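/- Theorem 2. Fix $M>0$ and $\alpha\in(0,1)$. Let $\mathcal F(M)$ be the set of functions $m(x)=m_1(x)\mathbf 1\{x\ge 0\}+m_0(x)\mathbf 1\{x<0\}$ with $m_0,m_1:\mathbb R\to\mathbb R$ twice continuously differentiable and $\|m_t''\|_\infty\le M$, and write $m_+$, $m_-$ for the right and left limits at $0$. Model. Let $h=h_n$ and $d=d_n$ be deterministic with $0\le d<h$. For every $n$ and every $\mu^*\in\mathcal F(M)$ we observe $(X_i,Y_i)$, $i\le n$, from an i.i.d. sample of $(Y_i(1),Y_i(0),X_i^*,X_i)$ with law $P=P_{n,\mu^*}$, where $Y_i(1),Y_i(0)$ are integrable, $\mathbb E[Y_i(t)|X_i^*=x]$ is continuous in $x$ for $t=0,1$, and $\mu^*(x)$ equals $\mathbb E[Y_i(1)|X_i^*=x]$ for $x\ge0$ and $\mathbb E[Y_i(0)|X_i^*=x]$ for $x<0$; almost surely $X_i=X_i^*$ if $|X_i^*|\ge d$ and $|X_i|<d$ if $|X_i^*|<d$; and $Y_i=Y_i(T_i)$ with $T_i=\mathbf 1\{X_i\ge0\}$. The parameter is $\tau^*=\mu^*_+-\mu^*_-$.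 Estimator and interval. $\hat\tau(h,d)=\sum_i w_i(h,d)Y_i$ is the coefficient of $T$ in the least squares regression of $Y_i$ on $(T_i,X_i,T_iX_i,1)$ with weights $K(X_i/h)\mathbf 1\{|X_i|\ge d\}$; the $w_i(h,d)$ depend only on $X_1,\dots,X_n$. The worst-case bias is $\bar b=-\frac M2\sum_i w_i(h,d)X_i^2\,\mathrm{sign}(X_i)$, the conditional variance is $s^2=\sum_i w_i(h,d)^2\sigma_i^2$ with $\sigma_i^2=\mathbb V(Y_i|X_i)$, and $\hat s^2=\sum_i w_i(h,d)^2\hat\sigma_i^2$ with $\hat\sigma_i^2$ functions of the observed data. With $\mathrm{cv}_{1-\alpha}(r)$ the $1-\alpha$ quantile of $|N(r,1)|$, let $C_n(d)=[\hat\tau(h,d)\pm \mathrm{cv}_{1-\alpha}(\bar b/\hat s)\,\hat s]$. Assumptions, with all constants independent of $n$ and $\mu^*$. (i) Either small donut asymptotics hold: $d=ch$ for some $c\in[0,1)$, $h\to0$, $nh\to\infty$, and $K$ does not vanish identically on $(c,1)$; or large donut asymptotics hold: $d$ is fixed, $h\to d$, $n(h-d)\to\infty$, and there is a constant $C_K$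 such that for all $c<1$ close enough to $1$, $\int_c^1K>0$ and $\sup_{[c,1]}K\le \frac{C_K}{1-c}\int_c^1K$ (as for the uniform, triangular and Epanechnikov kernels). (ii) $X_i$ has a density that on some open interval is continuous and bounded between two positive constants, the interval being the same for all $n$ and $\mu^*$ and containing $[-d,d]$ for all large $n$; for some $q>2$, $\mathbb E[|Y_i-\mathbb E[Y_i|X_i]|^q\,|X_i]$ exists and is bounded by a constant; $\mathbb V(Y_i|X_i=x)$ is $L$-Lipschitz in $x$ on either side of $0$ and bounded below by a positive constant on the support of $X_i$ without $0$; and $K$ is a bounded symmetric probability density, continuous on $[-1,1]$ and zero outside $[-1,1]$. (iii) $\hat s^2=s^2(1+o_P(1))$ uniformly over $\mathcal F(M)$, i.e. $\sup_{\mu^*\in\mathcal F(M)}P(|\hat s^2-s^2|>\varepsilon s^2)\to0$ for every $\varepsilon>0$. Conclusion: $$\liminf_{n\to\infty}\ \inf_{\mu^*\in\mathcal F(M)}P\big(\tau^*\in C_n(d)\big)\ \ge\ 1-\alpha .$$ -/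

import Mathlib

open MeasureTheory ProbabilityTheory Filter Topology Set

noncomputable section

namespace DonutRD

/-! ### Smoothness class and target parameter -/

/-- The class `F(M)`: functions that agree with a twice continuously differentiable function `m₁`
on `[0, ∞)` and with a twice continuously differentiable function `m₀` on `(-∞, 0)`, both with
second derivative bounded by `M` in absolute value. -/
def smoothClass (M : ℝ) : Set (ℝ → ℝ) :=
  {m | ∃ m₁ m₀ : ℝ → ℝ,
    ContDiff ℝ 2 m₁ ∧ ContDiff ℝ 2 m₀ ∧
    (∀ x, |iteratedDeriv 2 m₁ x| ≤ M) ∧ (∀ x, |iteratedDeriv 2 m₀ x| ≤ M) ∧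
    ∀ x, m x = if 0 ≤ x then m₁ x else m₀ x}

/-- The jump `m₊ - m₋` of a function at the threshold `0` (right limit minus left limit). -/
def jumpAtZero (m : ℝ → ℝ) : ℝ := Function.rightLim m 0 - Function.leftLim m 0

/-- If `m` is pieced together from two continuous conditional mean functions `g₁` (treated) and
`g₀` (untreated), its jump is the average treatment effect `g₁ 0 - g₀ 0` at the threshold. -/
theorem jumpAtZero_eq {m g₁ g₀ : ℝ → ℝ} (h₁ : Continuous g₁) (h₀ : Continuous g₀)
    (hm : ∀ x, m x = if 0 ≤ x then g₁ x else g₀ x) : jumpAtZero m = g₁ 0 - g₀ 0 := by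
  have hr : Tendsto m (𝓝[>] 0) (𝓝 (g₁ 0)) := by
    refine ((h₁.tendsto 0).mono_left nhdsWithin_le_nhds).congr' ?_
    filter_upwards [self_mem_nhdsWithin] with x hx
    rw [hm, if_pos (le_of_lt hx)]
  have hl : Tendsto m (𝓝[<] 0) (𝓝 (g₀ 0)) := by
    refine ((h₀.tendsto 0).mono_left nhdsWithin_le_nhds).congr' ?_
    filter_upwards [self_mem_nhdsWithin] with x hx
    rw [hm, if_neg (not_le.mpr hx)]
  rw [jumpAtZero, rightLim_eq_of_tendsto hr,
    leftLim_eq_of_tendsto hl]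

/-! ### Units and populations -/

/-- A unit: the quadruple `(Y(1), Y(0), X*, X)` of the two potential outcomes, the natural running
variable and the observed running variable. -/
abbrev RDUnit : Type := ℝ × ℝ × ℝ × ℝ

/-- Potential outcome `Y(1)` with treatment. -/
def outcome1 (u : RDUnit) : ℝ := u.1

/-- Potential outcome `Y(0)` without treatment. -/
def outcome0 (u : RDUnit) : ℝ := u.2.1

/-- Natural running variable `X*`. -/
def naturalX (u : RDUnit) : ℝ := u.2.2.1

/-- Observed running variable `X`. -/
def observedX (u : RDUnit) : ℝ := u.2.2.2

/-- Observed outcome `Y = Y(T)` with `T = 1{X ≥ 0}`. -/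
def outcome (u : RDUnit) : ℝ := if 0 ≤ observedX u then outcome1 u else outcome0 u

/-- The σ-algebra generated by the natural running variable. -/
abbrev naturalSigma : MeasurableSpace RDUnit := MeasurableSpace.comap naturalX inferInstance

/-- The σ-algebra generated by the observed running variable. -/
abbrev observedSigma : MeasurableSpace RDUnit := MeasurableSpace.comap observedX inferInstance

/-- The donut RD population model with donut size `d` and conditional mean function `m` (this is
`μ*`). The functions `g₁`, `g₀` are continuous versions of `x ↦ E[Y(t) | X* = x]`. -/
structure IsDonutModel (P : Measure RDUnit) (d : ℝ) (m : ℝ → ℝ) : Prop where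
  integrable_outcome1 : Integrable outcome1 P
  integrable_outcome0 : Integrable outcome0 P
  mean : ∃ g₁ g₀ : ℝ → ℝ, Continuous g₁ ∧ Continuous g₀ ∧
    P[outcome1 | naturalSigma] =ᵐ[P] (fun u => g₁ (naturalX u)) ∧
    P[outcome0 | naturalSigma] =ᵐ[P] (fun u => g₀ (naturalX u)) ∧
    ∀ x, m x = if 0 ≤ x then g₁ x else g₀ x
  outside : ∀ᵐ u ∂P, d ≤ |naturalX u| → observedX u = naturalX u
  inside : ∀ᵐ u ∂P, |naturalX u| < d → |observedX u| < d

/-- The observed running variable has a density that on the open interval `(a, b)` is continuous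
and takes values in `[lo, hi]`. -/
def HasRegularDensity (P : Measure RDUnit) (a b lo hi : ℝ) : Prop :=
  ∃ f : ℝ → ℝ, Measurable f ∧ (∀ x, 0 ≤ f x) ∧
    P.map observedX = volume.withDensity (fun x => ENNReal.ofReal (f x)) ∧
    ContinuousOn f (Ioo a b) ∧ ∀ x ∈ Ioo a b, lo ≤ f x ∧ f x ≤ hi

/-- Moment conditions: the conditional `q`-th absolute central moment of the observed outcome given
the observed running variable exists and is bounded by `C`; the conditional variance is `σsq X`,
where `σsq` is `L`-Lipschitz on either side of the threshold and at least `lo` on the support of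
the running variable, the threshold itself excepted. -/
structure HasRegularErrors (P : Measure RDUnit) (q C lo : ℝ) (L : NNReal) (σsq : ℝ → ℝ) :
    Prop where
  integrable : Integrable (fun u => |outcome u - (P[outcome | observedSigma]) u| ^ q) P
  bounded : ∀ᵐ u ∂P,
    (P[fun v => |outcome v - (P[outcome | observedSigma]) v| ^ q | observedSigma]) u ≤ C
  measurable : Measurable σsq
  variance : condVar observedSigma outcome P =ᵐ[P] fun u => σsq (observedX u)
  lipschitz_right : LipschitzOnWith L σsq ((P.map observedX).support ∩ Ioi 0)
  lipschitz_left : LipschitzOnWith L σsq ((P.map observedX).support ∩ Iio 0)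
  lower : ∀ x ∈ (P.map observedX).support \ {0}, lo ≤ σsq x

/-! ### Kernel -/

/-- A bounded symmetric density that is continuous on `[-1, 1]` and zero outside of it. -/
structure IsKernel (K : ℝ → ℝ) : Prop where
  nonneg : ∀ u, 0 ≤ K u
  integral_eq_one : ∫ u, K u = 1
  symmetric : ∀ u, K (-u) = K u
  bounded : ∃ B, ∀ u, K u ≤ B
  continuousOn : ContinuousOn K (Icc (-1) 1)
  zero_outside : ∀ u, u ∉ Icc (-1 : ℝ) 1 → K u = 0

/-- The kernel does not degenerate at the edge of its support: on short intervals `[c, 1]` it is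
not almost everywhere zero and it is at most a constant multiple of its average there. (True for
the uniform, triangular and Epanechnikov kernels, and whenever `K u` is of exact order `(1 - u) ^ p`
as `u` tends to `1` from below, for some `p ≥ 0`.) -/
def KernelRegularAtEdge (K : ℝ → ℝ) : Prop :=
  ∃ C : ℝ, ∀ᶠ c in 𝓝[<] (1 : ℝ),
    0 < ∫ u in c..1, K u ∧ ∀ u ∈ Icc c 1, (1 - c) * K u ≤ C * ∫ v in c..1, K v

/-! ### Asymptotic frameworks -/

/-- Small donut asymptotics: `d = c h` with `c ∈ [0, 1)`, `h → 0` and `n h → ∞`. -/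
structure SmallDonut (c : ℝ) (h d : ℕ → ℝ) : Prop where
  nonneg : 0 ≤ c
  lt_one : c < 1
  donut_eq : ∀ n, d n = c * h n
  bandwidth : Tendsto h atTop (𝓝 0)
  sampleSize : Tendsto (fun n : ℕ => (n : ℝ) * h n) atTop atTop

/-- Large donut asymptotics: `d` is fixed, `h → d` and `n (h - d) → ∞`. -/
structure LargeDonut (h d : ℕ → ℝ) : Prop where
  fixed : ∀ n k, d n = d k
  bandwidth : Tendsto h atTop (𝓝 (d 0))
  sampleSize : Tendsto (fun n : ℕ => (n : ℝ) * (h n - d n)) atTop atTop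

/-! ### The donut RD estimator -/

section Estimator

variable {n : ℕ}

/-- Regressor vector `(T, X, T X, 1)` with `T = 1{X ≥ 0}`. -/
def regressor (x : ℝ) : Fin 4 → ℝ :=
  ![if 0 ≤ x then 1 else 0, x, if 0 ≤ x then x else 0, 1]

/-- Kernel weight `K(x / h) 1{|x| ≥ d}` of an observation. -/
def kernelWeight (K : ℝ → ℝ) (h d x : ℝ) : ℝ := if d ≤ |x| then K (x / h) else 0

/-- The weighted least squares objective function of the donut RD regression. -/
def leastSquaresLoss (K : ℝ → ℝ) (h d : ℝ) (X Y : Fin n → ℝ) (β : Fin 4 → ℝ) : ℝ :=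
  ∑ i, kernelWeight K h d (X i) * (Y i - regressor (X i) ⬝ᵥ β) ^ 2

/-- Weighted Gram matrix of the regressors. -/
def gram (K : ℝ → ℝ) (h d : ℝ) (X : Fin n → ℝ) : Matrix (Fin 4) (Fin 4) ℝ :=
  ∑ i, kernelWeight K h d (X i) • Matrix.vecMulVec (regressor (X i)) (regressor (X i))

/-- The weighted least squares coefficient vector. -/
def coefficient (K : ℝ → ℝ) (h d : ℝ) (X Y : Fin n → ℝ) : Fin 4 → ℝ :=
  Matrix.mulVec (gram K h d X)⁻¹ (∑ i, (kernelWeight K h d (X i) * Y i) • regressor (X i))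

/-- The weights `wᵢ(h, d)` of the donut RD estimator, which depend on the running variable only. -/
def weight (K : ℝ → ℝ) (h d : ℝ) (X : Fin n → ℝ) (i : Fin n) : ℝ :=
  kernelWeight K h d (X i) * Matrix.mulVec (gram K h d X)⁻¹ (regressor (X i)) 0

/-- The local linear donut RD estimator `τ̂(h, d) = ∑ᵢ wᵢ(h, d) Yᵢ`. -/
def estimator (K : ℝ → ℝ) (h d : ℝ) (X Y : Fin n → ℝ) : ℝ :=
  ∑ i, weight K h d X i * Y i

/-- The estimator is the first entry of the least squares coefficient vector. -/
theorem estimator_eq_coefficient (K : ℝ → ℝ) (h d : ℝ) (X Y : Fin n → ℝ) :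
    estimator K h d X Y = coefficient K h d X Y 0 := by
  simp only [estimator, weight, coefficient, Matrix.mulVec_sum, Matrix.mulVec_smul,
    Finset.sum_apply, Pi.smul_apply, smul_eq_mul]
  exact Finset.sum_congr rfl fun i _ => by ring

theorem gram_mulVec (K : ℝ → ℝ) (h d : ℝ) (X : Fin n → ℝ) (β : Fin 4 → ℝ) :
    Matrix.mulVec (gram K h d X) β =
      ∑ i, (kernelWeight K h d (X i) * (regressor (X i) ⬝ᵥ β)) • regressor (X i) := by
  simp only [gram, Matrix.sum_mulVec, Matrix.smul_mulVec, Matrix.vecMulVec_mulVec]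
  refine Finset.sum_congr rfl fun i _ => ?_
  ext j
  simp
  ring

/-- When the Gram matrix is invertible, the least squares coefficient vector is the unique
minimizer of the objective function, so that the estimator is the first entry of the argmin. -/
theorem isMinOn_leastSquaresLoss_iff {K : ℝ → ℝ} (hK : ∀ u, 0 ≤ K u) (h d : ℝ)
    (X Y : Fin n → ℝ) (hG : IsUnit (gram K h d X).det) (β : Fin 4 → ℝ) :
    IsMinOn (leastSquaresLoss K h d X Y) univ β ↔ β = coefficient K h d X Y := by
  have hk : ∀ i, 0 ≤ kernelWeight K h d (X i) := fun i => by
    unfold kernelWeight; split_ifs; exacts [hK _, le_rfl]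
  have expand : ∀ β γ : Fin 4 → ℝ, leastSquaresLoss K h d X Y (β + γ) =
      leastSquaresLoss K h d X Y β
        + 2 * ((Matrix.mulVec (gram K h d X) β
            - ∑ i, (kernelWeight K h d (X i) * Y i) • regressor (X i)) ⬝ᵥ γ)
        + ∑ i, kernelWeight K h d (X i) * (regressor (X i) ⬝ᵥ γ) ^ 2 := by
    intro β γ
    rw [gram_mulVec, ← Finset.sum_sub_distrib, sum_dotProduct, Finset.mul_sum]
    simp only [leastSquaresLoss]
    rw [← Finset.sum_add_distrib, ← Finset.sum_add_distrib]
    refine Finset.sum_congr rfl fun i _ => ?_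
    rw [dotProduct_add, sub_dotProduct, smul_dotProduct, smul_dotProduct]
    simp only [smul_eq_mul]
    ring
  have normal : Matrix.mulVec (gram K h d X) (coefficient K h d X Y) =
      ∑ i, (kernelWeight K h d (X i) * Y i) • regressor (X i) := by
    rw [coefficient, Matrix.mulVec_mulVec, Matrix.mul_nonsing_inv _ hG, Matrix.one_mulVec]
  constructor
  · intro hmin
    set r := Matrix.mulVec (gram K h d X) β
      - ∑ i, (kernelWeight K h d (X i) * Y i) • regressor (X i) with hr
    set A := ∑ i, kernelWeight K h d (X i) * (regressor (X i) ⬝ᵥ r) ^ 2 with hA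
    have hA0 : 0 ≤ A := Finset.sum_nonneg fun i _ => mul_nonneg (hk i) (sq_nonneg _)
    have key : ∀ t : ℝ, 0 ≤ 2 * (t * (r ⬝ᵥ r)) + t ^ 2 * A := by
      intro t
      have h1 := isMinOn_iff.mp hmin (β + t • r) (mem_univ _)
      rw [expand β (t • r), ← hr, dotProduct_smul] at h1
      have h2 : ∑ i, kernelWeight K h d (X i) * (regressor (X i) ⬝ᵥ (t • r)) ^ 2 = t ^ 2 * A := by
        rw [hA, Finset.mul_sum]
        refine Finset.sum_congr rfl fun i _ => ?_
        rw [dotProduct_smul, smul_eq_mul]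
        ring
      rw [h2, smul_eq_mul] at h1
      linarith
    have hrr : r ⬝ᵥ r = 0 := by
      have hrr0 : 0 ≤ r ⬝ᵥ r := Finset.sum_nonneg fun i _ => mul_self_nonneg _
      have h3 := key (-(r ⬝ᵥ r) / (A + 1))
      have hpos : 0 < A + 1 := by linarith
      have h4 : 2 * (-(r ⬝ᵥ r) / (A + 1) * (r ⬝ᵥ r)) + (-(r ⬝ᵥ r) / (A + 1)) ^ 2 * A
          = -((r ⬝ᵥ r) ^ 2 * (A + 2)) / (A + 1) ^ 2 := by
        field_simp
        ring
      rw [h4] at h3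
      have h5 : 0 ≤ -((r ⬝ᵥ r) ^ 2 * (A + 2)) := by
        by_contra hneg
        exact absurd h3 (not_le.mpr (div_neg_of_neg_of_pos (not_le.mp hneg) (by positivity)))
      nlinarith [sq_nonneg (r ⬝ᵥ r)]
    have hr0 : r = 0 := dotProduct_self_eq_zero.mp hrr
    have h6 := sub_eq_zero.mp (hr.symm.trans hr0)
    rw [coefficient, ← h6, Matrix.mulVec_mulVec, Matrix.nonsing_inv_mul _ hG, Matrix.one_mulVec]
  · rintro rfl
    refine isMinOn_iff.mpr fun γ _ => ?_
    have h1 := expand (coefficient K h d X Y) (γ - coefficient K h d X Y)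
    rw [add_sub_cancel, normal, sub_self, zero_dotProduct] at h1
    rw [h1]
    have : 0 ≤ ∑ i, kernelWeight K h d (X i)
        * (regressor (X i) ⬝ᵥ (γ - coefficient K h d X Y)) ^ 2 :=
      Finset.sum_nonneg fun i _ => mul_nonneg (hk i) (sq_nonneg _)
    linarith

/-! ### The bias-aware confidence interval -/

/-- Worst-case conditional bias `b̄(h, d) = -(M / 2) ∑ᵢ wᵢ(h, d) Xᵢ² sign(Xᵢ)`. -/
def worstCaseBias (K : ℝ → ℝ) (M h d : ℝ) (X : Fin n → ℝ) : ℝ :=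
  -(M / 2) * ∑ i, weight K h d X i * X i ^ 2 * Real.sign (X i)

/-- `∑ᵢ wᵢ(h, d)² vᵢ`: the conditional variance of the estimator if `vᵢ = σᵢ²`, and its estimate
if `vᵢ` is an estimate of `σᵢ²`. -/
def varianceOf (K : ℝ → ℝ) (h d : ℝ) (X v : Fin n → ℝ) : ℝ :=
  ∑ i, weight K h d X i ^ 2 * v i

/-- `cv_p(r)`: the `p`-quantile of `|N(r, 1)|`. -/
def criticalValue (p r : ℝ) : ℝ :=
  sInf {t : ℝ | p ≤ ((gaussianReal r 1).map (fun x => |x|)).real (Iic t)}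

/-- The interval `[τ̂(h, d) ± cv_{1-α}(b̄(h, d) / ŝ(h, d)) ŝ(h, d)]`, where `v` contains the
estimates of the conditional variances `σᵢ²`, and `ŝ²(h, d) = ∑ᵢ wᵢ(h, d)² vᵢ`. -/
def confidenceInterval (K : ℝ → ℝ) (M α h d : ℝ) (X Y v : Fin n → ℝ) : Set ℝ :=
  let s := Real.sqrt (varianceOf K h d X v)
  let r := criticalValue (1 - α) (worstCaseBias K M h d X / s) * s
  Icc (estimator K h d X Y - r) (estimator K h d X Y + r)

end Estimator

/-! ### Samples -/

/-- Law of an i.i.d. sample of size `n` from the population `P`. -/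
def sampleLaw (n : ℕ) (P : Measure RDUnit) : Measure (Fin n → RDUnit) :=
  Measure.pi fun _ => P

/-- Observed running variables of a sample. -/
def sampleX {n : ℕ} (ω : Fin n → RDUnit) : Fin n → ℝ := fun i => observedX (ω i)

/-- Observed outcomes of a sample. -/
def sampleY {n : ℕ} (ω : Fin n → RDUnit) : Fin n → ℝ := fun i => outcome (ω i)

/-- Observed data `(Xᵢ, Yᵢ)` of a sample. -/
def sampleData {n : ℕ} (ω : Fin n → RDUnit) : Fin n → ℝ × ℝ :=
  fun i => (observedX (ω i), outcome (ω i))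

end DonutRD

end

/-! Outside the donut the observed and the natural running variable agree, and observations inside
it get weight zero. Given the running variables, `τ̂ - τ*` is therefore a bias `∑ wᵢ μ*(Xᵢ) - τ*`
plus a weighted sum of independent centred errors with variance `s²`.

The bias is at most `b̄` in absolute value (`abs_sum_weight_mul_sub_jump_le`). On each side of the
threshold the weights are a nonnegative kernel times an affine function, sum to `1` (after a sign
change on the left) and annihilate linear functions. Such weights integrate a convex function
vanishing at `0` to at most zero, and `M x² / 2 ± (m x - m 0)` is convex for either smooth piece
`m`.

The error sum is approximately normal by Lindeberg's replacement method, with an error controlled by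
the model constants alone, once no squared weight is more than a small fraction of their sum
(`exists_gaussian_approximation_weighted`). An affine function cannot be small, relative to its
value elsewhere in the window, on both of two separated regions. So if both regions hold many
observations and the kernel is large there, no weight dominates (`sq_weight_le_of_count`). Either
asymptotic framework supplies such regions, whose expected counts grow like `n (h - d)`; Chebyshev's
inequality bounds the actual counts using only the lower density bound
(`WindowAsymptotics.eventually_weights`), hence uniformly over the populations.

With the true `s`, conditional coverage is thus nearly the standard normal mass of an interval of
half-length `cv(b̄ / s)` shifted by bias over `s`. This mass decreases with the size of the shift
and is still at least the nominal level at shift `b̄ / s`. Replacing `s` by `ŝ` costs little because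
dilating an interval by a factor near one changes its normal mass little, uniformly over all
intervals; this matters as `b̄ / s` need not be bounded (`exists_criticalValue_mul_le`). -/

namespace DonutRD

/-! ### Lindeberg replacement -/

/-- Bounded measurable functions with a second order expansion at every point whose remainder is at
most `B |y| ^ r`. -/
def HasTaylorBound (r B : ℝ) (f : ℝ → ℝ) : Prop :=
  Measurable f ∧ ∃ a b : ℝ → ℝ, ∃ D : ℝ, Measurable a ∧ Measurable b ∧
    (∀ x, |f x| ≤ D) ∧ (∀ x, |a x| ≤ D) ∧ (∀ x, |b x| ≤ D) ∧
    ∀ x y, |f (x + y) - f x - a x * y - b x * y ^ 2| ≤ B * |y| ^ r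

theorem integrable_comp_add {μ : Measure ℝ} [IsFiniteMeasure μ] {g : ℝ → ℝ} {D : ℝ}
    (hg : Measurable g) (hD : ∀ x, |g x| ≤ D) (x : ℝ) : Integrable (fun z => g (x + z)) μ :=
  Integrable.of_bound (hg.comp (measurable_const_add x)).aestronglyMeasurable D
    (ae_of_all _ fun z => by simpa using hD (x + z))

theorem measurable_integral_comp_add {μ : Measure ℝ} [SFinite μ] {g : ℝ → ℝ} (hg : Measurable g) :
    Measurable fun x => ∫ z, g (x + z) ∂μ := by
  refine (StronglyMeasurable.integral_prod_right (f := fun x z => g (x + z)) ?_).measurable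
  exact (hg.comp (measurable_fst.add measurable_snd)).stronglyMeasurable

theorem abs_integral_comp_add_le {μ : Measure ℝ} [IsProbabilityMeasure μ] {g : ℝ → ℝ} {D : ℝ}
    (hD : ∀ x, |g x| ≤ D) (x : ℝ) : |∫ z, g (x + z) ∂μ| ≤ D := by
  simpa using norm_integral_le_of_norm_le_const (μ := μ) (f := fun z => g (x + z))
    (ae_of_all _ fun z => by simpa using hD (x + z))

/-- The expansion is integrated term by term. Keeping the same `B` after averaging over an
independent summand is what makes the replacement argument an induction. -/
theorem HasTaylorBound.translate_integral {r B : ℝ} {f : ℝ → ℝ} (hf : HasTaylorBound r B f)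
    (μ : Measure ℝ) [IsProbabilityMeasure μ] :
    HasTaylorBound r B (fun x => ∫ z, f (x + z) ∂μ) := by
  obtain ⟨hfm, a, b, D, ha, hb, hfD, haD, hbD, hT⟩ := hf
  refine ⟨measurable_integral_comp_add hfm, fun x => ∫ z, a (x + z) ∂μ,
    fun x => ∫ z, b (x + z) ∂μ, D, measurable_integral_comp_add ha,
    measurable_integral_comp_add hb, abs_integral_comp_add_le hfD, abs_integral_comp_add_le haD,
    abs_integral_comp_add_le hbD, fun x y => ?_⟩
  have i1 := integrable_comp_add (μ := μ) hfm hfD x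
  have i2 := integrable_comp_add (μ := μ) hfm hfD (x + y)
  have i3 := (integrable_comp_add (μ := μ) ha haD x).mul_const y
  have i4 := (integrable_comp_add (μ := μ) hb hbD x).mul_const (y ^ 2)
  beta_reduce
  have i5 : Integrable (fun z => f (x + y + z) - f (x + z)) μ := i2.sub i1
  have i6 : Integrable (fun z => f (x + y + z) - f (x + z) - a (x + z) * y) μ := i5.sub i3
  rw [← integral_mul_const, ← integral_mul_const, ← integral_sub i2 i1,
    ← integral_sub i5 i3, ← integral_sub i6 i4]
  have := norm_integral_le_of_norm_le_const (μ := μ) (C := B * |y| ^ r)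
    (f := fun z => f (x + y + z) - f (x + z) - a (x + z) * y - b (x + z) * y ^ 2)
    (ae_of_all _ fun z => by
      have := hT (x + z) y
      rw [Real.norm_eq_abs]
      convert this using 4
      ring_nf)
  simpa using this

theorem integrable_sq_of_rpow {μ : Measure ℝ} [IsFiniteMeasure μ] {r : ℝ} (hr : 2 ≤ r)
    (h : Integrable (fun y => |y| ^ r) μ) : Integrable (fun y => y ^ 2) μ := by
  refine ((integrable_const (1 : ℝ)).add h).mono' (by fun_prop) (ae_of_all _ fun y => ?_)
  rw [Real.norm_eq_abs, abs_of_nonneg (sq_nonneg y), ← sq_abs, Pi.add_apply]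
  rcases le_total |y| 1 with h1 | h1
  · have : |y| ^ 2 ≤ 1 := pow_le_one₀ (abs_nonneg y) h1
    have : 0 ≤ |y| ^ r := by positivity
    linarith
  · have : |y| ^ 2 ≤ |y| ^ r := by
      rw [← Real.rpow_natCast]; exact Real.rpow_le_rpow_of_exponent_le h1 (by simpa using hr)
    linarith

theorem integrable_id_of_sq {μ : Measure ℝ} [IsFiniteMeasure μ]
    (h : Integrable (fun y => y ^ 2) μ) : Integrable (fun y => y) μ := by
  refine ((integrable_const (1 : ℝ)).add h).mono' (by fun_prop) (ae_of_all _ fun y => ?_)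
  rw [Real.norm_eq_abs, Pi.add_apply]
  nlinarith [sq_nonneg (|y| - 1), abs_nonneg y, sq_abs y]

/-- The two laws share mean and second moment, so the quadratic Taylor polynomials cancel and only
the remainders survive. -/
theorem HasTaylorBound.abs_integral_sub_le {r B : ℝ} {f : ℝ → ℝ} (hf : HasTaylorBound r B f)
    (hr : 2 ≤ r) {μ ν : Measure ℝ} [IsProbabilityMeasure μ] [IsProbabilityMeasure ν]
    (hμ : Integrable (fun y => |y| ^ r) μ) (hν : Integrable (fun y => |y| ^ r) ν)
    (h1 : ∫ y, y ∂μ = ∫ y, y ∂ν) (h2 : ∫ y, y ^ 2 ∂μ = ∫ y, y ^ 2 ∂ν) (x : ℝ) :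
    |∫ y, f (x + y) ∂μ - ∫ y, f (x + y) ∂ν| ≤ B * (∫ y, |y| ^ r ∂μ + ∫ y, |y| ^ r ∂ν) := by
  obtain ⟨hfm, a, b, D, ha, hb, hfD, haD, hbD, hT⟩ := hf
  have key : ∀ (ρ : Measure ℝ) [IsProbabilityMeasure ρ], Integrable (fun y => |y| ^ r) ρ →
      |∫ y, f (x + y) ∂ρ - (f x + a x * ∫ y, y ∂ρ + b x * ∫ y, y ^ 2 ∂ρ)| ≤
        B * ∫ y, |y| ^ r ∂ρ := by
    intro ρ _ hρ
    have i0 := integrable_comp_add (μ := ρ) hfm hfD x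
    have s2 := integrable_sq_of_rpow hr hρ
    have i2 := s2.const_mul (b x)
    have i1 := (integrable_id_of_sq s2).const_mul (a x)
    have e : ∫ y, f (x + y) ∂ρ - (f x + a x * ∫ y, y ∂ρ + b x * ∫ y, y ^ 2 ∂ρ) =
        ∫ y, (f (x + y) - f x - a x * y - b x * y ^ 2) ∂ρ := by
      have i3 : Integrable (fun y => f (x + y) - f x) ρ := i0.sub (integrable_const _)
      have i4 : Integrable (fun y => f (x + y) - f x - a x * y) ρ := i3.sub i1
      rw [integral_sub i4 i2, integral_sub i3 i1, integral_sub i0 (integrable_const _),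
        integral_const_mul, integral_const_mul]
      simp
      ring
    rw [e, ← integral_const_mul]
    refine (abs_integral_le_integral_abs).trans (integral_mono_of_nonneg
      (ae_of_all _ fun _ => abs_nonneg _) (hρ.const_mul B) (ae_of_all _ fun y => hT x y))
  have k1 := key μ hμ
  have k2 := key ν hν
  rw [h1, h2] at k1
  rw [abs_le] at *
  constructor <;> linarith [k1.1, k1.2, k2.1, k2.2]

theorem integrable_rpow_gaussianReal (v : NNReal) {r : ℝ} (hr : 0 ≤ r) :
    Integrable (fun y => |y| ^ r) (gaussianReal 0 v) := by
  have := (memLp_id_gaussianReal (μ := 0) (v := v) r.toNNReal).integrable_norm_rpow'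
  simpa [hr] using this

theorem integral_sq_gaussianReal (v : NNReal) : ∫ y, y ^ 2 ∂(gaussianReal 0 v) = v := by
  have h := variance_fun_id_gaussianReal (μ := 0) (v := v)
  rw [variance_eq_integral (by fun_prop)] at h
  simpa using h

/-- The Lindeberg replacement bound. -/
theorem HasTaylorBound.abs_integral_sum_sub_gaussian_le {ι Ω : Type*} [MeasurableSpace Ω]
    {Q : Measure Ω} [IsProbabilityMeasure Q] {ξ : ι → Ω → ℝ} (hξ : ∀ i, Measurable (ξ i))
    (hind : iIndepFun ξ Q) {r B : ℝ} (hr : 2 ≤ r)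
    (hint : ∀ i, Integrable (fun ω => |ξ i ω| ^ r) Q) (hmean : ∀ i, ∫ ω, ξ i ω ∂Q = 0)
    (v : ι → NNReal) (hvar : ∀ i, ∫ ω, ξ i ω ^ 2 ∂Q = v i) (s : Finset ι) :
    ∀ {f : ℝ → ℝ}, HasTaylorBound r B f →
    |∫ ω, f (∑ i ∈ s, ξ i ω) ∂Q - ∫ y, f y ∂(gaussianReal 0 (∑ i ∈ s, v i))| ≤
      B * ∑ i ∈ s, (∫ ω, |ξ i ω| ^ r ∂Q + ∫ y, |y| ^ r ∂(gaussianReal 0 (v i))) := by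
  classical
  -- The test function stays universally quantified: the induction hypothesis is used for the
  -- averaged function `g`, not for `f`.
  induction s using Finset.induction_on with
  | empty => intro f hf; simp
  | insert i s his ih =>
    intro f hf
    have hμ : IsProbabilityMeasure (Q.map (ξ i)) := Measure.isProbabilityMeasure_map (hξ i).aemeasurable
    have hS : Measurable (fun ω => ∑ j ∈ s, ξ j ω) := Finset.measurable_sum _ fun j _ => hξ j
    have hμS : IsProbabilityMeasure (Q.map (fun ω => ∑ j ∈ s, ξ j ω)) :=
      Measure.isProbabilityMeasure_map hS.aemeasurable
    obtain ⟨D, hD⟩ : ∃ D, ∀ x, |f x| ≤ D := by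
      obtain ⟨_, a, b, D, _, _, h, _⟩ := hf; exact ⟨D, h⟩
    have hfi : ∀ (ρ : Measure ℝ) [IsProbabilityMeasure ρ], Integrable f ρ := fun ρ _ => by
      simpa using integrable_comp_add (μ := ρ) hf.1 hD 0
    -- Integrating out the new summand turns the longer sum into the shorter one tested against `g`;
    -- `ih` makes the shorter sum Gaussian, and `e3` then replaces the new summand.
    set g : ℝ → ℝ := fun x => ∫ z, f (x + z) ∂(Q.map (ξ i)) with hg
    have hgT : HasTaylorBound r B g := hf.translate_integral _
    have e1 : ∫ ω, f (∑ j ∈ insert i s, ξ j ω) ∂Q = ∫ ω, g (∑ j ∈ s, ξ j ω) ∂Q := by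
      have hI : (fun ω => ∑ j ∈ s, ξ j ω) ⟂ᵢ[Q] ξ i := by
        have := hind.indepFun_finsetSum_of_notMem hξ his
        convert this using 1
        ext ω; simp
      have hc := hI.map_add_eq_map_conv_map hS (hξ i)
      have : ∫ ω, f (∑ j ∈ insert i s, ξ j ω) ∂Q =
          ∫ y, f y ∂(Q.map ((fun ω => ∑ j ∈ s, ξ j ω) + ξ i)) := by
        rw [integral_map (hS.add (hξ i)).aemeasurable hf.1.aestronglyMeasurable]
        refine integral_congr_ae (ae_of_all _ fun ω => ?_)
        simp only [Finset.sum_insert his, Pi.add_apply]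
        rw [add_comm]
      rw [this, hc, integral_conv (hfi _), integral_map hS.aemeasurable]
      exact hgT.1.aestronglyMeasurable
    have e2 : ∫ y, f y ∂(gaussianReal 0 (∑ j ∈ insert i s, v j)) =
        ∫ x, (∫ z, f (x + z) ∂(gaussianReal 0 (v i))) ∂(gaussianReal 0 (∑ j ∈ s, v j)) := by
      rw [Finset.sum_insert his, add_comm]
      have : gaussianReal 0 (∑ j ∈ s, v j + v i) =
          gaussianReal 0 (∑ j ∈ s, v j) ∗ gaussianReal 0 (v i) := by
        rw [gaussianReal_conv_gaussianReal]; simp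
      rw [this, integral_conv (hfi _)]
    have e3 : |∫ x, g x ∂(gaussianReal 0 (∑ j ∈ s, v j)) -
        ∫ x, (∫ z, f (x + z) ∂(gaussianReal 0 (v i))) ∂(gaussianReal 0 (∑ j ∈ s, v j))| ≤
        B * (∫ ω, |ξ i ω| ^ r ∂Q + ∫ y, |y| ^ r ∂(gaussianReal 0 (v i))) := by
      have hgi : ∀ (h : ℝ → ℝ), HasTaylorBound r B h →
          Integrable h (gaussianReal 0 (∑ j ∈ s, v j)) := by
        rintro h ⟨hm, a, b, D', _, _, hD', _⟩
        simpa using integrable_comp_add (μ := gaussianReal 0 (∑ j ∈ s, v j)) hm hD' 0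
      rw [← integral_sub (hgi _ hgT) (hgi _ (hf.translate_integral _))]
      have hm : AEStronglyMeasurable (fun y : ℝ => |y| ^ r) (Q.map (ξ i)) :=
        (measurable_norm.pow_const r).aestronglyMeasurable
      have := norm_integral_le_of_norm_le_const (μ := gaussianReal 0 (∑ j ∈ s, v j))
        (f := fun x => g x - ∫ z, f (x + z) ∂(gaussianReal 0 (v i)))
        (C := B * (∫ ω, |ξ i ω| ^ r ∂Q + ∫ y, |y| ^ r ∂(gaussianReal 0 (v i))))
        (ae_of_all _ fun x => by
          have := hf.abs_integral_sub_le hr (μ := Q.map (ξ i)) (ν := gaussianReal 0 (v i))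
            ((integrable_map_measure hm (hξ i).aemeasurable).2 (hint i))
            (integrable_rpow_gaussianReal _ (by linarith)) (by
              rw [integral_map (hξ i).aemeasurable (by fun_prop), hmean i]; simp) (by
              rw [integral_map (hξ i).aemeasurable (by fun_prop), hvar i,
                integral_sq_gaussianReal]) x
          rw [integral_map (φ := ξ i) (f := fun y : ℝ => |y| ^ r) (hξ i).aemeasurable hm] at this
          simpa [hg] using this)
      simpa using this
    rw [e1, e2, Finset.sum_insert his, mul_add]
    have := ih hgT
    rw [abs_le] at *
    constructor <;> linarith [this.1, this.2, e3.1, e3.2]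

/-! ### Smooth step functions as test functions. -/

theorem taylorWithinEval_two {f : ℝ → ℝ} (hf : ContDiff ℝ 3 f) {x z : ℝ} (h : x ≠ z) :
    taylorWithinEval f 2 (uIcc x z) x z =
      f x + deriv f x * (z - x) + iteratedDeriv 2 f x / 2 * (z - x) ^ 2 := by
  have hu := uniqueDiffOn_uIcc h
  have hx : x ∈ uIcc x z := left_mem_uIcc
  rw [taylorWithinEval_succ, taylorWithinEval_succ, taylor_within_zero_eval,
    iteratedDerivWithin_eq_iteratedDeriv hu ((hf.of_le (by norm_num)).contDiffAt) hx,
    iteratedDerivWithin_eq_iteratedDeriv hu ((hf.of_le (by norm_num)).contDiffAt) hx]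
  simp [iteratedDeriv_one]
  ring

theorem taylorWithinEval_one {f : ℝ → ℝ} (hf : ContDiff ℝ 3 f) {x z : ℝ} (h : x ≠ z) :
    taylorWithinEval f 1 (uIcc x z) x z = f x + deriv f x * (z - x) := by
  have hu := uniqueDiffOn_uIcc h
  have hx : x ∈ uIcc x z := left_mem_uIcc
  rw [taylorWithinEval_succ, taylor_within_zero_eval,
    iteratedDerivWithin_eq_iteratedDeriv hu ((hf.of_le (by norm_num)).contDiffAt) hx]
  simp [iteratedDeriv_one, mul_comm]

/-- For `|y| ≤ 1` the third order remainder is used with `|y| ^ 3 ≤ |y| ^ r`; for `|y| ≥ 1` the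
second order one with `|y| ^ 2 ≤ |y| ^ r`. This is where `2 ≤ r ≤ 3` comes from. -/
theorem hasTaylorBound_of_contDiff {f : ℝ → ℝ} (hf : ContDiff ℝ 3 f) {D r : ℝ}
    (hD : ∀ k ≤ 3, ∀ x, |iteratedDeriv k f x| ≤ D) (hr : 2 ≤ r) (hr' : r ≤ 3) :
    HasTaylorBound r D f := by
  have hD0 : 0 ≤ D := (abs_nonneg _).trans (hD 0 (by norm_num) 0)
  refine ⟨hf.continuous.measurable, deriv f, fun x => iteratedDeriv 2 f x / 2, D,
    (hf.continuous_deriv (by norm_num)).measurable,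
    ((hf.continuous_iteratedDeriv 2 (by norm_num)).div_const 2).measurable,
    by simpa using hD 0 (by norm_num),
    by simpa [iteratedDeriv_one] using hD 1 (by norm_num), fun x => ?_, fun x y => ?_⟩
  · have := hD 2 (by norm_num) x
    rw [abs_div, abs_two]
    linarith [abs_nonneg (iteratedDeriv 2 f x)]
  rcases eq_or_ne y 0 with rfl | hy
  · have : (0 : ℝ) ≤ D * |0| ^ r := by positivity
    simpa using this
  have hne : x ≠ x + y := by simpa using hy
  rcases le_total |y| 1 with h1 | h1
  · obtain ⟨x', -, h⟩ := taylor_mean_remainder_lagrange_iteratedDeriv (n := 2) hne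
      (hf.contDiffOn.of_le (by norm_num))
    rw [taylorWithinEval_two hf hne, add_sub_cancel_left] at h
    have e : f (x + y) - f x - deriv f x * y - iteratedDeriv 2 f x / 2 * y ^ 2 =
        iteratedDeriv 3 f x' * y ^ 3 / 6 := by
      have : ((2 + 1).factorial : ℝ) = 6 := by norm_num [Nat.factorial]
      rw [this] at h
      linarith
    rw [e, abs_div, abs_mul, abs_pow]
    have h3 : |y| ^ 3 ≤ |y| ^ r := by
      rw [← Real.rpow_natCast]
      exact Real.rpow_le_rpow_of_exponent_ge (abs_pos.2 hy) h1 (by simpa using hr')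
    have := mul_le_mul (hD 3 le_rfl x') h3 (by positivity) hD0
    have h6 : |(6 : ℝ)| = 6 := by norm_num
    have : 0 ≤ |iteratedDeriv 3 f x'| * |y| ^ 3 := by positivity
    rw [h6]
    linarith
  · obtain ⟨x', -, h⟩ := taylor_mean_remainder_lagrange_iteratedDeriv (n := 1) hne
      (hf.contDiffOn.of_le (by norm_num))
    rw [taylorWithinEval_one hf hne, add_sub_cancel_left] at h
    have e : f (x + y) - f x - deriv f x * y - iteratedDeriv 2 f x / 2 * y ^ 2 =
        (iteratedDeriv 2 f x' - iteratedDeriv 2 f x) / 2 * y ^ 2 := by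
      have : ((1 + 1).factorial : ℝ) = 2 := by norm_num [Nat.factorial]
      rw [this] at h
      norm_num at h
      linarith
    rw [e, abs_mul, abs_pow]
    have h3 : |y| ^ 2 ≤ |y| ^ r := by
      rw [← Real.rpow_natCast]
      exact Real.rpow_le_rpow_of_exponent_le h1 (by simpa using hr)
    have h4 : |(iteratedDeriv 2 f x' - iteratedDeriv 2 f x) / 2| ≤ D := by
      have a1 := abs_le.1 (hD 2 (by norm_num) x')
      have a2 := abs_le.1 (hD 2 (by norm_num) x)
      rw [abs_le]; constructor <;> linarith [a1.1, a1.2, a2.1, a2.2]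
    exact mul_le_mul h4 h3 (by positivity) hD0

/-- The function is locally constant off `[0, 1]`, and `[0, 1]` is compact. -/
theorem exists_bound_iteratedDeriv_smoothTransition (k : ℕ) :
    ∃ D, ∀ x, |iteratedDeriv k Real.smoothTransition x| ≤ D := by
  have hc : Continuous (iteratedDeriv k Real.smoothTransition) :=
    (Real.smoothTransition.contDiff (n := (k : ℕ∞))).continuous_iteratedDeriv k (by simp)
  obtain ⟨D, hD⟩ := isCompact_Icc.exists_bound_of_continuousOn (s := Icc (0 : ℝ) 1) hc.continuousOn
  refine ⟨max D 1, fun x => ?_⟩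
  have hk : ∀ c : ℝ, |c| ≤ 1 → |iteratedDeriv k (fun _ : ℝ => c) x| ≤ max D 1 := fun c hc => by
    rw [iteratedDeriv_const]
    split_ifs
    · exact hc.trans (le_max_right _ _)
    · simp
  rcases lt_or_ge x 0 with h0 | h0
  · have : Real.smoothTransition =ᶠ[𝓝 x] fun _ => (0 : ℝ) := by
      filter_upwards [Iio_mem_nhds h0] with z hz using Real.smoothTransition.zero_of_nonpos hz.le
    rw [this.iteratedDeriv_eq]
    exact hk 0 (by simp)
  rcases lt_or_ge 1 x with h1 | h1
  · have : Real.smoothTransition =ᶠ[𝓝 x] fun _ => (1 : ℝ) := by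
      filter_upwards [Ioi_mem_nhds h1] with z hz using
        Real.smoothTransition.one_of_one_le (le_of_lt hz)
    rw [this.iteratedDeriv_eq]
    exact hk 1 (by simp)
  · exact (hD x ⟨h0, h1⟩).trans (le_max_left _ _)

theorem exists_hasTaylorBound_smoothTransition {r : ℝ} (hr : 2 ≤ r) (hr' : r ≤ 3) :
    ∃ B, 0 ≤ B ∧ HasTaylorBound r B Real.smoothTransition := by
  choose D hD using exists_bound_iteratedDeriv_smoothTransition
  have h0 : ∀ k, 0 ≤ D k := fun k => (abs_nonneg _).trans (hD k 0)
  refine ⟨∑ k ∈ Finset.range 4, D k, Finset.sum_nonneg fun k _ => h0 k,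
    hasTaylorBound_of_contDiff (Real.smoothTransition.contDiff (n := 3)) (fun k hk x => ?_) hr hr'⟩
  exact (hD k x).trans (Finset.single_le_sum (fun k _ => h0 k) (by simp; omega))

/-- The factor `|c| ^ r` is the price of a steep step: approximating an indicator within `δ` takes
`|c| = δ⁻¹`. -/
theorem HasTaylorBound.comp_affine {r B : ℝ} {f : ℝ → ℝ} (hf : HasTaylorBound r B f) (c e : ℝ) :
    HasTaylorBound r (B * |c| ^ r) (fun x => f (c * x + e)) := by
  obtain ⟨hfm, a, b, D, ha, hb, hfD, haD, hbD, hT⟩ := hf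
  have hD0 : 0 ≤ D := (abs_nonneg _).trans (hfD 0)
  have hm : Measurable fun x : ℝ => c * x + e := by fun_prop
  refine ⟨hfm.comp hm, fun x => c * a (c * x + e), fun x => c ^ 2 * b (c * x + e),
    D + |c| * D + c ^ 2 * D, (ha.comp hm).const_mul _, (hb.comp hm).const_mul _, fun x => ?_,
    fun x => ?_, fun x => ?_, fun x y => ?_⟩
  · have := hfD (c * x + e)
    have : 0 ≤ |c| * D := by positivity
    have : 0 ≤ c ^ 2 * D := by positivity
    linarith
  · rw [abs_mul]
    have := mul_le_mul_of_nonneg_left (haD (c * x + e)) (abs_nonneg c)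
    have : 0 ≤ c ^ 2 * D := by positivity
    linarith
  · rw [abs_mul, abs_of_nonneg (sq_nonneg c)]
    have := mul_le_mul_of_nonneg_left (hbD (c * x + e)) (sq_nonneg c)
    have : 0 ≤ |c| * D := by positivity
    linarith
  · have := hT (c * x + e) (c * y)
    rw [abs_mul c y, Real.mul_rpow (abs_nonneg _) (abs_nonneg _)] at this
    rw [mul_assoc B]
    refine le_trans (le_of_eq ?_) this
    ring_nf

/-! ### Standard normal probabilities -/

theorem gaussianReal_real_Ioc {x y : ℝ} (h : x ≤ y) :
    (gaussianReal 0 1).real (Ioc x y) = ∫ z in x..y, gaussianPDFReal 0 1 z := by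
  rw [measureReal_def, gaussianReal_apply_eq_integral _ one_ne_zero,
    intervalIntegral.integral_of_le h, ENNReal.toReal_ofReal]
  exact integral_nonneg fun z => gaussianPDFReal_nonneg _ _ _

theorem intervalIntegrable_gaussianPDFReal (x y : ℝ) :
    IntervalIntegrable (gaussianPDFReal 0 1) volume x y :=
  (integrable_gaussianPDFReal 0 1).intervalIntegrable

theorem gaussianPDFReal_zero_one (x : ℝ) :
    gaussianPDFReal 0 1 x = (√(2 * Real.pi))⁻¹ * Real.exp (-x ^ 2 / 2) := by
  simp [gaussianPDFReal]

theorem inv_sqrt_two_pi_le_one : (√(2 * Real.pi))⁻¹ ≤ 1 := by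
  apply inv_le_one_of_one_le₀
  rw [Real.one_le_sqrt]
  linarith [Real.pi_gt_three]

theorem gaussianPDFReal_le_exp (x : ℝ) : gaussianPDFReal 0 1 x ≤ Real.exp (-x ^ 2 / 2) := by
  rw [gaussianPDFReal_zero_one]
  have := mul_le_mul_of_nonneg_right inv_sqrt_two_pi_le_one (Real.exp_pos (-x ^ 2 / 2)).le
  linarith

theorem gaussianPDFReal_le_one (x : ℝ) : gaussianPDFReal 0 1 x ≤ 1 :=
  (gaussianPDFReal_le_exp x).trans (Real.exp_le_one_iff.2 (by have := sq_nonneg x; linarith))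

theorem gaussianReal_real_Ioc_le {x y : ℝ} (h : x ≤ y) :
    (gaussianReal 0 1).real (Ioc x y) ≤ y - x := by
  rw [gaussianReal_real_Ioc h]
  have := intervalIntegral.integral_mono_on h (intervalIntegrable_gaussianPDFReal x y)
    (intervalIntegrable_const (c := (1 : ℝ))) (fun z _ => gaussianPDFReal_le_one z)
  simpa using this

instance : NullSingletonClass (gaussianReal 0 1) := nullSingletonClass_gaussianReal one_ne_zero

theorem gaussianReal_real_Iic_add_le {x δ : ℝ} (hδ : 0 ≤ δ) :
    (gaussianReal 0 1).real (Iic (x + δ)) ≤ (gaussianReal 0 1).real (Iic x) + δ := by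
  have h1 : Iic (x + δ) = Iic x ∪ Ioc x (x + δ) := (Iic_union_Ioc_eq_Iic (by linarith)).symm
  have h2 := gaussianReal_real_Ioc_le (x := x) (y := x + δ) (by linarith)
  rw [h1]
  linarith [measureReal_union_le (μ := gaussianReal 0 1) (Iic x) (Ioc x (x + δ))]

theorem gaussianReal_real_Ici_sub_le {x δ : ℝ} (hδ : 0 ≤ δ) :
    (gaussianReal 0 1).real (Ici (x - δ)) ≤ (gaussianReal 0 1).real (Ici x) + δ := by
  have h1 : Ici (x - δ) ⊆ {x - δ} ∪ (Ioc (x - δ) x ∪ Ici x) := fun z hz => by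
    simp only [mem_union, mem_singleton_iff, mem_Ioc, mem_Ici] at *
    grind
  have h2 := gaussianReal_real_Ioc_le (x := x - δ) (y := x) (by linarith)
  have h3 := measureReal_mono (μ := gaussianReal 0 1) h1
  have h4 := measureReal_union_le (μ := gaussianReal 0 1) {x - δ} (Ioc (x - δ) x ∪ Ici x)
  have h5 := measureReal_union_le (μ := gaussianReal 0 1) (Ioc (x - δ) x) (Ici x)
  have h6 : (gaussianReal 0 1).real {x - δ} = 0 := by simp [measureReal_def]
  linarith

/-! ### Quantitative central limit theorem -/

theorem measureReal_le_integral {Ω : Type*} [MeasurableSpace Ω] {Q : Measure Ω}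
    [IsProbabilityMeasure Q] {A : Set Ω} (hA : MeasurableSet A) {g : Ω → ℝ} (hg : Integrable g Q)
    (h0 : ∀ ω, 0 ≤ g ω) (h1 : ∀ ω ∈ A, 1 ≤ g ω) : Q.real A ≤ ∫ ω, g ω ∂Q := by
  have : Q.real A = ∫ ω, A.indicator (fun _ => (1 : ℝ)) ω ∂Q := by
    rw [integral_indicator hA]; simp
  rw [this]
  refine integral_mono ((integrable_const _).indicator hA) hg fun ω => ?_
  by_cases h : ω ∈ A
  · simpa [h] using h1 ω h
  · simpa [h] using h0 ω

theorem integral_le_measureReal {Ω : Type*} [MeasurableSpace Ω] {Q : Measure Ω}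
    [IsProbabilityMeasure Q] {A : Set Ω} (hA : MeasurableSet A) {g : Ω → ℝ} (hg : Integrable g Q)
    (h1 : ∀ ω, g ω ≤ 1) (h0 : ∀ ω ∉ A, g ω ≤ 0) : ∫ ω, g ω ∂Q ≤ Q.real A := by
  have : Q.real A = ∫ ω, A.indicator (fun _ => (1 : ℝ)) ω ∂Q := by
    rw [integral_indicator hA]; simp
  rw [this]
  refine integral_mono hg ((integrable_const _).indicator hA) fun ω => ?_
  by_cases h : ω ∈ A
  · simpa [h] using h1 ω
  · simpa [h] using h0 ω h

/-- Normal approximation of a sum of independent centred variables, uniformly over intervals,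
when the sum of the absolute moments of order `r ∈ (2, 3]` is small. -/
theorem exists_gaussian_approximation {r : ℝ} (hr : 2 ≤ r) (hr' : r ≤ 3) {ε : ℝ} (hε : 0 < ε) :
    ∃ η > 0, ∀ {ι Ω : Type} [Fintype ι] [MeasurableSpace Ω] {Q : Measure Ω}
      [IsProbabilityMeasure Q] {ξ : ι → Ω → ℝ} (v : ι → NNReal), (∀ i, Measurable (ξ i)) →
      iIndepFun ξ Q → (∀ i, Integrable (fun ω => |ξ i ω| ^ r) Q) → (∀ i, ∫ ω, ξ i ω ∂Q = 0) →
      (∀ i, ∫ ω, ξ i ω ^ 2 ∂Q = v i) → ∑ i, v i = 1 →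
      ∑ i, (∫ ω, |ξ i ω| ^ r ∂Q + ∫ y, |y| ^ r ∂(gaussianReal 0 (v i))) ≤ η →
      ∀ lo hi : ℝ, (gaussianReal 0 1).real (Icc lo hi) - ε ≤
        Q.real {ω | ∑ i, ξ i ω ∈ Icc lo hi} := by
  obtain ⟨B, hB0, hB⟩ := exists_hasTaylorBound_smoothTransition hr hr'
  -- Each of the two tails loses `δ` by smoothing its indicator and `δ` by the replacement, `4 * δ`
  -- in all.
  set δ := ε / 4 with hδ
  have hδ0 : 0 < δ := by positivity
  set B' := B * |δ⁻¹| ^ r with hB'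
  have hB'0 : 0 ≤ B' := by positivity
  refine ⟨δ / (B' + 1), by positivity, ?_⟩
  intro ι Ω _ _ Q _ ξ v hξ hind hint hmean hvar hv hη lo hi
  have herr : B' * ∑ i, (∫ ω, |ξ i ω| ^ r ∂Q + ∫ y, |y| ^ r ∂(gaussianReal 0 (v i))) ≤ δ := by
    calc _ ≤ B' * (δ / (B' + 1)) := mul_le_mul_of_nonneg_left hη hB'0
      _ = δ * (B' / (B' + 1)) := by ring
      _ ≤ δ * 1 := mul_le_mul_of_nonneg_left
          ((div_le_one (by linarith)).2 (by linarith)) hδ0.le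
      _ = δ := mul_one _
  set S : Ω → ℝ := fun ω => ∑ i, ξ i ω with hS
  have hSm : Measurable S := Finset.measurable_sum _ fun j _ => hξ j
  have hψi : ∀ {Ω' : Type} [MeasurableSpace Ω'] (ρ : Measure Ω') [IsProbabilityMeasure ρ]
      (g : Ω' → ℝ), Measurable g → Integrable (fun ω => Real.smoothTransition (g ω)) ρ := by
    intro Ω' _ ρ _ g hg
    refine Integrable.of_bound
      (Real.smoothTransition.continuous.measurable.comp hg).aestronglyMeasurable 1
      (ae_of_all _ fun ω => ?_)
    rw [Real.norm_eq_abs, abs_of_nonneg (Real.smoothTransition.nonneg _)]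
    exact Real.smoothTransition.le_one _
  -- The step function equals `1` up to `lo` and `0` from `lo + δ` on; `hupp` uses its mirror image
  -- at `hi`.
  have hlow : Q.real {ω | S ω ≤ lo} ≤ (gaussianReal 0 1).real (Iic lo) + 2 * δ := by
    have hf : HasTaylorBound r B' (fun x => Real.smoothTransition (-δ⁻¹ * x + (lo + δ) * δ⁻¹)) := by
      have := hB.comp_affine (-δ⁻¹) ((lo + δ) * δ⁻¹)
      rwa [abs_neg] at this
    have h1 := hf.abs_integral_sum_sub_gaussian_le hξ hind hr hint hmean v hvar Finset.univ
    rw [hv] at h1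
    have h2 := measureReal_le_integral (Q := Q) (A := {ω | S ω ≤ lo})
      (measurableSet_le hSm measurable_const)
      (hψi Q (fun ω => -δ⁻¹ * S ω + (lo + δ) * δ⁻¹) (by fun_prop))
      (fun _ => Real.smoothTransition.nonneg _) (fun ω hω => by
        rw [Real.smoothTransition.one_of_one_le]
        have : -δ⁻¹ * S ω + (lo + δ) * δ⁻¹ = 1 + δ⁻¹ * (lo - S ω) := by field_simp; ring
        rw [this]
        have : 0 ≤ δ⁻¹ * (lo - S ω) := mul_nonneg (by positivity) (sub_nonneg.2 hω)
        linarith)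
    have h3 := integral_le_measureReal (Q := gaussianReal 0 1) (A := Iic (lo + δ))
      measurableSet_Iic
      (hψi (gaussianReal 0 1) (fun x => -δ⁻¹ * x + (lo + δ) * δ⁻¹) (by fun_prop))
      (fun _ => Real.smoothTransition.le_one _) (fun x hx => by
        rw [Real.smoothTransition.zero_of_nonpos]
        have : -δ⁻¹ * x + (lo + δ) * δ⁻¹ = -(δ⁻¹ * (x - (lo + δ))) := by ring
        rw [this]
        have : 0 ≤ δ⁻¹ * (x - (lo + δ)) :=
          mul_nonneg (by positivity) (by have := notMem_Iic.1 hx; linarith)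
        linarith)
    have h4 := gaussianReal_real_Iic_add_le (x := lo) hδ0.le
    have h5 := (abs_le.1 h1).2
    linarith
  have hupp : Q.real {ω | hi ≤ S ω} ≤ (gaussianReal 0 1).real (Ici hi) + 2 * δ := by
    have hf : HasTaylorBound r B' (fun x => Real.smoothTransition (δ⁻¹ * x + (δ - hi) * δ⁻¹)) :=
      hB.comp_affine (δ⁻¹) ((δ - hi) * δ⁻¹)
    have h1 := hf.abs_integral_sum_sub_gaussian_le hξ hind hr hint hmean v hvar Finset.univ
    rw [hv] at h1
    have h2 := measureReal_le_integral (Q := Q) (A := {ω | hi ≤ S ω})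
      (measurableSet_le measurable_const hSm)
      (hψi Q (fun ω => δ⁻¹ * S ω + (δ - hi) * δ⁻¹) (by fun_prop))
      (fun _ => Real.smoothTransition.nonneg _) (fun ω hω => by
        rw [Real.smoothTransition.one_of_one_le]
        have : δ⁻¹ * S ω + (δ - hi) * δ⁻¹ = 1 + δ⁻¹ * (S ω - hi) := by field_simp; ring
        rw [this]
        have : 0 ≤ δ⁻¹ * (S ω - hi) := mul_nonneg (by positivity) (sub_nonneg.2 hω)
        linarith)
    have h3 := integral_le_measureReal (Q := gaussianReal 0 1) (A := Ici (hi - δ))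
      measurableSet_Ici
      (hψi (gaussianReal 0 1) (fun x => δ⁻¹ * x + (δ - hi) * δ⁻¹) (by fun_prop))
      (fun _ => Real.smoothTransition.le_one _) (fun x hx => by
        rw [Real.smoothTransition.zero_of_nonpos]
        have : δ⁻¹ * x + (δ - hi) * δ⁻¹ = -(δ⁻¹ * (hi - δ - x)) := by ring
        rw [this]
        have : 0 ≤ δ⁻¹ * (hi - δ - x) :=
          mul_nonneg (by positivity) (by have := notMem_Ici.1 hx; linarith)
        linarith)
    have h4 := gaussianReal_real_Ici_sub_le (x := hi) hδ0.le
    have h5 := (abs_le.1 h1).2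
    linarith
  -- The closed tails overlap the interval at its endpoints. That is harmless here, where only a
  -- union bound is needed; the converse inequality `hN` for the normal law uses that it has no
  -- atoms.
  have htot : 1 ≤ Q.real {ω | S ω ≤ lo} + Q.real {ω | hi ≤ S ω} +
      Q.real {ω | S ω ∈ Icc lo hi} := by
    have : (univ : Set Ω) ⊆ {ω | S ω ≤ lo} ∪ {ω | hi ≤ S ω} ∪ {ω | S ω ∈ Icc lo hi} := by
      intro ω _
      simp only [mem_union, mem_ofPred_eq, mem_Icc]
      grind
    have h1 := measureReal_mono (μ := Q) this
    rw [probReal_univ] at h1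
    have h2 := measureReal_union_le (μ := Q) ({ω | S ω ≤ lo} ∪ {ω | hi ≤ S ω}) {ω | S ω ∈ Icc lo hi}
    have h3 := measureReal_union_le (μ := Q) {ω | S ω ≤ lo} {ω | hi ≤ S ω}
    linarith
  rcases lt_or_ge hi lo with h | h
  · rw [Icc_eq_empty (not_le.2 h)]
    simp only [measureReal_empty]
    linarith [measureReal_nonneg (μ := Q) (s := {ω | ∑ i, ξ i ω ∈ (∅ : Set ℝ)})]
  have hN : (gaussianReal 0 1).real (Iic lo) + (gaussianReal 0 1).real (Ici hi) +
      (gaussianReal 0 1).real (Icc lo hi) ≤ 1 := by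
    have a1 : (gaussianReal 0 1).real (Iic lo) = (gaussianReal 0 1).real (Iio lo) :=
      measureReal_congr Iio_ae_eq_Iic.symm
    have a2 : (gaussianReal 0 1).real (Ici hi) = (gaussianReal 0 1).real (Ioi hi) :=
      measureReal_congr Ioi_ae_eq_Ici.symm
    have d1 : Disjoint (Iio lo) (Ioi hi) := by
      rw [Set.disjoint_left]; intro z hz hz'; simp only [mem_Iio, mem_Ioi] at *; linarith
    have d2 : Disjoint (Iio lo ∪ Ioi hi) (Icc lo hi) := by
      rw [Set.disjoint_left]; intro z hz hz'
      simp only [mem_union, mem_Iio, mem_Ioi, mem_Icc] at *; grind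
    rw [a1, a2, ← measureReal_union d1 measurableSet_Ioi, ← measureReal_union d2 measurableSet_Icc]
    exact measureReal_le_one
  linarith

/-- Scaling, which makes the Gaussian moments comparable to powers of the weights. -/
theorem integral_abs_rpow_gaussianReal (v : NNReal) (r : ℝ) :
    ∫ y, |y| ^ r ∂(gaussianReal 0 v) = √v ^ r * ∫ y, |y| ^ r ∂(gaussianReal 0 1) := by
  have h := gaussianReal_map_const_mul (μ := 0) (v := 1) (√v)
  have e : NNReal.mk (√v ^ 2) (sq_nonneg _) * 1 = v := by
    ext; simp
  rw [mul_zero, e] at h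
  rw [← h, integral_map (f := fun y : ℝ => |y| ^ r) (by fun_prop)
      (measurable_norm.pow_const r).aestronglyMeasurable,
    ← integral_const_mul]
  refine integral_congr_ae (ae_of_all _ fun y => ?_)
  beta_reduce
  rw [abs_mul, abs_of_nonneg (Real.sqrt_nonneg _), Real.mul_rpow (Real.sqrt_nonneg _) (abs_nonneg _)]

theorem abs_rpow_le_one_add {r q : ℝ} (hr : 0 ≤ r) (hrq : r ≤ q) (y : ℝ) :
    |y| ^ r ≤ 1 + |y| ^ q := by
  have : 0 ≤ |y| ^ q := by positivity
  rcases le_total |y| 1 with h1 | h1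
  · linarith [Real.rpow_le_one (abs_nonneg y) h1 hr]
  · linarith [Real.rpow_le_rpow_of_exponent_le h1 hrq]

theorem integrable_and_integral_rpow_le {μ : Measure ℝ} [IsProbabilityMeasure μ] {r q C g : ℝ}
    (hr : 0 ≤ r) (hrq : r ≤ q) (hint : Integrable (fun y => |y - g| ^ q) μ)
    (hC : ∫ y, |y - g| ^ q ∂μ ≤ C) :
    Integrable (fun y => |y - g| ^ r) μ ∧ ∫ y, |y - g| ^ r ∂μ ≤ 1 + C := by
  have hm : Measurable fun y : ℝ => |y - g| ^ r :=
    (measurable_norm.comp (measurable_id.sub_const g)).pow_const r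
  have hi : Integrable (fun y => 1 + |y - g| ^ q) μ := (integrable_const 1).add hint
  have h1 : Integrable (fun y => |y - g| ^ r) μ :=
    hi.mono' hm.aestronglyMeasurable (ae_of_all _ fun y => by
      rw [Real.norm_eq_abs, abs_of_nonneg (by positivity)]
      exact abs_rpow_le_one_add hr hrq _)
  refine ⟨h1, (integral_mono h1 hi fun y => abs_rpow_le_one_add hr hrq _).trans ?_⟩
  rw [integral_add (integrable_const _) hint]
  simpa using hC

/-- Normal approximation of a weighted sum of independent observations whose absolute central
moments of order `q > 2` are bounded and whose variances are bounded below, uniformly over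
intervals, when no single squared weight contributes much to the sum of squared weights. -/
theorem exists_gaussian_approximation_weighted {q C v₀ ε : ℝ} (hq : 2 < q) (hv₀ : 0 < v₀)
    (hε : 0 < ε) :
    ∃ η > 0, ∀ {n : ℕ} (κ : Fin n → Measure ℝ) [∀ i, IsProbabilityMeasure (κ i)]
      (c g v : Fin n → ℝ), (∀ i, Integrable (fun y => |y - g i| ^ q) (κ i)) →
      (∀ i, ∫ y, |y - g i| ^ q ∂(κ i) ≤ C) → (∀ i, ∫ y, y ∂(κ i) = g i) →
      (∀ i, ∫ y, (y - g i) ^ 2 ∂(κ i) = v i) → (∀ i, v₀ ≤ v i) →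
      (∀ i, c i ^ 2 ≤ η * ∑ j, c j ^ 2) → 0 < ∑ j, c j ^ 2 → ∀ lo hi : ℝ,
      (gaussianReal 0 1).real (Icc lo hi) - ε ≤ (Measure.pi κ).real
        {y | ∑ i, c i * (y i - g i) ∈
          Icc (lo * √(∑ i, c i ^ 2 * v i)) (hi * √(∑ i, c i ^ 2 * v i))} := by
  -- The Taylor bound needs `r ≤ 3`; a strict `r > 2` leaves the spare power `r - 2` of the largest
  -- weight that makes the error small.
  set r := min q 3 with hr
  have hr2 : 2 < r := lt_min hq (by norm_num)
  have hr3 : r ≤ 3 := min_le_right _ _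
  have hrq : r ≤ q := min_le_left _ _
  obtain ⟨η₀, hη₀, H⟩ := exists_gaussian_approximation hr2.le hr3 hε
  set G := ∫ y, |y| ^ r ∂(gaussianReal 0 1) with hG
  have hG0 : 0 ≤ G := integral_nonneg fun y => by positivity
  set C' := max C 0 with hC'
  have hC'0 : 0 ≤ C' := le_max_right _ _
  -- Per unit of `|c i / s| ^ r`, a bound for the moment of the observation plus that of the
  -- Gaussian with the same variance.
  set D := (1 + C') + √(1 + C') ^ r * G with hD
  have hD0 : 0 < D := by positivity
  -- Chosen so that `t ^ (r - 2) * D * v₀⁻¹ = η₀`. A fraction `v₀ * t ^ 2` for the squared weights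
  -- yields `|c i / s| ≤ t`, and the sum of `(c i / s) ^ 2` is at most `v₀⁻¹`.
  set t := (η₀ * v₀ / D) ^ (r - 2)⁻¹ with ht
  have ht0 : 0 < t := by positivity
  have htr : t ^ (r - 2) = η₀ * v₀ / D := by
    rw [ht, ← Real.rpow_mul (by positivity), inv_mul_cancel₀ (by linarith), Real.rpow_one]
  refine ⟨v₀ * t ^ 2, by positivity, ?_⟩
  intro n κ _ c g v hint hC hmean hvar hv hmax hpos lo hi
  set s := √(∑ i, c i ^ 2 * v i) with hs
  have hsum : v₀ * ∑ i, c i ^ 2 ≤ ∑ i, c i ^ 2 * v i := by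
    rw [Finset.mul_sum]
    exact Finset.sum_le_sum fun i _ => by
      rw [mul_comm]; exact mul_le_mul_of_nonneg_left (hv i) (sq_nonneg _)
  have hspos : 0 < ∑ i, c i ^ 2 * v i := lt_of_lt_of_le (by positivity) hsum
  have hs0 : 0 < s := Real.sqrt_pos.2 hspos
  have hs2 : s ^ 2 = ∑ i, c i ^ 2 * v i := Real.sq_sqrt hspos.le
  have hvC : ∀ i, v i ≤ 1 + C' := fun i => by
    rw [← hvar i]
    have := (integrable_and_integral_rpow_le (μ := κ i) (r := 2) (by norm_num) hq.le (hint i)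
      ((hC i).trans (le_max_left _ 0))).2
    simpa using this
  have hb : ∀ i, |c i / s| ≤ t := fun i => by
    refine abs_le_of_sq_le_sq ?_ ht0.le
    rw [div_pow, div_le_iff₀ (by positivity), hs2]
    calc c i ^ 2 ≤ v₀ * t ^ 2 * ∑ j, c j ^ 2 := hmax i
      _ = t ^ 2 * (v₀ * ∑ j, c j ^ 2) := by ring
      _ ≤ _ := mul_le_mul_of_nonneg_left hsum (sq_nonneg _)
  have hb2 : ∑ i, (c i / s) ^ 2 ≤ v₀⁻¹ := by
    simp only [div_pow]
    rw [← Finset.sum_div, div_le_iff₀ (by positivity), hs2, inv_mul_eq_div, le_div_iff₀ hv₀, mul_comm]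
    exact hsum
  have hbr : ∀ i, |c i / s| ^ r ≤ t ^ (r - 2) * (c i / s) ^ 2 := fun i => by
    rcases eq_or_ne (c i / s) 0 with h0 | h0
    · rw [h0]; simp [Real.zero_rpow (by linarith : r ≠ 0)]
    · have h1 : |c i / s| ^ r = |c i / s| ^ (r - 2) * (c i / s) ^ 2 := by
        rw [← sq_abs, ← Real.rpow_natCast, ← Real.rpow_add (abs_pos.2 h0)]
        norm_num
      rw [h1]
      exact mul_le_mul_of_nonneg_right
        (Real.rpow_le_rpow (abs_nonneg _) (hb i) (by linarith)) (sq_nonneg _)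
  have hvnn : ∀ i, 0 ≤ (c i / s) ^ 2 * v i := fun i =>
    mul_nonneg (sq_nonneg _) (hv₀.le.trans (hv i))
  obtain ⟨V, hV⟩ : ∃ V : Fin n → NNReal, ∀ i, (V i : ℝ) = (c i / s) ^ 2 * v i :=
    ⟨fun i => Real.toNNReal _, fun i => Real.coe_toNNReal _ (hvnn i)⟩
  have hev : ∀ (i : Fin n) (F : ℝ → ℝ), Measurable F →
      ∫ y, F (y i) ∂(Measure.pi κ) = ∫ z, F z ∂(κ i) := fun i F hF => by
    have := (measurePreserving_eval κ i).map_eq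
    rw [← this, integral_map (measurable_pi_apply i).aemeasurable hF.aestronglyMeasurable]
  have hevi : ∀ (i : Fin n) (F : ℝ → ℝ), Measurable F → Integrable F (κ i) →
      Integrable (fun y => F (y i)) (Measure.pi κ) := fun i F hF hI =>
    (measurePreserving_eval κ i).integrable_comp_of_integrable hI
  have hFm : ∀ i, Measurable fun z : ℝ => |c i / s * (z - g i)| ^ r := fun i =>
    (measurable_norm.comp ((measurable_id.sub_const (g i)).const_mul _)).pow_const r
  have hFe : ∀ i, (fun z : ℝ => |c i / s * (z - g i)| ^ r) =
      fun z => |c i / s| ^ r * |z - g i| ^ r := fun i => by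
    ext z; rw [abs_mul, Real.mul_rpow (abs_nonneg _) (abs_nonneg _)]
  have hmom := fun i => integrable_and_integral_rpow_le (μ := κ i) (r := r) (by linarith) hrq
    (hint i) ((hC i).trans (le_max_left _ 0))
  have hidi : ∀ i, Integrable (fun y => y) (κ i) := fun i => by
    have h2 := (integrable_and_integral_rpow_le (μ := κ i) (r := 1) (by norm_num) (by linarith)
      (hint i) (hC i)).1
    simp only [Real.rpow_one] at h2
    have h3 : Integrable (fun y => y - g i) (κ i) := by
      rw [← integrable_norm_iff (by fun_prop)]; exact h2
    exact (h3.add (integrable_const (g i))).congr (ae_of_all _ fun y => by simp)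
  have key := H (Q := Measure.pi κ) (ξ := fun i y => c i / s * (y i - g i))
    V (fun i => by fun_prop)
    (iIndepFun_pi (X := fun i z => c i / s * (z - g i)) fun i => by fun_prop)
    (fun i => hevi i (fun z => |c i / s * (z - g i)| ^ r) (hFm i) (by
      rw [hFe i]; exact (hmom i).1.const_mul _))
    (fun i => by
      rw [hev i (fun z => c i / s * (z - g i)) (by fun_prop), integral_const_mul,
        integral_sub (hidi i) (integrable_const _), hmean i]
      simp)
    (fun i => by
      rw [hev i (fun z => (c i / s * (z - g i)) ^ 2) (by fun_prop)]
      simp only [mul_pow]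
      rw [integral_const_mul, hvar i, hV])
    (by
      ext
      rw [NNReal.coe_sum]
      simp only [hV, div_pow, div_mul_eq_mul_div, NNReal.coe_one]
      rw [← Finset.sum_div, hs2, div_self hspos.ne'])
    (by
      calc _ ≤ ∑ i, t ^ (r - 2) * D * (c i / s) ^ 2 := by
            refine Finset.sum_le_sum fun i _ => ?_
            rw [hev i (fun z => |c i / s * (z - g i)| ^ r) (hFm i), hFe i, integral_const_mul,
              integral_abs_rpow_gaussianReal, hV, Real.sqrt_mul (sq_nonneg _),
              Real.sqrt_sq_eq_abs, Real.mul_rpow (abs_nonneg _) (Real.sqrt_nonneg _), ← hG]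
            have h1 : √(v i) ^ r ≤ √(1 + C') ^ r :=
              Real.rpow_le_rpow (Real.sqrt_nonneg _) (Real.sqrt_le_sqrt (hvC i)) (by linarith)
            have h2 : |c i / s| ^ r * √(v i) ^ r * G ≤ |c i / s| ^ r * (√(1 + C') ^ r * G) := by
              rw [mul_assoc]
              gcongr
            have h3 : |c i / s| ^ r * ∫ y, |y - g i| ^ r ∂(κ i) ≤ |c i / s| ^ r * (1 + C') :=
              mul_le_mul_of_nonneg_left (hmom i).2 (by positivity)
            have h4 := mul_le_mul_of_nonneg_right (hbr i) hD0.le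
            rw [hD] at h4 ⊢
            linarith
        _ = η₀ * v₀ * ∑ i, (c i / s) ^ 2 := by
            rw [← Finset.mul_sum, htr]; field_simp
        _ ≤ η₀ * v₀ * v₀⁻¹ := mul_le_mul_of_nonneg_left hb2 (by positivity)
        _ = η₀ := by field_simp) lo hi
  refine key.trans_eq ?_
  congr 1
  ext y
  have e : ∑ i, c i / s * (y i - g i) = (∑ i, c i * (y i - g i)) / s := by
    rw [Finset.sum_div]; exact Finset.sum_congr rfl fun i _ => by ring
  simp only [mem_ofPred_eq, mem_Icc, e]
  rw [le_div_iff₀ hs0, div_le_iff₀ hs0]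

/-! ### Critical values -/

theorem gaussianReal_real_Icc {x y : ℝ} (h : x ≤ y) :
    (gaussianReal 0 1).real (Icc x y) = ∫ z in x..y, gaussianPDFReal 0 1 z := by
  rw [← gaussianReal_real_Ioc h]
  exact measureReal_congr Ioc_ae_eq_Icc.symm

theorem gaussianPDFReal_le_of_abs_le {x y : ℝ} (h : |y| ≤ |x|) :
    gaussianPDFReal 0 1 x ≤ gaussianPDFReal 0 1 y := by
  rw [gaussianPDFReal_zero_one, gaussianPDFReal_zero_one]
  have := sq_le_sq.2 h
  gcongr

/-- A centred interval of given length loses standard normal mass when it is moved away from the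
origin. -/
theorem gaussianReal_real_Icc_le_of_abs_le {t r r' : ℝ} (ht : 0 ≤ t) (h : |r'| ≤ r) :
    (gaussianReal 0 1).real (Icc (-t - r) (t - r)) ≤
      (gaussianReal 0 1).real (Icc (-t - r') (t - r')) := by
  have main : ∀ r', 0 ≤ r' → r' ≤ r → (gaussianReal 0 1).real (Icc (-t - r) (t - r)) ≤
      (gaussianReal 0 1).real (Icc (-t - r') (t - r')) := by
    intro r' h0 h1
    have I := intervalIntegrable_gaussianPDFReal
    rw [gaussianReal_real_Icc (by linarith), gaussianReal_real_Icc (by linarith)]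
    have e1 := intervalIntegral.integral_add_adjacent_intervals (I (-t - r) (-t - r'))
      (I (-t - r') (t - r'))
    have e2 := intervalIntegral.integral_add_adjacent_intervals (I (-t - r) (t - r))
      (I (t - r) (t - r'))
    -- Moving the shift from `r` to `r'` trades the strip left of `-t - r'` for the strip right of
    -- `t - r`. Both are parametrised by the intermediate shift `s`, and `|t - s| ≤ |-t - s|`.
    have e3 : ∫ z in (-t - r)..(-t - r'), gaussianPDFReal 0 1 z =
        ∫ s in r'..r, gaussianPDFReal 0 1 (-t - s) := by
      rw [intervalIntegral.integral_comp_sub_left]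
    have e4 : ∫ z in (t - r)..(t - r'), gaussianPDFReal 0 1 z =
        ∫ s in r'..r, gaussianPDFReal 0 1 (t - s) := by
      rw [intervalIntegral.integral_comp_sub_left]
    have e5 : ∫ s in r'..r, gaussianPDFReal 0 1 (-t - s) ≤
        ∫ s in r'..r, gaussianPDFReal 0 1 (t - s) := by
      have hc : Continuous (gaussianPDFReal 0 1) := by
        have : gaussianPDFReal 0 1 = fun x => (√(2 * Real.pi))⁻¹ * Real.exp (-x ^ 2 / 2) :=
          funext gaussianPDFReal_zero_one
        rw [this]; fun_prop
      refine intervalIntegral.integral_mono_on h1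
        ((hc.comp (continuous_const.sub continuous_id)).intervalIntegrable _ _)
        ((hc.comp (continuous_const.sub continuous_id)).intervalIntegrable _ _) fun s hs => ?_
      refine gaussianPDFReal_le_of_abs_le ?_
      have : |-t - s| = t + s := by
        rw [abs_of_nonpos (by linarith [hs.1])]; ring
      rw [this, abs_le]
      constructor <;> linarith [hs.1]
    linarith
  rcases le_total 0 r' with h0 | h0
  · exact main r' h0 ((le_abs_self _).trans h)
  -- A negative shift is reduced to a positive one by the symmetry of the normal law.
  · refine (main (-r') (by linarith) ((neg_le_abs _).trans h)).trans_eq ?_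
    have hmap : (gaussianReal 0 1).map (fun x => -x) = gaussianReal 0 1 := by
      rw [gaussianReal_map_neg]; simp
    conv_lhs => rw [← hmap]
    rw [map_measureReal_apply measurable_neg measurableSet_Icc]
    congr 1
    ext z
    simp only [mem_preimage, mem_Icc]
    constructor <;> rintro ⟨a, b⟩ <;> constructor <;> linarith

/-- Every point between `x` and `k * x` has modulus at least `|x| / 2`, so the density there is at
most `exp (-x² / 8)`. This beats the width `|k - 1| * |x|` and makes the bound uniform in `x`. -/
theorem abs_integral_gaussianPDFReal_le {k : ℝ} (hk : 1 / 2 ≤ k) (x : ℝ) :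
    |∫ z in x..(k * x), gaussianPDFReal 0 1 z| ≤ 2 * |k - 1| := by
  have h1 : ∀ z ∈ uIoc x (k * x), ‖gaussianPDFReal 0 1 z‖ ≤ Real.exp (-(x ^ 2 / 8)) := by
    intro z hz
    rw [Real.norm_eq_abs, abs_of_nonneg (gaussianPDFReal_nonneg _ _ _)]
    refine (gaussianPDFReal_le_exp z).trans (Real.exp_le_exp.2 ?_)
    have h2 : (x / 2) ^ 2 ≤ z ^ 2 := by
      rw [sq_le_sq, abs_div, abs_two]
      rcases le_total 0 x with h0 | h0
      · have hz1 : x / 2 ≤ z := by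
          have h3 : min x (k * x) < z := (mem_uIoc.1 hz).elim
            (fun h => (min_le_left _ _).trans_lt h.1) (fun h => (min_le_right _ _).trans_lt h.1)
          have h4 : x / 2 ≤ min x (k * x) := le_min (by linarith) (by nlinarith)
          linarith
        rw [abs_of_nonneg h0]
        exact hz1.trans (le_abs_self _)
      · have hz1 : z ≤ x / 2 := by
          have h3 : z ≤ max x (k * x) := (mem_uIoc.1 hz).elim
            (fun h => h.2.trans (le_max_right _ _)) (fun h => h.2.trans (le_max_left _ _))
          have h4 : max x (k * x) ≤ x / 2 := max_le (by linarith) (by nlinarith)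
          linarith
        rw [abs_of_nonpos h0]
        have := neg_le_abs z
        linarith
    nlinarith
  have h2 := intervalIntegral.norm_integral_le_of_norm_le_const h1
  rw [Real.norm_eq_abs] at h2
  refine h2.trans ?_
  have h3 : k * x - x = (k - 1) * x := by ring
  have h4 : |x| * Real.exp (-(x ^ 2 / 8)) ≤ 2 := by
    rw [Real.exp_neg, ← div_eq_mul_inv, div_le_iff₀ (Real.exp_pos _)]
    have := Real.add_one_le_exp (x ^ 2 / 8)
    nlinarith [sq_nonneg (|x| - 2), sq_abs x, abs_nonneg x]
  rw [h3, abs_mul]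
  nlinarith [abs_nonneg (k - 1)]

theorem gaussianReal_real_Icc_mul_ge {k x y : ℝ} (hk : 1 / 2 ≤ k) (h : x ≤ y) :
    (gaussianReal 0 1).real (Icc x y) - 4 * |k - 1| ≤
      (gaussianReal 0 1).real (Icc (k * x) (k * y)) := by
  have I := intervalIntegrable_gaussianPDFReal
  rw [gaussianReal_real_Icc h, gaussianReal_real_Icc (by nlinarith)]
  have e1 := intervalIntegral.integral_add_adjacent_intervals (I x (k * x)) (I (k * x) (k * y))
  have e2 := intervalIntegral.integral_add_adjacent_intervals (I x y) (I y (k * y))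
  have b1 := abs_le.1 (abs_integral_gaussianPDFReal_le hk x)
  have b2 := abs_le.1 (abs_integral_gaussianPDFReal_le hk y)
  linarith [b1.1, b1.2, b2.1, b2.2]

theorem abs_gaussianReal_real_Iic (r t : ℝ) :
    ((gaussianReal r 1).map (fun x => |x|)).real (Iic t) =
      (gaussianReal 0 1).real (Icc (-t - r) (t - r)) := by
  have h : gaussianReal r 1 = (gaussianReal 0 1).map (fun x => x + r) := by
    rw [gaussianReal_map_add_const]; simp
  have hm : Measurable fun x : ℝ => |x| := measurable_norm
  rw [h, Measure.map_map hm (by fun_prop),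
    map_measureReal_apply (hm.comp (by fun_prop)) measurableSet_Iic]
  congr 1
  ext z
  simp only [mem_preimage, Function.comp, mem_Iic, mem_Icc, abs_le]
  constructor <;> rintro ⟨a, b⟩ <;> constructor <;> linarith

theorem criticalValue_eq (p r : ℝ) :
    criticalValue p r = sInf {t | p ≤ (gaussianReal 0 1).real (Icc (-t - r) (t - r))} := by
  simp only [criticalValue, abs_gaussianReal_real_Iic]

theorem nonneg_of_le_gaussianReal_real_Icc {p r t : ℝ} (hp : 0 < p)
    (h : p ≤ (gaussianReal 0 1).real (Icc (-t - r) (t - r))) : 0 ≤ t := by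
  by_contra ht
  rw [Icc_eq_empty (by linarith), measureReal_empty] at h
  linarith

theorem criticalValue_le {p r t : ℝ} (hp : 0 < p)
    (h : p ≤ (gaussianReal 0 1).real (Icc (-t - r) (t - r))) : criticalValue p r ≤ t := by
  rw [criticalValue_eq]
  exact csInf_le ⟨0, fun s hs => nonneg_of_le_gaussianReal_real_Icc hp hs⟩ h

/-- The infimum is attained: the admissible half-lengths form a closed set, by continuity of the
mass, that is nonempty because the distribution function tends to `1 > p`. -/
theorem le_gaussianReal_real_criticalValue {p : ℝ} (hp : 0 < p) (hp1 : p < 1) (r : ℝ) :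
    p ≤ (gaussianReal 0 1).real (Icc (-criticalValue p r - r) (criticalValue p r - r)) := by
  set S := {t | p ≤ (gaussianReal 0 1).real (Icc (-t - r) (t - r))} with hS
  have hne : S.Nonempty := by
    have hμ : IsProbabilityMeasure ((gaussianReal r 1).map (fun x : ℝ => |x|)) :=
      Measure.isProbabilityMeasure_map measurable_norm.aemeasurable
    have := (tendsto_cdf_atTop ((gaussianReal r 1).map (fun x : ℝ => |x|))).eventually_const_le hp1
    obtain ⟨t, ht⟩ := this.exists
    rw [cdf_eq_real, abs_gaussianReal_real_Iic] at ht
    exact ⟨t, ht⟩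
  have hSe : S = {t | 0 ≤ t} ∩ {t | p ≤ ∫ z in (-t - r)..(t - r), gaussianPDFReal 0 1 z} := by
    ext t
    constructor
    · intro ht
      have h0 := nonneg_of_le_gaussianReal_real_Icc hp ht
      refine ⟨h0, ?_⟩
      rw [mem_ofPred_eq, ← gaussianReal_real_Icc (by linarith [show (0:ℝ) ≤ t from h0])]
      exact ht
    · rintro ⟨h0, ht⟩
      rw [mem_ofPred_eq, ← gaussianReal_real_Icc (by linarith [show (0:ℝ) ≤ t from h0])] at ht
      exact ht
  have hcl : IsClosed S := by
    rw [hSe]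
    refine (isClosed_le continuous_const continuous_id).inter (isClosed_le continuous_const ?_)
    have hprim := intervalIntegral.continuous_primitive intervalIntegrable_gaussianPDFReal 0
    have : (fun t : ℝ => ∫ z in (-t - r)..(t - r), gaussianPDFReal 0 1 z) = fun t =>
        (∫ z in (0:ℝ)..(t - r), gaussianPDFReal 0 1 z) -
          ∫ z in (0:ℝ)..(-t - r), gaussianPDFReal 0 1 z := by
      ext t
      rw [intervalIntegral.integral_interval_sub_left (intervalIntegrable_gaussianPDFReal _ _)
        (intervalIntegrable_gaussianPDFReal _ _)]
    rw [this]
    exact (hprim.comp (by fun_prop)).sub (hprim.comp (by fun_prop))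
  have := hcl.csInf_mem hne ⟨0, fun s hs => nonneg_of_le_gaussianReal_real_Icc hp hs⟩
  rw [hS, ← criticalValue_eq] at this
  exact this

theorem criticalValue_nonneg {p : ℝ} (hp : 0 < p) (hp1 : p < 1) (r : ℝ) : 0 ≤ criticalValue p r :=
  nonneg_of_le_gaussianReal_real_Icc hp (le_gaussianReal_real_criticalValue hp hp1 r)

/-- The half-length `s cv_p(b / s)` of a bias-aware interval is, up to an arbitrarily small loss of
level, insensitive to small relative errors in the standard error `s`. -/
theorem exists_criticalValue_mul_le {p ε : ℝ} (hε : 0 < ε) (hεp : ε < p) (hp : p < 1) :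
    ∃ δ > 0, δ < 1 ∧ ∀ k : ℝ, 0 < k → |k ^ 2 - 1| ≤ δ → ∀ ρ : ℝ,
      criticalValue (p - ε) (k * ρ) ≤ k * criticalValue p ρ := by
  -- Dilation by `k ≥ 1 / 2` costs at most `4 * |k - 1|` of mass, and `|k - 1| ≤ |k ^ 2 - 1|` since
  -- `k + 1 ≥ 1`.
  refine ⟨min (ε / 4) (1 / 2), by positivity, (min_le_right _ _).trans_lt (by norm_num),
    fun k hk hkδ ρ => ?_⟩
  have hk1 : |k - 1| ≤ |k ^ 2 - 1| := by
    have : k ^ 2 - 1 = (k - 1) * (k + 1) := by ring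
    rw [this, abs_mul, abs_of_pos (show 0 < k + 1 by linarith)]
    nlinarith [abs_nonneg (k - 1)]
  have h1 : |k - 1| ≤ ε / 4 := hk1.trans (hkδ.trans (min_le_left _ _))
  have h2 : |k - 1| ≤ 1 / 2 := hk1.trans (hkδ.trans (min_le_right _ _))
  have hk2 : 1 / 2 ≤ k := by linarith [(abs_le.1 h2).1]
  -- The half-length `k * criticalValue p ρ` is admissible at level `p - ε`: the interval to be
  -- checked is `k` times the one that defines `criticalValue p ρ`.
  refine criticalValue_le (by linarith) ?_
  have h3 := le_gaussianReal_real_criticalValue (p := p) (by linarith) hp ρ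
  have h4 := criticalValue_nonneg (p := p) (by linarith) hp ρ
  have h5 := gaussianReal_real_Icc_mul_ge hk2
    (show -criticalValue p ρ - ρ ≤ criticalValue p ρ - ρ by linarith)
  have e1 : -(k * criticalValue p ρ) - k * ρ = k * (-criticalValue p ρ - ρ) := by ring
  have e2 : k * criticalValue p ρ - k * ρ = k * (criticalValue p ρ - ρ) := by ring
  rw [e1, e2]
  linarith

/-! ### Worst-case bias -/

/-- Local linear boundary weights integrate convex functions vanishing at the boundary to at most
zero. -/
theorem sum_weight_mul_convex_nonpos {ι : Type*} (s : Finset ι) {k x w : ι → ℝ} {A B : ℝ}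
    (hk : ∀ i ∈ s, 0 ≤ k i) (hx : ∀ i ∈ s, 0 ≤ x i) (hw : ∀ i ∈ s, w i = k i * (A + B * x i))
    (h0 : ∑ i ∈ s, w i = 1) (h1 : ∑ i ∈ s, w i * x i = 0) {f : ℝ → ℝ}
    (hf : ConvexOn ℝ univ f) (hf0 : f 0 = 0) : ∑ i ∈ s, w i * f (x i) ≤ 0 := by
  have hneg : ¬ ∀ i ∈ s, w i ≤ 0 := fun h => by
    linarith [Finset.sum_nonpos h]
  rcases le_or_gt 0 A with hA | hA
  · rcases le_or_gt 0 B with hB | hB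
    -- Nonnegative terms `w i * x i` summing to zero all vanish: weight sits only at `x i = 0`,
    -- where `f` is zero.
    · have hw0 : ∀ i ∈ s, 0 ≤ w i * x i := fun i hi => by
        rw [hw i hi]
        have := hk i hi; have := hx i hi; positivity
      refine (Finset.sum_eq_zero fun i hi => ?_).le
      rcases mul_eq_zero.1 ((Finset.sum_eq_zero_iff_of_nonneg hw0).1 h1 i hi) with h | h
      · simp [h]
      · simp [h, hf0]
    · have hA' : 0 < A := by
        refine lt_of_le_of_ne hA fun h => hneg fun i hi => ?_
        rw [hw i hi, ← h]
        have := mul_nonpos_of_nonpos_of_nonneg hB.le (hx i hi)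
        exact mul_nonpos_of_nonneg_of_nonpos (hk i hi) (by linarith)
      -- The main case: weights are nonnegative up to `x₀` and nonpositive beyond. By convexity `f`
      -- lies below its chord of slope `m` through the origin up to `x₀` and above that line
      -- afterwards, so each `w i * (f (x i) - m * x i)` is nonpositive; subtracting `m * x i` is
      -- free because of `h1`.
      set x₀ := A / -B with hx₀
      have hx₀0 : 0 < x₀ := div_pos hA' (by linarith)
      have hAB : A + B * x₀ = 0 := by rw [hx₀, div_neg]; field_simp [hB.ne]; ring
      set m := f x₀ / x₀ with hm
      have hmx : m * x₀ = f x₀ := by rw [hm]; field_simp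
      have key : ∑ i ∈ s, w i * (f (x i) - m * x i) ≤ 0 := by
        refine Finset.sum_nonpos fun i hi => ?_
        have hki := hk i hi
        have hxi := hx i hi
        rw [hw i hi]
        rcases le_total (x i) x₀ with h | h
        · have c := hf.2 (mem_univ 0) (mem_univ x₀)
            (show 0 ≤ 1 - x i / x₀ by rw [sub_nonneg, div_le_one hx₀0]; exact h)
            (show 0 ≤ x i / x₀ by positivity) (by ring)
          have e : x i / x₀ * x₀ = x i := by field_simp
          simp only [smul_eq_mul, mul_zero, zero_add, hf0, e] at c
          have c2 : x i / x₀ * f x₀ = m * x i := by rw [hm]; ring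
          have : 0 ≤ A + B * x i := by nlinarith
          exact mul_nonpos_of_nonneg_of_nonpos (by positivity) (by linarith)
        · have hxi0 : 0 < x i := hx₀0.trans_le h
          have c := hf.2 (mem_univ 0) (mem_univ (x i))
            (show 0 ≤ 1 - x₀ / x i by rw [sub_nonneg, div_le_one hxi0]; exact h)
            (show 0 ≤ x₀ / x i by positivity) (by ring)
          have e : x₀ / x i * x i = x₀ := by field_simp
          simp only [smul_eq_mul, mul_zero, zero_add, hf0, e] at c
          have c2 : m * x i ≤ f (x i) := by
            rw [hm, div_mul_eq_mul_div, div_le_iff₀ hx₀0]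
            rw [div_mul_eq_mul_div, le_div_iff₀ hxi0] at c
            linarith
          have : A + B * x i ≤ 0 := by nlinarith
          exact mul_nonpos_of_nonpos_of_nonneg (mul_nonpos_of_nonneg_of_nonpos hki this)
            (by linarith)
      have e : ∑ i ∈ s, w i * (f (x i) - m * x i) =
          ∑ i ∈ s, w i * f (x i) - m * ∑ i ∈ s, w i * x i := by
        rw [Finset.mul_sum, ← Finset.sum_sub_distrib]
        exact Finset.sum_congr rfl fun i _ => by ring
      rw [e, h1] at key
      linarith
  · rcases le_or_gt B 0 with hB | hB
    · refine absurd (fun i hi => ?_) hneg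
      rw [hw i hi]
      have := mul_nonpos_of_nonpos_of_nonneg hB (hx i hi)
      exact mul_nonpos_of_nonneg_of_nonpos (hk i hi) (by linarith)
    -- By `h0` and `h1` the sum of `k i * (A + B * x i) ^ 2` equals `A`, which is negative here.
    · exfalso
      have e : ∑ i ∈ s, w i * (A + B * x i) = A := by
        have : ∑ i ∈ s, w i * (A + B * x i) = A * ∑ i ∈ s, w i + B * ∑ i ∈ s, w i * x i := by
          rw [Finset.mul_sum, Finset.mul_sum, ← Finset.sum_add_distrib]
          exact Finset.sum_congr rfl fun i _ => by ring
        rw [this, h0, h1]; ring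
      have : 0 ≤ ∑ i ∈ s, w i * (A + B * x i) := Finset.sum_nonneg fun i hi => by
        rw [hw i hi, mul_assoc]
        exact mul_nonneg (hk i hi) (mul_self_nonneg _)
      linarith

/-- The second derivative is `M - σ * g''`. Taking `σ = 1` and `σ = -1` gives the two sides of the
bias bound. -/
theorem convexOn_quadratic_sub {g : ℝ → ℝ} (hg : ContDiff ℝ 2 g) {M σ c e : ℝ}
    (hσ : ∀ x, σ * iteratedDeriv 2 g x ≤ M) :
    ConvexOn ℝ univ fun x => M / 2 * x ^ 2 - σ * (g x - c - e * x) := by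
  have hd1 : ∀ x, HasDerivAt g (deriv g x) x := fun x =>
    (hg.differentiable (by norm_num) x).hasDerivAt
  have hd2 : ∀ x, HasDerivAt (deriv g) (iteratedDeriv 2 g x) x := fun x => by
    rw [iteratedDeriv_succ, iteratedDeriv_one]
    have : Differentiable ℝ (deriv g) := by
      have := hg.differentiable_iteratedDeriv 1 (by norm_num)
      rwa [iteratedDeriv_one] at this
    exact (this x).hasDerivAt
  have h1 : ∀ x, HasDerivAt (fun x => M / 2 * x ^ 2 - σ * (g x - c - e * x))
      (M * x - σ * (deriv g x - e)) x := fun x => by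
    have := ((hasDerivAt_pow 2 x).const_mul (M / 2)).sub
      ((((hd1 x).sub_const c).sub ((hasDerivAt_id x).const_mul e)).const_mul σ)
    refine HasDerivAt.congr_deriv this ?_
    push_cast
    ring
  have h2 : ∀ x, HasDerivAt (fun x => M * x - σ * (deriv g x - e))
      (M - σ * iteratedDeriv 2 g x) x := fun x => by
    have := ((hasDerivAt_id x).const_mul M).sub (((hd2 x).sub_const e).const_mul σ)
    refine HasDerivAt.congr_deriv this ?_
    ring
  refine convexOn_of_hasDerivWithinAt2_nonneg convex_univ
    (fun x _ => (h1 x).continuousAt.continuousWithinAt)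
    (fun x _ => (h1 x).hasDerivWithinAt) (fun x _ => (h2 x).hasDerivWithinAt)
    (fun x _ => by linarith [hσ x])

/-- Bias bound on one side of the threshold. -/
theorem abs_sum_weight_mul_sub_le {ι : Type*} (s : Finset ι) {k x w : ι → ℝ} {A B : ℝ}
    (hk : ∀ i ∈ s, 0 ≤ k i) (hx : ∀ i ∈ s, 0 ≤ x i) (hw : ∀ i ∈ s, w i = k i * (A + B * x i))
    (h0 : ∑ i ∈ s, w i = 1) (h1 : ∑ i ∈ s, w i * x i = 0) {g : ℝ → ℝ} (hg : ContDiff ℝ 2 g)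
    {M : ℝ} (hM : ∀ x, |iteratedDeriv 2 g x| ≤ M) :
    |∑ i ∈ s, w i * g (x i) - g 0| ≤ -(M / 2) * ∑ i ∈ s, w i * x i ^ 2 := by
  have key : ∀ σ : ℝ, |σ| = 1 → M / 2 * ∑ i ∈ s, w i * x i ^ 2 ≤
      σ * (∑ i ∈ s, w i * g (x i) - g 0) := by
    intro σ hσ
    have hc := convexOn_quadratic_sub hg (M := M) (σ := σ) (c := g 0) (e := 0) (fun x => by
      refine (le_abs_self _).trans ?_
      rw [abs_mul, hσ, one_mul]; exact hM x)
    have := sum_weight_mul_convex_nonpos s hk hx hw h0 h1 hc (by simp)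
    have e : ∑ i ∈ s, w i * (M / 2 * x i ^ 2 - σ * (g (x i) - g 0 - 0 * x i)) =
        M / 2 * ∑ i ∈ s, w i * x i ^ 2 - σ * (∑ i ∈ s, w i * g (x i) - g 0 * ∑ i ∈ s, w i) := by
      rw [Finset.mul_sum, Finset.mul_sum, ← Finset.sum_sub_distrib, Finset.mul_sum,
        ← Finset.sum_sub_distrib]
      exact Finset.sum_congr rfl fun i _ => by ring
    rw [e, h0, mul_one] at this
    linarith
  have a := key 1 (by simp)
  have b := key (-1) (by simp)
  rw [abs_le]
  constructor <;> linarith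

/-! ### Algebra of the regression weights. -/

section Weights

variable {n : ℕ} {K : ℝ → ℝ} {h d : ℝ} {X : Fin n → ℝ}

theorem kernelWeight_nonneg (hK : ∀ u, 0 ≤ K u) (x : ℝ) : 0 ≤ kernelWeight K h d x := by
  unfold kernelWeight; split_ifs; exacts [hK _, le_rfl]

/-- The interacted regression fits a separate line on each side of the threshold. Both the bias
bound and the negligibility of single weights rest on this form. -/
theorem exists_weight_eq (K : ℝ → ℝ) (h d : ℝ) (X : Fin n → ℝ) :
    ∃ A₁ B₁ A₀ B₀ : ℝ, ∀ i, weight K h d X i =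
      kernelWeight K h d (X i) * if 0 ≤ X i then A₁ + B₁ * X i else A₀ + B₀ * X i := by
  refine ⟨(gram K h d X)⁻¹ 0 0 + (gram K h d X)⁻¹ 0 3, (gram K h d X)⁻¹ 0 1 + (gram K h d X)⁻¹ 0 2,
    (gram K h d X)⁻¹ 0 3, (gram K h d X)⁻¹ 0 1, fun i => ?_⟩
  rw [weight]
  congr 1
  simp only [Matrix.mulVec, dotProduct, regressor, Fin.sum_univ_four]
  split_ifs <;> simp <;> ring

/-- This is row `0` of `G⁻¹ * G = 1`. It encodes that the weights sum to `1` on the right and `-1`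
on the left and annihilate linear functions on each side. -/
theorem sum_weight_mul_regressor (hG : IsUnit (gram K h d X).det) (j : Fin 4) :
    ∑ i, weight K h d X i * regressor (X i) j = (1 : Matrix (Fin 4) (Fin 4) ℝ) 0 j := by
  rw [← Matrix.nonsing_inv_mul _ hG]
  simp only [weight, Matrix.mulVec, dotProduct, Matrix.mul_apply]
  simp only [gram, Matrix.sum_apply, Matrix.smul_apply, Matrix.vecMulVec_apply, smul_eq_mul]
  simp only [Finset.mul_sum, Finset.sum_mul]
  rw [Finset.sum_comm]
  exact Finset.sum_congr rfl fun l _ => Finset.sum_congr rfl fun i _ => by ring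

/-- The one-sided bound is applied to the right part and to the reflected left part; the sign in the
worst-case bias makes the two bounds add up. -/
theorem abs_sum_weight_mul_sub_jump_le (hK : ∀ u, 0 ≤ K u) (hG : IsUnit (gram K h d X).det)
    {M : ℝ} {m : ℝ → ℝ} (hm : m ∈ smoothClass M) :
    |∑ i, weight K h d X i * m (X i) - jumpAtZero m| ≤ worstCaseBias K M h d X := by
  obtain ⟨m₁, m₀, h₁, h₀, b₁, b₀, hmx⟩ := hm
  obtain ⟨A₁, B₁, A₀, B₀, hw⟩ := exists_weight_eq K h d X
  rw [jumpAtZero_eq h₁.continuous h₀.continuous hmx]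
  set w := weight K h d X with hwdef
  have s0 := sum_weight_mul_regressor hG 0
  have s1 := sum_weight_mul_regressor hG 1
  have s2 := sum_weight_mul_regressor hG 2
  have s3 := sum_weight_mul_regressor hG 3
  simp [regressor, ← hwdef] at s0 s1 s2 s3
  have split : ∀ F : Fin n → ℝ, ∑ i, F i = ∑ i with 0 ≤ X i, F i + ∑ i with ¬ 0 ≤ X i, F i :=
    fun F => (Finset.sum_filter_add_sum_filter_not _ _ _).symm
  rw [← Finset.sum_filter] at s0 s2
  rw [split, s2] at s1
  rw [split, s0] at s3
  have R := abs_sum_weight_mul_sub_le (Finset.univ.filter fun i => 0 ≤ X i)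
    (k := fun i => kernelWeight K h d (X i)) (x := X) (w := w) (A := A₁) (B := B₁)
    (fun i _ => kernelWeight_nonneg hK _) (fun i hi => (Finset.mem_filter.1 hi).2)
    (fun i hi => by rw [hw, if_pos (Finset.mem_filter.1 hi).2]) s0 s2 h₁ b₁
  -- Reflection and a sign change turn the left weights, which sum to `-1`, into boundary weights of
  -- the form required.
  have L := abs_sum_weight_mul_sub_le (Finset.univ.filter fun i => ¬ 0 ≤ X i)
    (k := fun i => kernelWeight K h d (X i)) (x := fun i => -X i) (w := fun i => -w i)
    (A := -A₀) (B := B₀)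
    (fun i _ => kernelWeight_nonneg hK _)
    (fun i hi => by have := (Finset.mem_filter.1 hi).2; linarith)
    (fun i hi => by rw [hw, if_neg (Finset.mem_filter.1 hi).2]; ring)
    (by rw [Finset.sum_neg_distrib]; linarith)
    (by simp only [neg_mul_neg]; linarith) (g := fun x => m₀ (-x)) (h₀.comp contDiff_neg)
    (M := M) (fun x => by rw [iteratedDeriv_comp_neg]; simpa using b₀ (-x))
  have e1 : ∑ i, w i * m (X i) = ∑ i with 0 ≤ X i, w i * m₁ (X i) +
      ∑ i with ¬ 0 ≤ X i, w i * m₀ (X i) := by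
    rw [split]
    congr 1
    · exact Finset.sum_congr rfl fun i hi => by rw [hmx, if_pos (Finset.mem_filter.1 hi).2]
    · exact Finset.sum_congr rfl fun i hi => by rw [hmx, if_neg (Finset.mem_filter.1 hi).2]
  have e2 : worstCaseBias K M h d X = -(M / 2) * (∑ i with 0 ≤ X i, w i * X i ^ 2 -
      ∑ i with ¬ 0 ≤ X i, w i * X i ^ 2) := by
    rw [worstCaseBias, split, sub_eq_add_neg, ← Finset.sum_neg_distrib]
    congr 2
    · refine Finset.sum_congr rfl fun i hi => ?_
      -- At `X i = 0`, `Real.sign` is `0` rather than `1`, but the factor `X i ^ 2` vanishes as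
      -- well.
      rcases (Finset.mem_filter.1 hi).2.eq_or_lt with h | h
      · rw [← h]; simp
      · rw [Real.sign_of_pos h]; ring
    · refine Finset.sum_congr rfl fun i hi => ?_
      rw [Real.sign_of_neg (not_le.1 (Finset.mem_filter.1 hi).2)]; ring
  rw [e1, e2]
  simp only [neg_mul, neg_neg, neg_sq, Finset.sum_neg_distrib, neg_zero] at L R
  rw [abs_le] at *
  constructor <;> linarith [L.1, L.2, R.1, R.2]

/-! ### No weight dominates -/

/-- Two regions `A₁`, `A₂` of the window `(d, h]`, apart from each other by a fraction `γ` of its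
length, where the kernel is at least a fraction `κ` of its maximum `b` over the window. -/
structure KernelRegions (K : ℝ → ℝ) (h d κ γ b : ℝ) (A₁ A₂ : Set ℝ) : Prop where
  pos : 0 < b
  le : ∀ x ∈ Icc d h, K (x / h) ≤ b
  subset₁ : A₁ ⊆ Ioc d h
  subset₂ : A₂ ⊆ Ioc d h
  lower₁ : ∀ x ∈ A₁, κ * b ≤ K (x / h)
  lower₂ : ∀ x ∈ A₂, κ * b ≤ K (x / h)
  gap : ∀ x ∈ A₁, ∀ y ∈ A₂, γ * (h - d) ≤ y - x

/-- Two values of size at most `t`, taken `γ * (h - d)` apart, bound the slope by `2 * t / (γ * (h -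
d))`. Across the window this adds at most `2 * t / γ`, and `t ≤ t / γ`. -/
theorem abs_affine_le {γ A B x u v : ℝ} (hγ : 0 < γ) (hγ1 : γ ≤ 1) (hdh : d < h)
    (hx : x ∈ Icc d h) (hu : u ∈ Icc d h) (huv : γ * (h - d) ≤ v - u) {t : ℝ}
    (h1 : |A + B * u| ≤ t) (h2 : |A + B * v| ≤ t) : |A + B * x| ≤ 3 / γ * t := by
  have hl : 0 < h - d := by linarith
  have hlen : 0 < γ * (h - d) := by positivity
  have ht : 0 ≤ t := (abs_nonneg _).trans h1
  have hB : |B| * (γ * (h - d)) ≤ 2 * t := by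
    have e : B * (v - u) = (A + B * v) - (A + B * u) := by ring
    have h3 : |B| * (v - u) ≤ 2 * t := by
      rw [← abs_of_pos (show 0 < v - u by linarith), ← abs_mul, e]
      linarith [abs_sub (A + B * v) (A + B * u)]
    nlinarith [abs_nonneg B]
  have h4 : |B * (x - u)| ≤ |B| * (h - d) := by
    rw [abs_mul]
    refine mul_le_mul_of_nonneg_left ?_ (abs_nonneg _)
    rw [abs_le]; constructor <;> linarith [hx.1, hx.2, hu.1, hu.2]
  have e : A + B * x = (A + B * u) + B * (x - u) := by ring
  have h5 : |A + B * x| ≤ t + |B| * (h - d) := by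
    rw [e]; exact (abs_add_le _ _).trans (by linarith)
  rw [div_mul_eq_mul_div, le_div_iff₀ hγ]
  nlinarith

/-- On at least one of the two regions the affine factor stays above a fixed fraction of its value
at `i`, so that `N` terms of the sum are comparable to the term of `i`. -/
theorem sq_weight_le_of_regions {ι : Type*} (s s₁ s₂ : Finset ι) {k x : ι → ℝ} {κ γ b A B : ℝ}
    (hγ : 0 < γ) (hγ1 : γ ≤ 1) (hκ : 0 < κ) (hb : 0 < b) (hdh : d < h) {N : ℕ} (hN : 0 < N)
    (hk : ∀ i ∈ s, 0 ≤ k i) (hkb : ∀ i ∈ s, k i ≤ b) (hks : ∀ i ∈ s, k i ≠ 0 → x i ∈ Icc d h)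
    (h₁ : s₁ ⊆ s) (h₂ : s₂ ⊆ s) (hk₁ : ∀ i ∈ s₁, κ * b ≤ k i) (hk₂ : ∀ i ∈ s₂, κ * b ≤ k i)
    (hgap : ∀ i ∈ s₁, ∀ j ∈ s₂, γ * (h - d) ≤ x j - x i) (hN₁ : N ≤ s₁.card) (hN₂ : N ≤ s₂.card)
    (i : ι) (hi : i ∈ s) :
    (k i * (A + B * x i)) ^ 2 ≤
      9 / (γ ^ 2 * κ ^ 2 * N) * ∑ j ∈ s, (k j * (A + B * x j)) ^ 2 := by
  have hN' : (0 : ℝ) < N := by exact_mod_cast hN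
  rcases eq_or_ne (k i) 0 with h0 | h0
  · rw [h0]
    have : 0 ≤ ∑ j ∈ s, (k j * (A + B * x j)) ^ 2 := Finset.sum_nonneg fun _ _ => sq_nonneg _
    simp only [zero_mul, ne_eq, OfNat.ofNat_ne_zero, not_false_eq_true, zero_pow]
    positivity
  set T := |A + B * x i| with hT
  -- If each region had a point with affine value below `t`, `abs_affine_le` would give `T < 3 / γ *
  -- t = T`.
  set t := γ / 3 * T with ht
  have ht0 : 0 ≤ t := by positivity
  have lower : ∀ s' : Finset ι, s' ⊆ s → (∀ j ∈ s', κ * b ≤ k j) → N ≤ s'.card →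
      (∀ j ∈ s', t ≤ |A + B * x j|) →
      N * ((κ * b) ^ 2 * t ^ 2) ≤ ∑ j ∈ s, (k j * (A + B * x j)) ^ 2 := by
    intro s' hs' hk' hN'' ht'
    calc (N : ℝ) * ((κ * b) ^ 2 * t ^ 2) ≤ s'.card * ((κ * b) ^ 2 * t ^ 2) := by
          have : (N : ℝ) ≤ s'.card := by exact_mod_cast hN''
          gcongr
      _ = ∑ j ∈ s', (κ * b) ^ 2 * t ^ 2 := by simp
      _ ≤ ∑ j ∈ s', (k j * (A + B * x j)) ^ 2 := Finset.sum_le_sum fun j hj => by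
          rw [mul_pow (k j), ← sq_abs (A + B * x j)]
          have := hk' j hj; have := ht' j hj
          gcongr
      _ ≤ _ := Finset.sum_le_sum_of_subset_of_nonneg hs' fun _ _ _ => sq_nonneg _
  have main : N * ((κ * b) ^ 2 * t ^ 2) ≤ ∑ j ∈ s, (k j * (A + B * x j)) ^ 2 := by
    by_cases h : ∀ j ∈ s₁, t ≤ |A + B * x j|
    · exact lower s₁ h₁ hk₁ hN₁ h
    · push Not at h
      obtain ⟨u, hu, hut⟩ := h
      refine lower s₂ h₂ hk₂ hN₂ fun v hv => ?_
      by_contra hvt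
      push Not at hvt
      have hku : 0 < k u := lt_of_lt_of_le (by positivity) (hk₁ u hu)
      have := abs_affine_le hγ hγ1 hdh (hks i hi h0) (hks u (h₁ hu) hku.ne') (hgap u hu v hv)
        (A := A) (B := B) (t := max |A + B * x u| |A + B * x v|) (le_max_left _ _) (le_max_right _ _)
      have hlt : max |A + B * x u| |A + B * x v| < t := max_lt hut hvt
      have : T < 3 / γ * t := this.trans_lt (by gcongr)
      have e : 3 / γ * t = T := by rw [ht]; field_simp
      linarith
  have hup : (k i * (A + B * x i)) ^ 2 ≤ b ^ 2 * T ^ 2 := by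
    rw [mul_pow, ← sq_abs (A + B * x i)]
    have := hkb i hi; have := hk i hi
    gcongr
  refine hup.trans ?_
  rw [div_mul_eq_mul_div, le_div_iff₀ (by positivity)]
  have e : N * ((κ * b) ^ 2 * t ^ 2) * 9 = b ^ 2 * T ^ 2 * (γ ^ 2 * κ ^ 2 * N) := by
    rw [ht]; ring
  linarith

theorem kernelWeight_neg (hK : ∀ u, K (-u) = K u) (x : ℝ) :
    kernelWeight K h d (-x) = kernelWeight K h d x := by
  simp [kernelWeight, neg_div, hK]

theorem KernelRegions.mem_Icc_of_kernelWeight_ne_zero (hK : IsKernel K) (hd : 0 ≤ d) (hdh : d < h)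
    {x : ℝ} (hx : 0 ≤ x) (h0 : kernelWeight K h d x ≠ 0) : x ∈ Icc d h := by
  unfold kernelWeight at h0
  rw [abs_of_nonneg hx] at h0
  have h1 : d ≤ x := by by_contra h; simp [h] at h0
  refine ⟨h1, ?_⟩
  rw [if_pos h1] at h0
  by_contra hxh
  refine h0 (hK.zero_outside _ fun hmem => hxh ?_)
  exact (div_le_one (by linarith)).1 hmem.2

theorem IsKernel.kernelWeight_le {κ γ b : ℝ} {A₁ A₂ : Set ℝ} (hK : IsKernel K) (hd : 0 ≤ d)
    (hdh : d < h) (hR : KernelRegions K h d κ γ b A₁ A₂) {x : ℝ} (hx : 0 ≤ x) :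
    kernelWeight K h d x ≤ b := by
  by_cases h0 : kernelWeight K h d x = 0
  · rw [h0]; exact hR.pos.le
  · have hm := KernelRegions.mem_Icc_of_kernelWeight_ne_zero hK hd hdh hx h0
    rw [kernelWeight, abs_of_nonneg hx, if_pos hm.1]
    exact hR.le x hm

theorem kernelWeight_of_mem {x : ℝ} (hd : 0 ≤ d) (hx : x ∈ Ioc d h) :
    kernelWeight K h d x = K (x / h) := by
  rw [kernelWeight, abs_of_nonneg (hd.trans hx.1.le), if_pos hx.1.le]

/-- A null vector of the Gram matrix annihilates its quadratic form, so both fitted lines vanish at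
every observation with positive kernel weight; two distinct such points on each side force both
lines to be zero. -/
theorem isUnit_det_gram_of_regions {κ γ b : ℝ} {A₁ A₂ : Set ℝ} (hK : IsKernel K) (hd : 0 ≤ d)
    (hdh : d < h) (hκ : 0 < κ) (hγ : 0 < γ) (hR : KernelRegions K h d κ γ b A₁ A₂)
    (r₁ : ∃ i, X i ∈ A₁) (r₂ : ∃ i, X i ∈ A₂) (l₁ : ∃ i, -X i ∈ A₁) (l₂ : ∃ i, -X i ∈ A₂) :
    IsUnit (gram K h d X).det := by
  rw [isUnit_iff_ne_zero]
  intro hdet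
  obtain ⟨β, hβ, hz⟩ := Matrix.exists_mulVec_eq_zero_iff.2 hdet
  have hq : ∑ i, kernelWeight K h d (X i) * (regressor (X i) ⬝ᵥ β) ^ 2 = 0 := by
    have := congrArg (fun v => v ⬝ᵥ β) hz
    simp only [gram_mulVec, sum_dotProduct, smul_dotProduct, zero_dotProduct, smul_eq_mul] at this
    rw [← this]
    exact Finset.sum_congr rfl fun i _ => by ring
  have hq' : ∀ i, kernelWeight K h d (X i) * (regressor (X i) ⬝ᵥ β) ^ 2 = 0 := fun i =>
    (Finset.sum_eq_zero_iff_of_nonneg fun i _ =>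
      mul_nonneg (kernelWeight_nonneg hK.nonneg _) (sq_nonneg _)).1 hq i (Finset.mem_univ i)
  have hκb : 0 < κ * b := mul_pos hκ hR.pos
  have posK : ∀ x, x ∈ A₁ ∨ x ∈ A₂ → 0 < x ∧ 0 < kernelWeight K h d x := by
    rintro x (hx | hx)
    · have := hR.subset₁ hx
      exact ⟨hd.trans_lt this.1, by
        rw [kernelWeight_of_mem hd this]; exact hκb.trans_le (hR.lower₁ x hx)⟩
    · have := hR.subset₂ hx
      exact ⟨hd.trans_lt this.1, by
        rw [kernelWeight_of_mem hd this]; exact hκb.trans_le (hR.lower₂ x hx)⟩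
  have right : ∀ i, X i ∈ A₁ ∨ X i ∈ A₂ → (β 0 + β 3) + (β 1 + β 2) * X i = 0 := fun i hi => by
    have hp := posK _ hi
    have := (mul_eq_zero.1 (hq' i)).resolve_left hp.2.ne'
    have := pow_eq_zero_iff (two_ne_zero) |>.1 this
    simp [regressor, dotProduct, Fin.sum_univ_four, hp.1.le] at this
    linarith
  have left : ∀ i, -X i ∈ A₁ ∨ -X i ∈ A₂ → β 3 + β 1 * X i = 0 := fun i hi => by
    have hp := posK _ hi
    rw [kernelWeight_neg hK.symmetric] at hp
    have := (mul_eq_zero.1 (hq' i)).resolve_left hp.2.ne'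
    have := pow_eq_zero_iff (two_ne_zero) |>.1 this
    have hneg : ¬ 0 ≤ X i := by linarith [hp.1]
    simp [regressor, dotProduct, Fin.sum_univ_four, hneg] at this
    linarith
  have two : ∀ {a c x y : ℝ}, 0 < y - x → a + c * x = 0 → a + c * y = 0 → a = 0 ∧ c = 0 := by
    intro a c x y hxy h1 h2
    have : c * (y - x) = 0 := by linarith
    have hc := (mul_eq_zero.1 this).resolve_right hxy.ne'
    exact ⟨by simpa [hc] using h1, hc⟩
  have hgap : 0 < γ * (h - d) := mul_pos hγ (by linarith)
  obtain ⟨i₁, hi₁⟩ := r₁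
  obtain ⟨i₂, hi₂⟩ := r₂
  obtain ⟨j₁, hj₁⟩ := l₁
  obtain ⟨j₂, hj₂⟩ := l₂
  obtain ⟨a1, a2⟩ := two (hgap.trans_le (hR.gap _ hi₁ _ hi₂)) (right i₁ (.inl hi₁))
    (right i₂ (.inr hi₂))
  obtain ⟨a3, a4⟩ := two (a := β 3) (c := -β 1) (hgap.trans_le (hR.gap _ hj₁ _ hj₂))
    (by linarith [left j₁ (.inl hj₁)]) (by linarith [left j₂ (.inr hj₂)])
  apply hβ
  ext j
  fin_cases j <;> simp <;> linarith

/-- Each side is treated separately, the left one after reflection; the sum over one side is at most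
the full sum. -/
theorem sq_weight_le_of_count {κ γ b : ℝ} {A₁ A₂ : Set ℝ} (hK : IsKernel K) (hd : 0 ≤ d)
    (hdh : d < h) (hκ : 0 < κ) (hγ : 0 < γ) (hγ1 : γ ≤ 1) (hR : KernelRegions K h d κ γ b A₁ A₂)
    {N : ℕ} (hN : 0 < N) {r₁ r₂ l₁ l₂ : Finset (Fin n)} (hr₁ : ∀ i ∈ r₁, X i ∈ A₁)
    (hr₂ : ∀ i ∈ r₂, X i ∈ A₂) (hl₁ : ∀ i ∈ l₁, -X i ∈ A₁) (hl₂ : ∀ i ∈ l₂, -X i ∈ A₂)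
    (nr₁ : N ≤ r₁.card) (nr₂ : N ≤ r₂.card) (nl₁ : N ≤ l₁.card) (nl₂ : N ≤ l₂.card) (i : Fin n) :
    weight K h d X i ^ 2 ≤ 9 / (γ ^ 2 * κ ^ 2 * N) * ∑ j, weight K h d X j ^ 2 := by
  obtain ⟨A, B, A', B', hw⟩ := exists_weight_eq K h d X
  have hN' : (0 : ℝ) < N := by exact_mod_cast hN
  have sub : ∀ s : Finset (Fin n), 9 / (γ ^ 2 * κ ^ 2 * N) * ∑ j ∈ s, weight K h d X j ^ 2 ≤
      9 / (γ ^ 2 * κ ^ 2 * N) * ∑ j, weight K h d X j ^ 2 := fun s =>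
    mul_le_mul_of_nonneg_left (Finset.sum_le_sum_of_subset_of_nonneg (Finset.subset_univ s)
      fun _ _ _ => sq_nonneg _) (by positivity)
  have p₁ : ∀ x ∈ A₁, 0 < x := fun x hx => hd.trans_lt (hR.subset₁ hx).1
  have p₂ : ∀ x ∈ A₂, 0 < x := fun x hx => hd.trans_lt (hR.subset₂ hx).1
  have k₁ : ∀ x ∈ A₁, κ * b ≤ kernelWeight K h d x := fun x hx => by
    rw [kernelWeight_of_mem hd (hR.subset₁ hx)]; exact hR.lower₁ x hx
  have k₂ : ∀ x ∈ A₂, κ * b ≤ kernelWeight K h d x := fun x hx => by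
    rw [kernelWeight_of_mem hd (hR.subset₂ hx)]; exact hR.lower₂ x hx
  by_cases hi : 0 ≤ X i
  · have := sq_weight_le_of_regions (Finset.univ.filter fun i => 0 ≤ X i) r₁ r₂ (h := h) (d := d)
      (k := fun i => kernelWeight K h d (X i)) (x := X) (A := A) (B := B) hγ hγ1 hκ hR.pos hdh hN
      (fun i _ => kernelWeight_nonneg hK.nonneg _)
      (fun i hi => hK.kernelWeight_le hd hdh hR (Finset.mem_filter.1 hi).2)
      (fun i hi h0 => KernelRegions.mem_Icc_of_kernelWeight_ne_zero hK hd hdh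
        (Finset.mem_filter.1 hi).2 h0)
      (fun i hi => by simpa using (p₁ _ (hr₁ i hi)).le)
      (fun i hi => by simpa using (p₂ _ (hr₂ i hi)).le)
      (fun i hi => k₁ _ (hr₁ i hi)) (fun i hi => k₂ _ (hr₂ i hi))
      (fun i hi j hj => hR.gap _ (hr₁ i hi) _ (hr₂ j hj)) nr₁ nr₂ i (by simpa using hi)
    refine le_trans (le_of_eq_of_le ?_ (this.trans_eq ?_)) (sub (Finset.univ.filter fun i => 0 ≤ X i))
    · rw [hw, if_pos hi]
    · congr 1
      exact Finset.sum_congr rfl fun j hj => by rw [hw, if_pos (Finset.mem_filter.1 hj).2]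
  · have kn := fun x => kernelWeight_neg (h := h) (d := d) hK.symmetric x
    have := sq_weight_le_of_regions (Finset.univ.filter fun i => ¬ 0 ≤ X i) l₁ l₂ (h := h) (d := d)
      (k := fun i => kernelWeight K h d (X i)) (x := fun i => -X i) (A := A') (B := -B')
      hγ hγ1 hκ hR.pos hdh hN
      (fun i _ => kernelWeight_nonneg hK.nonneg _)
      (fun i hi => by
        rw [← kn]
        exact hK.kernelWeight_le hd hdh hR (by have := (Finset.mem_filter.1 hi).2; linarith))
      (fun i hi h0 => by
        rw [← kn] at h0
        exact KernelRegions.mem_Icc_of_kernelWeight_ne_zero hK hd hdh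
          (by have := (Finset.mem_filter.1 hi).2; linarith) h0)
      (fun i hi => by simpa using p₁ _ (hl₁ i hi))
      (fun i hi => by simpa using p₂ _ (hl₂ i hi))
      (fun i hi => by rw [← kn]; exact k₁ _ (hl₁ i hi))
      (fun i hi => by rw [← kn]; exact k₂ _ (hl₂ i hi))
      (fun i hi j hj => hR.gap _ (hl₁ i hi) _ (hl₂ j hj)) nl₁ nl₂ i (by simpa using hi)
    refine le_trans (le_of_eq_of_le ?_ (this.trans_eq ?_)) 
      (sub (Finset.univ.filter fun i => ¬ 0 ≤ X i))
    · rw [hw, if_neg hi]; ring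
    · congr 1
      exact Finset.sum_congr rfl fun j hj => by
        rw [hw, if_neg (Finset.mem_filter.1 hj).2]; ring

theorem sum_sq_weight_pos (hG : IsUnit (gram K h d X).det) : 0 < ∑ j, weight K h d X j ^ 2 := by
  refine (Finset.sum_nonneg fun _ _ => sq_nonneg _).lt_of_ne fun h0 => ?_
  have hz : ∀ i, weight K h d X i = 0 := fun i => by
    have := (Finset.sum_eq_zero_iff_of_nonneg fun _ _ => sq_nonneg _).1 h0.symm i (Finset.mem_univ i)
    simpa using this
  have := sum_weight_mul_regressor hG 0
  simp [hz] at this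

end Weights

/-! ### Regions of the window where the kernel is large -/

theorem IsKernel.measurable {K : ℝ → ℝ} (hK : IsKernel K) : Measurable K := by
  have h : K = (Icc (-1 : ℝ) 1).piecewise K (fun _ => 0) := by
    ext u
    by_cases hu : u ∈ Icc (-1 : ℝ) 1
    · simp only [Set.piecewise, if_pos hu]
    · simp only [Set.piecewise, if_neg hu, hK.zero_outside u hu]
  rw [h]
  exact hK.continuousOn.measurable_piecewise continuousOn_const measurableSet_Icc

/-- A subset of `(d, h]` of measure `λ (h - d)` contains two parts of proportional measure that are
apart from each other. -/
theorem exists_separated_subsets {A : Set ℝ} {d h l : ℝ} (hA : MeasurableSet A)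
    (hAs : A ⊆ Ioc d h) (hdh : d < h) (hl : 0 < l) (hvol : l * (h - d) ≤ volume.real A) :
    ∃ A₁ A₂, A₁ ⊆ A ∧ A₂ ⊆ A ∧ MeasurableSet A₁ ∧ MeasurableSet A₂ ∧
      (∀ x ∈ A₁, ∀ y ∈ A₂, l / 3 * (h - d) ≤ y - x) ∧
      l / 3 * (h - d) ≤ volume.real A₁ ∧ l / 3 * (h - d) ≤ volume.real A₂ := by
  have hfin : ∀ B ⊆ Ioc d h, volume B ≠ ⊤ := fun B hB =>
    ((measure_mono hB).trans_lt (by simp)).ne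
  have hint : ∀ x y, IntervalIntegrable (A.indicator fun _ => (1 : ℝ)) volume x y := fun x y =>
    ((integrable_indicator_iff hA).2 (integrableOn_const (hfin A hAs))).intervalIntegrable
  set F : ℝ → ℝ := fun t => ∫ x in d..t, A.indicator (fun _ => (1 : ℝ)) x with hF
  have hFt : ∀ t, d ≤ t → F t = volume.real (A ∩ Iic t) := fun t ht => by
    rw [hF]
    beta_reduce
    rw [intervalIntegral.integral_of_le ht, setIntegral_indicator hA]
    have : Ioc d t ∩ A = A ∩ Iic t := by
      ext x
      simp only [mem_inter_iff, mem_Ioc, mem_Iic]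
      exact ⟨fun hx => ⟨hx.2, hx.1.2⟩, fun hx => ⟨⟨(hAs hx.1).1, hx.2⟩, hx.1⟩⟩
    rw [this]
    simp
  have hl0 : 0 < l * (h - d) := mul_pos hl (by linarith)
  have hFh : F h = volume.real A := by
    rw [hFt h hdh.le]
    congr 1
    exact inter_eq_left.2 fun x hx => (hAs hx).2
  have hFd : F d = 0 := by simp [hF]
  -- The point `t` cuts off a mass of `l / 3 * (h - d)`. A gap of that same length removes at most
  -- as much again, which leaves at least a third for the upper part.
  obtain ⟨t, ht, hFt'⟩ := intermediate_value_Icc hdh.le (f := F)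
    (intervalIntegral.continuous_primitive hint d).continuousOn
    (show l / 3 * (h - d) ∈ Icc (F d) (F h) by rw [hFd, hFh]; constructor <;> linarith)
  set t' := t + l / 3 * (h - d) with ht'
  refine ⟨A ∩ Iic t, A ∩ Ici t', inter_subset_left, inter_subset_left, hA.inter measurableSet_Iic,
    hA.inter measurableSet_Ici, fun x hx y hy => ?_, ?_, ?_⟩
  · have h1 : x ≤ t := hx.2
    have h2 : t' ≤ y := hy.2
    linarith
  · rw [← hFt t ht.1, hFt']
  · have hsub : A ⊆ (A ∩ Iic t) ∪ (Ioc t t' ∪ (A ∩ Ici t')) := fun x hx => by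
      simp only [mem_union, mem_inter_iff, mem_Iic, mem_Ioc, mem_Ici]
      grind
    have h1 : volume.real A ≤ volume.real ((A ∩ Iic t) ∪ (Ioc t t' ∪ (A ∩ Ici t'))) := by
      refine measureReal_mono hsub (measure_union_ne_top (hfin _ (inter_subset_left.trans hAs))
        (measure_union_ne_top (by simp) (hfin _ (inter_subset_left.trans hAs))))
    have h2 := measureReal_union_le (μ := volume) (A ∩ Iic t) (Ioc t t' ∪ (A ∩ Ici t'))
    have h3 := measureReal_union_le (μ := volume) (Ioc t t') (A ∩ Ici t')
    have h4 : volume.real (Ioc t t') = l / 3 * (h - d) := by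
      rw [Real.volume_real_Ioc_of_le (by rw [ht']; linarith)]; rw [ht']; ring
    rw [← hFt t ht.1, hFt'] at h2
    linarith

/-- A reverse Markov inequality: a function bounded by `b` whose integral is large must exceed `τ`
on a large set. -/
theorem integral_le_mul_measureReal_add {f : ℝ → ℝ} (hf : Measurable f) {d h b τ : ℝ} (hdh : d < h)
    (h0 : ∀ x ∈ Icc d h, 0 ≤ f x) (hb : ∀ x ∈ Icc d h, f x ≤ b) (hτ : 0 ≤ τ) :
    ∫ x in d..h, f x ≤ b * volume.real {x ∈ Ioc d h | τ ≤ f x} + τ * (h - d) := by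
  set A := {x ∈ Ioc d h | τ ≤ f x} with hA
  have hAm : MeasurableSet A := measurableSet_Ioc.inter (measurableSet_le measurable_const hf)
  have hAf : volume A ≠ ⊤ := ((measure_mono (sep_subset _ _)).trans_lt (by simp)).ne
  rw [intervalIntegral.integral_of_le hdh.le]
  have hb0 : 0 ≤ b := (h0 d ⟨le_rfl, hdh.le⟩).trans (hb d ⟨le_rfl, hdh.le⟩)
  have i1 : IntegrableOn (A.indicator fun _ => b) (Ioc d h) := by
    refine Integrable.integrableOn ?_
    exact (integrable_indicator_iff hAm).2 (integrableOn_const hAf)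
  have i2 : IntegrableOn (fun _ : ℝ => τ) (Ioc d h) := integrableOn_const (by simp)
  have h1 : ∫ x in Ioc d h, f x ≤ ∫ x in Ioc d h, (A.indicator (fun _ => b) x + τ) := by
    refine integral_mono_of_nonneg ?_ (i1.add i2) ?_
    · filter_upwards [ae_restrict_mem measurableSet_Ioc] with x hx using h0 x (Ioc_subset_Icc_self hx)
    · filter_upwards [ae_restrict_mem measurableSet_Ioc] with x hx
      by_cases hxA : x ∈ A
      · rw [indicator_of_mem hxA]
        linarith [hb x (Ioc_subset_Icc_self hx)]
      · rw [indicator_of_notMem hxA]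
        have : ¬ τ ≤ f x := fun hτ => hxA ⟨hx, hτ⟩
        linarith
  rw [integral_add i1 i2, setIntegral_indicator hAm] at h1
  refine h1.trans (le_of_eq ?_)
  have : Ioc d h ∩ A = A := inter_eq_right.2 (sep_subset _ _)
  rw [this]
  simp [Real.volume_real_Ioc_of_le hdh.le, mul_comm]

/-- The kernel is at least a fraction `κ` of an upper bound on at least a fraction `l` of the
window. -/
def KernelSpread (K : ℝ → ℝ) (h d κ l : ℝ) : Prop :=
  ∃ b, 0 < b ∧ (∀ x ∈ Icc d h, K (x / h) ≤ b) ∧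
    l * (h - d) ≤ volume.real {x ∈ Ioc d h | κ * b ≤ K (x / h)}

/-- By continuity the kernel exceeds `K u / 2` near `u`, and rescaling by `h` keeps the proportion
of the window fixed. -/
theorem exists_kernelSpread_of_pos {K : ℝ → ℝ} (hK : IsKernel K) {c u : ℝ} (hc : 0 ≤ c)
    (hu : u ∈ Ioo c 1) (hKu : 0 < K u) :
    ∃ κ > 0, ∃ l > 0, ∀ h d : ℝ, 0 < h → d = c * h → KernelSpread K h d κ l := by
  obtain ⟨B, hB⟩ := hK.bounded
  have hB0 : 0 < B := hKu.trans_le (hB u)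
  have hcont : ContinuousAt K u :=
    hK.continuousOn.continuousAt (Icc_mem_nhds (by linarith [hu.1]) hu.2)
  have hev : ∀ᶠ x in 𝓝 u, K u / 2 < K x ∧ x ∈ Ioo c 1 :=
    (hcont.eventually_const_lt (by linarith)).and (Ioo_mem_nhds hu.1 hu.2)
  obtain ⟨ρ, hρ, hball⟩ := Metric.eventually_nhds_iff.1 hev
  refine ⟨K u / (2 * B), by positivity, ρ, hρ, fun h d hh hd => ⟨B, hB0, fun x _ => hB _, ?_⟩⟩
  have hd0 : 0 ≤ d := by rw [hd]; positivity
  have hsub : Ioc (h * u) (h * (u + ρ / 2)) ∪ Ioc (h * (u - ρ / 2)) (h * u) ⊆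
      {x ∈ Ioc d h | K u / (2 * B) * B ≤ K (x / h)} := by
    intro x hx
    have hx' : h * (u - ρ / 2) < x ∧ x ≤ h * (u + ρ / 2) := by
      rcases hx with hx | hx
      · exact ⟨lt_of_le_of_lt (by nlinarith) hx.1, hx.2⟩
      · exact ⟨hx.1, hx.2.trans (by nlinarith)⟩
    have h1 : u - ρ / 2 < x / h := by rw [lt_div_iff₀ hh]; linarith [hx'.1]
    have h2 : x / h ≤ u + ρ / 2 := by rw [div_le_iff₀ hh]; linarith [hx'.2]
    have := hball (y := x / h) (by rw [Real.dist_eq, abs_lt]; constructor <;> linarith)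
    refine ⟨⟨?_, ?_⟩, ?_⟩
    · rw [hd]; exact (lt_div_iff₀ hh).1 this.2.1
    · exact (div_le_one hh).1 this.2.2.le
    · refine le_trans (le_of_eq ?_) this.1.le
      field_simp
  have h1 := measureReal_mono hsub
    ((measure_mono (μ := volume) (sep_subset _ _)).trans_lt (by simp)).ne
  have h2 : Ioc (h * u) (h * (u + ρ / 2)) ∪ Ioc (h * (u - ρ / 2)) (h * u) =
      Ioc (h * (u - ρ / 2)) (h * (u + ρ / 2)) := by
    rw [union_comm, Ioc_union_Ioc_eq_Ioc (by nlinarith) (by nlinarith)]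
  rw [h2, Real.volume_real_Ioc_of_le (by nlinarith)] at h1
  refine le_trans ?_ h1
  nlinarith

/-- Where the kernel is below half its average over `[c, 1]` it contributes at most half of the
integral; the rest must come from a set of proportional measure, as the maximum is a bounded
multiple of the average. -/
theorem exists_kernelSpread_of_regularAtEdge {K : ℝ → ℝ} (hK : IsKernel K)
    (hE : KernelRegularAtEdge K) :
    ∃ κ > 0, ∃ l > 0, ∀ᶠ c in 𝓝[<] (1 : ℝ), ∀ h d : ℝ, 0 < h → d = c * h →
      KernelSpread K h d κ l := by
  obtain ⟨C, hC⟩ := hE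
  set C' := max C 1 with hC'
  have hC'0 : 0 < C' := lt_of_lt_of_le one_pos (le_max_right _ _)
  refine ⟨1 / (2 * C'), by positivity, 1 / (2 * C'), by positivity, ?_⟩
  filter_upwards [hC, self_mem_nhdsWithin] with c ⟨hI, hcK⟩ hc1 h d hh hd
  set I := ∫ u in c..1, K u with hIdef
  have hc1' : 0 < 1 - c := sub_pos.2 hc1
  have hhd : h - d = h * (1 - c) := by rw [hd]; ring
  have hdh : d < h := by nlinarith
  -- `C'` times the average, so that the threshold `1 / (2 * C') * b` is half the average.
  set b := C' * I / (1 - c) with hb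
  have hb0 : 0 < b := by positivity
  have hle : ∀ x ∈ Icc d h, K (x / h) ≤ b := fun x hx => by
    have h1 := hcK (x / h) ⟨by rw [le_div_iff₀ hh, ← hd]; exact hx.1, (div_le_one hh).2 hx.2⟩
    rw [hb, le_div_iff₀ hc1']
    have : C * I ≤ C' * I := mul_le_mul_of_nonneg_right (le_max_left _ _) hI.le
    linarith
  refine ⟨b, hb0, hle, ?_⟩
  have hKm : Measurable fun x => K (x / h) := hK.measurable.comp (measurable_id.div_const h)
  have hmain := integral_le_mul_measureReal_add hKm hdh (fun x _ => hK.nonneg _) hle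
    (τ := 1 / (2 * C') * b) (by positivity)
  have hJ : ∫ x in d..h, K (x / h) = h * I := by
    rw [intervalIntegral.integral_comp_div _ hh.ne', smul_eq_mul]
    have h1 : d / h = c := by rw [hd]; field_simp
    rw [h1, div_self hh.ne']
  rw [hJ] at hmain
  have e1 : 1 / (2 * C') * b * (h - d) = h * I / 2 := by rw [hb, hhd]; field_simp
  rw [e1] at hmain
  have h2 : h * I / 2 ≤ b * volume.real {x ∈ Ioc d h | 1 / (2 * C') * b ≤ K (x / h)} := by
    linarith
  have e2 : b * (1 / (2 * C') * (h - d)) = h * I / 2 := by rw [hb, hhd]; field_simp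
  rw [← e2] at h2
  exact le_of_mul_le_mul_left h2 hb0

theorem IsKernel.exists_pos {K : ℝ → ℝ} (hK : IsKernel K) : ∃ u ∈ Ioo (0 : ℝ) 1, 0 < K u := by
  by_contra hcon
  push Not at hcon
  have h0 : ∀ᵐ u, K u = 0 := by
    have hne : ∀ x : ℝ, ∀ᵐ u : ℝ, u ≠ x := fun x => by simp [ae_iff]
    filter_upwards [hne 0, hne 1, hne (-1)] with u h0 h1 h2
    by_cases hu : u ∈ Icc (-1 : ℝ) 1
    · rcases lt_or_gt_of_ne h0 with h | h
      · rw [← hK.symmetric]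
        exact le_antisymm (hcon (-u) ⟨by linarith, by
          have := lt_of_le_of_ne hu.1 (Ne.symm h2); linarith⟩) (hK.nonneg _)
      · exact le_antisymm (hcon u ⟨h, lt_of_le_of_ne hu.2 h1⟩) (hK.nonneg _)
    · exact hK.zero_outside u hu
  have := hK.integral_eq_one
  rw [integral_congr_ae h0] at this
  simp at this

/-! ### Consequences of the asymptotic frameworks -/

/-- What both asymptotic frameworks have in common. -/
structure WindowAsymptotics (K : ℝ → ℝ) (h d : ℕ → ℝ) (a b κ l : ℝ) : Prop where
  spread : ∀ᶠ n in atTop, KernelSpread K (h n) (d n) κ l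
  inside : ∀ᶠ n in atTop, Icc (-(h n)) (h n) ⊆ Ioo a b
  sampleSize : Tendsto (fun n : ℕ => (n : ℝ) * (h n - d n)) atTop atTop

theorem eventually_Icc_subset {h : ℕ → ℝ} {d₀ a b : ℝ} (hh : Tendsto h atTop (𝓝 d₀))
    (ha : a < -d₀) (hb : d₀ < b) : ∀ᶠ n in atTop, Icc (-(h n)) (h n) ⊆ Ioo a b := by
  filter_upwards [hh.neg.eventually_const_lt ha, hh.eventually_lt_const hb] with n h1 h2 x hx
  exact ⟨h1.trans_le hx.1, hx.2.trans_lt h2⟩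

/-- For small donuts `n (h - d) = (1 - c) n h`; for large ones `d / h` tends to `1` from below,
which brings in the edge condition. -/
theorem exists_windowAsymptotics {K : ℝ → ℝ} (hK : IsKernel K) {h d : ℕ → ℝ}
    (hd : ∀ n, 0 ≤ d n ∧ d n < h n)
    (hasymp : (∃ c, SmallDonut c h d ∧ ∃ u ∈ Ioo c 1, 0 < K u) ∨
      (LargeDonut h d ∧ KernelRegularAtEdge K)) {a b : ℝ}
    (hhole : ∀ᶠ n in atTop, Icc (-(d n)) (d n) ⊆ Ioo a b) :
    ∃ κ > 0, ∃ l > 0, WindowAsymptotics K h d a b κ l := by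
  have hpos : ∀ n, 0 < h n := fun n => (hd n).1.trans_lt (hd n).2
  obtain ⟨n₀, hn₀⟩ := hhole.exists
  have hzero : (0 : ℝ) ∈ Ioo a b := hn₀ ⟨by linarith [(hd n₀).1], (hd n₀).1⟩
  have small : ∀ c, SmallDonut c h d → (∃ u ∈ Ioo c 1, 0 < K u) →
      ∃ κ > 0, ∃ l > 0, WindowAsymptotics K h d a b κ l := by
    rintro c hc ⟨u, hu, hKu⟩
    obtain ⟨κ, hκ, l, hl, H⟩ := exists_kernelSpread_of_pos hK hc.nonneg hu hKu
    refine ⟨κ, hκ, l, hl, Eventually.of_forall fun n => H _ _ (hpos n) (hc.donut_eq n),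
      eventually_Icc_subset hc.bandwidth (by simpa using hzero.1) hzero.2, ?_⟩
    have := hc.sampleSize.atTop_mul_const (sub_pos.2 hc.lt_one)
    refine this.congr fun n => ?_
    rw [hc.donut_eq]; ring
  rcases hasymp with ⟨c, hc, hu⟩ | ⟨hL, hE⟩
  · exact small c hc hu
  · rcases (hd 0).1.eq_or_lt with h0 | h0
    -- A fixed donut of size zero is a small donut with `c = 0`.
    · refine small 0 ⟨le_rfl, one_pos, fun n => ?_, ?_, ?_⟩ hK.exists_pos
      · rw [hL.fixed n 0, ← h0]; simp
      · rw [h0]; exact hL.bandwidth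
      · refine hL.sampleSize.congr fun n => ?_
        rw [hL.fixed n 0, ← h0]; simp
    · obtain ⟨κ, hκ, l, hl, H⟩ := exists_kernelSpread_of_regularAtEdge hK hE
      have hd0 : ∀ n, d n = d 0 := fun n => hL.fixed n 0
      have hsub : Icc (-(d 0)) (d 0) ⊆ Ioo a b := by rw [← hd0 n₀]; exact hn₀
      have hlim : Tendsto (fun n => d 0 / h n) atTop (𝓝[<] 1) := by
        refine tendsto_nhdsWithin_iff.2 ⟨?_, Eventually.of_forall fun n => ?_⟩
        · have := (tendsto_const_nhds (x := d 0)).div hL.bandwidth h0.ne'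
          rwa [div_self h0.ne'] at this
        · exact (div_lt_one (hpos n)).2 (by rw [← hd0 n]; exact (hd n).2)
      refine ⟨κ, hκ, l, hl, ?_, eventually_Icc_subset hL.bandwidth
        (hsub ⟨le_rfl, by linarith⟩).1 (hsub ⟨by linarith, le_rfl⟩).2, hL.sampleSize⟩
      filter_upwards [hlim.eventually H] with n hn
      exact hn _ _ (hpos n) (by rw [hd0 n, div_mul_cancel₀ _ (hpos n).ne'])

/-! ### Number of observations in a region -/

/-- Chebyshev's inequality for a binomial count: its variance is at most its mean `n * p'`, and a
count below half the mean is a deviation of `n * p' / 2`. -/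
theorem measure_count_lt_le {n N : ℕ} {ν : Measure ℝ} [IsProbabilityMeasure ν] {A : Set ℝ}
    (hA : MeasurableSet A) {p : ℝ} (hp : 0 < p) (hpA : p ≤ ν.real A) (hn : 0 < n)
    (hN : (N : ℝ) ≤ n * p / 2) :
    ∃ B : Set (Fin n → ℝ), MeasurableSet B ∧
      (Measure.pi fun _ => ν) B ≤ ENNReal.ofReal (4 / (n * p)) ∧
      ∀ x ∉ B, ∃ s : Finset (Fin n), (∀ i ∈ s, x i ∈ A) ∧ N ≤ s.card := by
  classical
  set μ : Measure (Fin n → ℝ) := Measure.pi fun _ => ν with hμ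
  set f : ℝ → ℝ := A.indicator fun _ => 1 with hf
  have hfm : Measurable f := measurable_const.indicator hA
  have hf0 : ∀ x, 0 ≤ f x := fun x => indicator_nonneg (fun _ _ => zero_le_one) x
  have hf1 : ∀ x, f x ≤ 1 := fun x => indicator_le_self' (f := fun _ => (1 : ℝ))
    (fun _ _ => zero_le_one) x
  set p' := ν.real A with hp'
  have hn' : (0 : ℝ) < n := by exact_mod_cast hn
  have hp'0 : 0 < p' := hp.trans_le hpA
  set S : (Fin n → ℝ) → ℝ := ∑ i, fun x => f (x i) with hS
  have hLp : ∀ i : Fin n, MemLp (fun x : Fin n → ℝ => f (x i)) 2 μ := fun i =>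
    MemLp.of_bound (hfm.comp (measurable_pi_apply i)).aestronglyMeasurable 1
      (ae_of_all _ fun x => by
        rw [Real.norm_eq_abs, abs_of_nonneg (hf0 _)]; exact hf1 _)
  have hmean : ∀ i : Fin n, ∫ x, f (x i) ∂μ = p' := fun i => by
    rw [integral_comp_eval hfm.aestronglyMeasurable, hf, integral_indicator hA]
    simp [hp']
  have hvar : ∀ i : Fin n, Var[fun x : Fin n → ℝ => f (x i); μ] ≤ p' := fun i => by
    refine (variance_le_expectation_sq (hLp i).1).trans (le_of_eq ?_)
    rw [← hmean i]
    refine integral_congr_ae (ae_of_all _ fun x => ?_)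
    by_cases hx : x i ∈ A <;> simp [hf, hx]
  have hSm : ∫ x, S x ∂μ = n * p' := by
    simp only [hS, Finset.sum_apply]
    rw [integral_finsetSum _ fun i _ => (hLp i).integrable (by norm_num)]
    simp [hmean]
  have hSv : Var[S; μ] ≤ n * p' := by
    rw [hS, IndepFun.variance_sum (fun i _ => hLp i) fun i _ j _ hij =>
      (iIndepFun_pi (μ := fun _ : Fin n => ν) (X := fun _ => f)
        fun _ => hfm.aemeasurable).indepFun hij]
    refine (Finset.sum_le_sum fun i _ => hvar i).trans_eq ?_
    simp
  have hSL : MemLp S 2 μ := memLp_finsetSum' _ fun i _ => hLp i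
  refine ⟨{x | n * p' / 2 ≤ |S x - ∫ y, S y ∂μ|}, ?_, ?_, fun x hx => ?_⟩
  · refine measurableSet_le measurable_const ?_
    have : Measurable S := by
      have : S = fun x => ∑ i, f (x i) := by ext x; simp [hS]
      rw [this]
      exact Finset.measurable_sum _ fun i _ => hfm.comp (measurable_pi_apply i)
    exact measurable_norm.comp (this.sub_const _)
  · refine (meas_ge_le_variance_div_sq hSL (by positivity)).trans (ENNReal.ofReal_le_ofReal ?_)
    calc Var[S; μ] / (n * p' / 2) ^ 2 ≤ n * p' / (n * p' / 2) ^ 2 := by gcongr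
      _ = 4 / (n * p') := by field_simp; ring
      _ ≤ 4 / (n * p) := by gcongr
  · refine ⟨Finset.univ.filter fun i => x i ∈ A, fun i hi => (Finset.mem_filter.1 hi).2, ?_⟩
    rw [mem_ofPred_eq, hSm, not_le, abs_lt] at hx
    have hcard : S x = ((Finset.univ.filter fun i => x i ∈ A).card : ℝ) := by
      simp only [hS, hf, Finset.sum_apply, indicator_apply]
      simp
    have h1 : (N : ℝ) ≤ n * p' / 2 := hN.trans (by gcongr)
    have h2 : (N : ℝ) ≤ ((Finset.univ.filter fun i => x i ∈ A).card : ℝ) := by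
      rw [← hcard]; linarith [hx.1]
    exact_mod_cast h2

theorem measurable_neg_preimage_real {A : Set ℝ} (hA : MeasurableSet A) :
    MeasurableSet {x : ℝ | -x ∈ A} := measurable_neg hA

/-- With probability tending to one, uniformly over designs with density at least `flo` on `(a, b)`,
the Gram matrix is invertible and no squared weight exceeds a fraction `η` of their sum. -/
theorem WindowAsymptotics.eventually_weights {K : ℝ → ℝ} (hK : IsKernel K) {h d : ℕ → ℝ}
    (hd : ∀ n, 0 ≤ d n ∧ d n < h n) {a b κ l flo : ℝ} (hκ : 0 < κ) (hl : 0 < l) (hflo : 0 < flo)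
    (hW : WindowAsymptotics K h d a b κ l) {η ε : ℝ} (hη : 0 < η) (hε : 0 < ε) :
    ∀ᶠ n in atTop, ∀ ν : Measure ℝ, IsProbabilityMeasure ν →
      (∀ A ⊆ Ioo a b, MeasurableSet A → flo * volume.real A ≤ ν.real A) →
      ∃ B : Set (Fin n → ℝ), MeasurableSet B ∧ (Measure.pi fun _ => ν) B ≤ ENNReal.ofReal ε ∧
        ∀ x ∉ B, IsUnit (gram K (h n) (d n) x).det ∧
          ∀ i, weight K (h n) (d n) x i ^ 2 ≤ η * ∑ j, weight K (h n) (d n) x j ^ 2 := by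
  -- The separation from `exists_separated_subsets`, capped at `1` as `abs_affine_le` requires.
  set γ := min (l / 3) 1 with hγ
  have hγ0 : 0 < γ := lt_min (by positivity) one_pos
  have hγ1 : γ ≤ 1 := min_le_right _ _
  -- A fixed number of observations per region that suffices for the fraction `η`.
  obtain ⟨N, hN⟩ := exists_nat_gt (9 / (γ ^ 2 * κ ^ 2 * η))
  have hN0' : (0 : ℝ) < N := lt_trans (by positivity) hN
  have hN0 : 0 < N := by exact_mod_cast hN0'
  have hNη : 9 / (γ ^ 2 * κ ^ 2 * N) ≤ η := by
    rw [div_le_iff₀ (by positivity)]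
    rw [div_lt_iff₀ (by positivity)] at hN
    linarith
  set q := flo * (l / 3) with hq
  have hq0 : 0 < q := by positivity
  -- The first lower bound on `n (h - d)` puts `N` below half the expected count; the second makes
  -- each of the four regions fail with probability at most `ε / 4`.
  filter_upwards [hW.spread, hW.inside, hW.sampleSize.eventually_ge_atTop (2 * N / q),
    hW.sampleSize.eventually_ge_atTop (16 / (q * ε)), eventually_gt_atTop 0]
    with n hsp hin hn1 hn2 hn0 ν hν hdens
  obtain ⟨hd0, hdh⟩ := hd n
  have hlen : 0 < h n - d n := by linarith
  have hn0' : (0 : ℝ) < n := by exact_mod_cast hn0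
  obtain ⟨b', hb', hle, hvol⟩ := hsp
  have hKm : Measurable fun x => K (x / h n) := hK.measurable.comp (measurable_id.div_const _)
  obtain ⟨A₁, A₂, hs₁, hs₂, hm₁, hm₂, hgap, hv₁, hv₂⟩ := exists_separated_subsets
    (measurableSet_Ioc.inter (measurableSet_le measurable_const hKm)) (sep_subset _ _) hdh hl hvol
  have hR : KernelRegions K (h n) (d n) κ γ b' A₁ A₂ :=
    ⟨hb', hle, hs₁.trans (sep_subset _ _), hs₂.trans (sep_subset _ _), fun x hx => (hs₁ hx).2,
      fun x hx => (hs₂ hx).2, fun x hx y hy =>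
        (mul_le_mul_of_nonneg_right (min_le_left _ _) hlen.le).trans (hgap x hx y hy)⟩
  set p := q * (h n - d n) with hp
  have hp0 : 0 < p := by positivity
  have hNp : (N : ℝ) ≤ n * p / 2 := by
    rw [div_le_iff₀ hq0] at hn1
    rw [hp]; linarith
  have hεp : 4 / (n * p) ≤ ε / 4 := by
    rw [div_le_iff₀ (by positivity)] at hn2
    rw [div_le_div_iff₀ (by positivity) (by positivity), hp]
    linarith
  have prob : ∀ A ⊆ Ioc (d n) (h n), MeasurableSet A → l / 3 * (h n - d n) ≤ volume.real A →
      p ≤ ν.real A ∧ p ≤ ν.real {x | -x ∈ A} := by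
    intro A hAs hAm hAv
    have e : volume.real {x | -x ∈ A} = volume.real A := by
      simp only [measureReal_def]
      congr 1
      exact Measure.measure_neg (volume : Measure ℝ) A
    have h1 : p ≤ flo * volume.real A := by
      rw [hp, hq, mul_assoc]; exact mul_le_mul_of_nonneg_left hAv hflo.le
    refine ⟨h1.trans (hdens A (fun x hx => hin ?_) hAm), ?_⟩
    · have := hAs hx
      exact ⟨by linarith [this.1], this.2⟩
    · rw [← e] at h1
      refine h1.trans (hdens _ (fun x hx => hin ?_) (measurable_neg_preimage_real hAm))
      have := hAs hx
      exact ⟨by linarith [this.2], by linarith [this.1]⟩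
  obtain ⟨p₁, p₃⟩ := prob A₁ hR.subset₁ hm₁ hv₁
  obtain ⟨p₂, p₄⟩ := prob A₂ hR.subset₂ hm₂ hv₂
  obtain ⟨B₁, hB₁, hBε₁, H₁⟩ := measure_count_lt_le hm₁ hp0 p₁ hn0 hNp
  obtain ⟨B₂, hB₂, hBε₂, H₂⟩ := measure_count_lt_le hm₂ hp0 p₂ hn0 hNp
  obtain ⟨B₃, hB₃, hBε₃, H₃⟩ :=
    measure_count_lt_le (measurable_neg_preimage_real hm₁) hp0 p₃ hn0 hNp
  obtain ⟨B₄, hB₄, hBε₄, H₄⟩ :=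
    measure_count_lt_le (measurable_neg_preimage_real hm₂) hp0 p₄ hn0 hNp
  refine ⟨B₁ ∪ B₂ ∪ (B₃ ∪ B₄), (hB₁.union hB₂).union (hB₃.union hB₄), ?_, fun x hx => ?_⟩
  · have hε4 := ENNReal.ofReal_le_ofReal hεp
    calc _ ≤ ENNReal.ofReal (ε / 4) + ENNReal.ofReal (ε / 4) +
          (ENNReal.ofReal (ε / 4) + ENNReal.ofReal (ε / 4)) :=
          (measure_union_le _ _).trans (add_le_add
            ((measure_union_le _ _).trans (add_le_add (hBε₁.trans hε4) (hBε₂.trans hε4)))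
            ((measure_union_le _ _).trans (add_le_add (hBε₃.trans hε4) (hBε₄.trans hε4))))
      _ = ENNReal.ofReal ε := by
          rw [← ENNReal.ofReal_add (by positivity) (by positivity),
            ← ENNReal.ofReal_add (by positivity) (by positivity)]
          congr 1; ring
  · simp only [mem_union, not_or] at hx
    obtain ⟨⟨x1, x2⟩, x3, x4⟩ := hx
    obtain ⟨r₁, hr₁, nr₁⟩ := H₁ x x1
    obtain ⟨r₂, hr₂, nr₂⟩ := H₂ x x2
    obtain ⟨l₁, hl₁, nl₁⟩ := H₃ x x3
    obtain ⟨l₂, hl₂, nl₂⟩ := H₄ x x4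
    have ex : ∀ {s : Finset (Fin n)} {Q : Fin n → Prop}, (∀ i ∈ s, Q i) → N ≤ s.card →
        ∃ i, Q i := fun hs hc => by
      obtain ⟨i, hi⟩ := Finset.card_pos.1 (hN0.trans_le hc)
      exact ⟨i, hs i hi⟩
    refine ⟨isUnit_det_gram_of_regions hK hd0 hdh hκ hγ0 hR (ex hr₁ nr₁) (ex hr₂ nr₂) (ex hl₁ nl₁)
      (ex hl₂ nl₂), fun i => ?_⟩
    refine (sq_weight_le_of_count hK hd0 hdh hκ hγ0 hγ1 hR hN0 hr₁ hr₂ hl₁ hl₂ nr₁ nr₂ nl₁ nl₂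
      i).trans (mul_le_mul_of_nonneg_right hNη (Finset.sum_nonneg fun _ _ => sq_nonneg _))

/-! ### Conditional law of the outcome given the running variable -/

theorem measurable_outcome1 : Measurable outcome1 := measurable_fst

theorem measurable_outcome0 : Measurable outcome0 := measurable_snd.fst

theorem measurable_naturalX : Measurable naturalX := measurable_snd.snd.fst

theorem measurable_observedX : Measurable observedX := measurable_snd.snd.snd

theorem measurable_outcome : Measurable outcome :=
  Measurable.ite (measurableSet_le measurable_const measurable_observedX) measurable_outcome1
    measurable_outcome0

theorem IsDonutModel.integrable_outcome {P : Measure RDUnit} {d : ℝ} {m : ℝ → ℝ}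
    (hP : IsDonutModel P d m) : Integrable outcome P := by
  refine (hP.integrable_outcome1.norm.add hP.integrable_outcome0.norm).mono'
    measurable_outcome.aestronglyMeasurable (ae_of_all _ fun u => ?_)
  simp only [outcome, Pi.add_apply]
  split_ifs
  · linarith [norm_nonneg (outcome0 u)]
  · linarith [norm_nonneg (outcome1 u)]

/-- Outside the donut, the observed and the natural running variable agree, so that a version of the
conditional mean of a potential outcome given the latter is one given the former. -/
theorem IsDonutModel.condExp_outcome_eq_on {P : Measure RDUnit} [IsProbabilityMeasure P] {d : ℝ}
    {m : ℝ → ℝ} (hP : IsDonutModel P d m) {Z : RDUnit → ℝ} (hZ : Integrable Z P) {g : ℝ → ℝ}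
    (hg : Measurable g) (hZg : P[Z | naturalSigma] =ᵐ[P] fun u => g (naturalX u)) {D : Set ℝ}
    (hD : MeasurableSet D) (hDd : ∀ x ∈ D, d ≤ |x|) (hDZ : ∀ u, observedX u ∈ D → outcome u = Z u) :
    ∀ᵐ u ∂P, observedX u ∈ D → (P[outcome | observedSigma]) u = g (observedX u) := by
  have hle : observedSigma ≤ (inferInstance : MeasurableSpace RDUnit) :=
    measurable_observedX.comap_le
  have hle' : naturalSigma ≤ (inferInstance : MeasurableSpace RDUnit) :=
    measurable_naturalX.comap_le
  -- A unit with natural value inside the donut is observed inside it, so it never contributes to an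
  -- event in `D`. The exceptional null set does not depend on `B`.
  have hswap : ∀ᵐ u ∂P, ∀ B ⊆ D, (observedX u ∈ B ↔ naturalX u ∈ B) ∧
      (observedX u ∈ B → observedX u = naturalX u) := by
    filter_upwards [hP.outside, hP.inside] with u h1 h2 B hB
    by_cases hn : |naturalX u| < d
    · have h3 := h2 hn
      refine ⟨⟨fun h => ?_, fun h => ?_⟩, fun h => ?_⟩
      · linarith [hDd _ (hB h)]
      · linarith [hDd _ (hB h)]
      · linarith [hDd _ (hB h)]
    · rw [h1 (not_lt.1 hn)]
      exact ⟨Iff.rfl, fun _ => rfl⟩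
  have hDm : MeasurableSet[observedSigma] (observedX ⁻¹' D) := ⟨D, hD, rfl⟩
  have hgi : Integrable (fun u => g (naturalX u)) P := integrable_condExp.congr hZg
  have hGi : Integrable ((observedX ⁻¹' D).indicator fun u => g (observedX u)) P := by
    refine (hgi.indicator (measurable_observedX hD)).congr ?_
    filter_upwards [hswap] with u hu
    by_cases h : u ∈ observedX ⁻¹' D
    · rw [indicator_of_mem h, indicator_of_mem h, (hu D Subset.rfl).2 h]
    · rw [indicator_of_notMem h, indicator_of_notMem h]
  -- Events about `X` within `D` are events about `X*` up to null sets, so the defining integrals of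
  -- the two conditional expectations coincide.
  have key : ((observedX ⁻¹' D).indicator fun u => g (observedX u)) =ᵐ[P]
      P[(observedX ⁻¹' D).indicator outcome | observedSigma] := by
    refine ae_eq_condExp_of_forall_setIntegral_eq hle
      (hP.integrable_outcome.indicator (measurable_observedX hD)) (fun s _ _ => hGi.integrableOn)
      ?_ ?_
    · rintro s ⟨A, hA, rfl⟩ -
      have hB : MeasurableSet (A ∩ D) := hA.inter hD
      have hpre : observedX ⁻¹' (A ∩ D) =ᵐ[P] naturalX ⁻¹' (A ∩ D) := by
        filter_upwards [hswap] with u hu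
        exact propext (hu _ inter_subset_right).1
      rw [setIntegral_indicator (measurable_observedX hD),
        setIntegral_indicator (measurable_observedX hD), ← preimage_inter]
      calc ∫ u in observedX ⁻¹' (A ∩ D), g (observedX u) ∂P
          = ∫ u in observedX ⁻¹' (A ∩ D), g (naturalX u) ∂P := by
            refine setIntegral_congr_ae (measurable_observedX hB) ?_
            filter_upwards [hswap] with u hu h
            rw [(hu _ inter_subset_right).2 h]
        _ = ∫ u in naturalX ⁻¹' (A ∩ D), g (naturalX u) ∂P := setIntegral_congr_set hpre
        _ = ∫ u in naturalX ⁻¹' (A ∩ D), (P[Z | naturalSigma]) u ∂P := by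
            refine setIntegral_congr_ae (measurable_naturalX hB) ?_
            filter_upwards [hZg] with u hu _
            rw [hu]
        _ = ∫ u in naturalX ⁻¹' (A ∩ D), Z u ∂P := setIntegral_condExp hle' hZ ⟨_, hB, rfl⟩
        _ = ∫ u in observedX ⁻¹' (A ∩ D), Z u ∂P := setIntegral_congr_set hpre.symm
        _ = ∫ u in observedX ⁻¹' (A ∩ D), outcome u ∂P :=
            setIntegral_congr_fun (measurable_observedX hB) fun u hu => (hDZ u hu.2).symm
    · refine StronglyMeasurable.aestronglyMeasurable ?_
      refine StronglyMeasurable.indicator ?_ hDm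
      exact (hg.comp (comap_measurable observedX)).stronglyMeasurable
  filter_upwards [key, condExp_indicator hP.integrable_outcome hDm] with u h1 h2 hu
  have hu' : u ∈ observedX ⁻¹' D := hu
  rw [h2, indicator_of_mem hu', indicator_of_mem hu'] at h1
  exact h1.symm

theorem IsDonutModel.condExp_outcome_eq {P : Measure RDUnit} [IsProbabilityMeasure P] {d : ℝ}
    {m : ℝ → ℝ} (hP : IsDonutModel P d m) :
    ∀ᵐ u ∂P, d ≤ |observedX u| → (P[outcome | observedSigma]) u = m (observedX u) := by
  obtain ⟨g₁, g₀, h₁, h₀, e₁, e₀, hm⟩ := hP.mean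
  have hD : MeasurableSet {x : ℝ | d ≤ |x|} := measurableSet_le measurable_const measurable_norm
  have k₁ := hP.condExp_outcome_eq_on hP.integrable_outcome1 h₁.measurable e₁
    (D := {x | d ≤ |x|} ∩ Ici 0) (hD.inter measurableSet_Ici) (fun x hx => hx.1)
    (fun u hu => if_pos hu.2)
  have k₀ := hP.condExp_outcome_eq_on hP.integrable_outcome0 h₀.measurable e₀
    (D := {x | d ≤ |x|} ∩ Iio 0) (hD.inter measurableSet_Iio) (fun x hx => hx.1)
    (fun u hu => if_neg (not_le.2 hu.2))
  filter_upwards [k₁, k₀] with u h1 h0 hu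
  rw [hm]
  split_ifs with h
  · exact h1 ⟨hu, h⟩
  · exact h0 ⟨hu, not_le.1 h⟩

theorem HasRegularDensity.le_measureReal {P : Measure RDUnit} [IsProbabilityMeasure P]
    {a b lo hi : ℝ} (hP : HasRegularDensity P a b lo hi) (hlo : 0 ≤ lo) {A : Set ℝ}
    (hA : A ⊆ Ioo a b) (hAm : MeasurableSet A) :
    lo * volume.real A ≤ (P.map observedX).real A := by
  obtain ⟨f, hf, -, hmap, -, hb⟩ := hP
  have : IsProbabilityMeasure (P.map observedX) :=
    Measure.isProbabilityMeasure_map measurable_observedX.aemeasurable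
  have h1 : ENNReal.ofReal lo * volume A ≤ P.map observedX A := by
    rw [hmap, withDensity_apply _ hAm, ← setLIntegral_const]
    exact setLIntegral_mono hf.ennreal_ofReal fun x hx => ENNReal.ofReal_le_ofReal (hb x (hA hx)).1
  have h2 := ENNReal.toReal_mono (measure_ne_top _ _) h1
  rwa [ENNReal.toReal_mul, ENNReal.toReal_ofReal hlo] at h2

theorem HasRegularDensity.ae_ne_zero {P : Measure RDUnit} {a b lo hi : ℝ}
    (hP : HasRegularDensity P a b lo hi) : ∀ᵐ x ∂(P.map observedX), x ≠ 0 := by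
  obtain ⟨f, -, -, hmap, -⟩ := hP
  rw [hmap]
  refine withDensity_absolutelyContinuous _ _ |>.ae_le ?_
  exact compl_mem_ae_iff.2 (by simp : volume ({0} : Set ℝ) = 0)

/-- The conditional law of the observed outcome given the observed running variable has the mean,
variance and moments that the model prescribes. -/
theorem exists_conditional_law {P : Measure RDUnit} [IsProbabilityMeasure P] {d : ℝ} {m : ℝ → ℝ}
    (hP : IsDonutModel P d m) {a b flo fhi : ℝ} (hdens : HasRegularDensity P a b flo fhi)
    {q C vlo : ℝ} {L : NNReal} {σsq : ℝ → ℝ} (hq : 2 < q) (herr : HasRegularErrors P q C vlo L σsq) :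
    ∃ κ : Kernel ℝ ℝ, IsMarkovKernel κ ∧
      P.map (fun u => (observedX u, outcome u)) = P.map observedX ⊗ₘ κ ∧
      ∃ g : ℝ → ℝ, ∀ᵐ x ∂(P.map observedX), Integrable (fun y => |y - g x| ^ q) (κ x) ∧
        ∫ y, |y - g x| ^ q ∂(κ x) ≤ C ∧ ∫ y, y ∂(κ x) = g x ∧
        ∫ y, (y - g x) ^ 2 ∂(κ x) = σsq x ∧ vlo ≤ σsq x ∧ (d ≤ |x| → g x = m x) := by
  have hX := measurable_observedX
  have hY := measurable_outcome
  set κ := condDistrib outcome observedX P with hκ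
  set g : ℝ → ℝ := fun x => ∫ y, y ∂(κ x) with hg
  have hgm : Measurable g := (StronglyMeasurable.integral_condDistrib
    (Y := outcome) (X := observedX) (μ := P) (f := fun z : ℝ × ℝ => z.2)
    measurable_snd.stronglyMeasurable).measurable
  have hmean : P[outcome | observedSigma] =ᵐ[P] fun u => g (observedX u) := by
    exact condExp_ae_eq_integral_condDistrib' hX hP.integrable_outcome
  have hmapc : P.map observedX ⊗ₘ κ = P.map (fun u => (observedX u, outcome u)) :=
    compProd_map_condDistrib hY.aemeasurable
  have hgX : ∀ᵐ u ∂P, d ≤ |observedX u| → g (observedX u) = m (observedX u) := by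
    filter_upwards [hP.condExp_outcome_eq, hmean] with u h1 h2 hu
    rw [← h2, h1 hu]
  have hmm : Measurable m := by
    obtain ⟨g₁, g₀, h₁, h₀, -, -, hm⟩ := hP.mean
    have : m = fun x => if 0 ≤ x then g₁ x else g₀ x := funext hm
    rw [this]
    exact Measurable.ite measurableSet_Ici h₁.measurable h₀.measurable
  have hFm : Measurable fun z : ℝ × ℝ => |z.2 - g z.1| ^ q :=
    (measurable_norm.comp (measurable_snd.sub (hgm.comp measurable_fst))).pow_const q
  have hFm2 : Measurable fun z : ℝ × ℝ => (z.2 - g z.1) ^ 2 :=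
    (measurable_snd.sub (hgm.comp measurable_fst)).pow_const 2
  have hFe : (fun u => |outcome u - (P[outcome | observedSigma]) u| ^ q) =ᵐ[P]
      fun u => |outcome u - g (observedX u)| ^ q := by
    filter_upwards [hmean] with u hu
    rw [hu]
  have hFi : Integrable (fun u => |outcome u - g (observedX u)| ^ q) P := herr.integrable.congr hFe
  have hFi2 : Integrable (fun u => (outcome u - g (observedX u)) ^ 2) P := by
    refine ((integrable_const (1 : ℝ)).add hFi).mono'
      (hFm2.comp (hX.prodMk hY)).aestronglyMeasurable (ae_of_all _ fun u => ?_)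
    rw [Real.norm_eq_abs, abs_of_nonneg (sq_nonneg _), ← sq_abs, ← Real.rpow_two]
    exact abs_rpow_le_one_add (by norm_num) hq.le _
  have hq1 : ∀ᵐ x ∂(P.map observedX), Integrable (fun y => |y - g x| ^ q) (κ x) := by
    have : Integrable (fun z : ℝ × ℝ => |z.2 - g z.1| ^ q)
        (P.map fun u => (observedX u, outcome u)) :=
      (integrable_map_measure hFm.aestronglyMeasurable (hX.prodMk hY).aemeasurable).2 hFi
    exact this.condDistrib_ae_map hY.aemeasurable
  have toMap : ∀ {s : Set ℝ}, MeasurableSet s → (∀ᵐ u ∂P, observedX u ∈ s) →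
      ∀ᵐ x ∂(P.map observedX), x ∈ s := fun hs h =>
    (ae_map_iff hX.aemeasurable hs).2 h
  have hIm : Measurable fun x => ∫ y, |y - g x| ^ q ∂(κ x) :=
    (hFm.stronglyMeasurable.integral_condDistrib (Y := outcome) (X := observedX) (μ := P)).measurable
  have hIm2 : Measurable fun x => ∫ y, (y - g x) ^ 2 ∂(κ x) :=
    (hFm2.stronglyMeasurable.integral_condDistrib
      (Y := outcome) (X := observedX) (μ := P)).measurable
  have hq2 : ∀ᵐ x ∂(P.map observedX), ∫ y, |y - g x| ^ q ∂(κ x) ≤ C := by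
    refine toMap (s := {x | ∫ y, |y - g x| ^ q ∂(κ x) ≤ C})
      (measurableSet_le hIm measurable_const) ?_
    filter_upwards [herr.bounded, condExp_congr_ae (m := observedSigma) hFe,
      condExp_prod_ae_eq_integral_condDistrib hX hY.aemeasurable hFm.stronglyMeasurable hFi]
      with u h1 h2 h3
    exact (h3.symm.trans h2.symm).trans_le h1
  have hv : ∀ᵐ x ∂(P.map observedX), ∫ y, (y - g x) ^ 2 ∂(κ x) = σsq x := by
    refine toMap (s := {x | ∫ y, (y - g x) ^ 2 ∂(κ x) = σsq x})
      (measurableSet_eq_fun hIm2 herr.measurable) ?_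
    have hVe : ((outcome - P[outcome | observedSigma]) ^ 2 : RDUnit → ℝ) =ᵐ[P]
        fun u => (outcome u - g (observedX u)) ^ 2 := by
      filter_upwards [hmean] with u hu
      simp [hu]
    filter_upwards [herr.variance, condExp_congr_ae (m := observedSigma) hVe,
      condExp_prod_ae_eq_integral_condDistrib hX hY.aemeasurable hFm2.stronglyMeasurable hFi2]
      with u h1 h2 h3
    exact (h3.symm.trans h2.symm).trans h1
  have hgm' : ∀ᵐ x ∂(P.map observedX), d ≤ |x| → g x = m x := by
    refine toMap (s := {x | d ≤ |x| → g x = m x}) ?_ hgX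
    have : {x | d ≤ |x| → g x = m x} = {x | d ≤ |x|}ᶜ ∪ {x | g x = m x} := by
      ext x; simp [imp_iff_not_or]
    rw [this]
    exact (measurableSet_le measurable_const measurable_norm).compl.union
      (measurableSet_eq_fun hgm hmm)
  -- The support has full measure, and the excluded point `0` is null because `X` has a density.
  have hlow : ∀ᵐ x ∂(P.map observedX), vlo ≤ σsq x := by
    filter_upwards [hdens.ae_ne_zero, Measure.support_mem_ae (μ := P.map observedX)] with x h1 h2
    exact herr.lower x ⟨h2, h1⟩
  refine ⟨κ, inferInstance, hmapc.symm, g, ?_⟩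
  filter_upwards [hq1, hq2, hv, hgm', hlow] with x h1 h2 h3 h4 h5
  exact ⟨h1, h2, rfl, h3, h5, h4⟩

/-! ### Samples, conditionally on the running variable -/

/-- Drawing from the kernel by a transformed uniform variable turns the composition into an image of
a product measure, whose coordinates can be regrouped across the sample. -/
theorem compProd_eq_map_prod {ν : Measure ℝ} [IsProbabilityMeasure ν] {κ : Kernel ℝ ℝ}
    [IsMarkovKernel κ] {f : ℝ → unitInterval → ℝ} (hf : Measurable (Function.uncurry f))
    (hκ : ∀ x, (volume : Measure unitInterval).map (f x) = κ x) :
    ν ⊗ₘ κ = (ν.prod (volume : Measure unitInterval)).map fun z => (z.1, f z.1 z.2) := by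
  have hm : Measurable fun z : ℝ × unitInterval => (z.1, f z.1 z.2) := measurable_fst.prodMk hf
  ext s hs
  rw [Measure.compProd_apply hs, Measure.map_apply hm hs, Measure.prod_apply (hm hs)]
  refine lintegral_congr fun x => ?_
  have hfx : Measurable (f x) := hf.comp measurable_prodMk_left
  rw [← hκ x, Measure.map_apply hfx (measurable_prodMk_left hs)]
  rfl

/-- Lower bound for the probability of an event in terms of conditional probabilities. -/
theorem mul_measure_compl_le_pi_compProd {n : ℕ} {ν : Measure ℝ} [IsProbabilityMeasure ν]
    {κ : Kernel ℝ ℝ} [IsMarkovKernel κ] {A : Set (Fin n → ℝ × ℝ)} (hA : MeasurableSet A)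
    {B : Set (Fin n → ℝ)} (hB : MeasurableSet B) {c : ENNReal}
    (h : ∀ᵐ x ∂(Measure.pi fun _ : Fin n => ν), x ∉ B →
      c ≤ (Measure.pi fun i => κ (x i)) {y | (fun i => (x i, y i)) ∈ A}) :
    c * (Measure.pi fun _ => ν) Bᶜ ≤ (Measure.pi fun _ : Fin n => ν ⊗ₘ κ) A := by
  obtain ⟨f, hf, hκ⟩ := Kernel.exists_measurable_map_eq_unitInterval κ
  set Φ : (Fin n → ℝ) × (Fin n → unitInterval) → (Fin n → ℝ × ℝ) :=
    fun z i => (z.1 i, f (z.1 i) (z.2 i)) with hΦ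
  have hm : Measurable fun z : ℝ × unitInterval => (z.1, f z.1 z.2) := measurable_fst.prodMk hf
  have hΦm : Measurable Φ := by
    refine measurable_pi_lambda _ fun i => ?_
    have h1 : Measurable fun z : (Fin n → ℝ) × (Fin n → unitInterval) => (z.1 i, z.2 i) := by
      fun_prop
    exact hm.comp h1
  -- The sample is an image of all running variables together with independent uniforms, so Fubini
  -- conditions on the whole vector of running variables at once.
  have hpi : (Measure.pi fun _ : Fin n => ν ⊗ₘ κ) =
      ((Measure.pi fun _ : Fin n => ν).prod
        (Measure.pi fun _ : Fin n => (volume : Measure unitInterval))).map Φ := by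
    rw [compProd_eq_map_prod hf hκ, ← Measure.pi_map_pi (fun _ => hm.aemeasurable)]
    have := (measurePreserving_arrowProdEquivProdArrow ℝ unitInterval (Fin n) (fun _ => ν)
      (fun _ => volume)).map_eq
    rw [← this, Measure.map_map hΦm (MeasurableEquiv.measurable _)]
    rfl
  rw [hpi, Measure.map_apply hΦm hA, Measure.prod_apply (hΦm hA), ← setLIntegral_const]
  refine le_trans (lintegral_mono_ae ?_) (setLIntegral_le_lintegral Bᶜ _)
  refine (ae_restrict_iff' hB.compl).2 ?_
  filter_upwards [h] with x hx hxB
  refine (hx hxB).trans (le_of_eq ?_)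
  have hfx : ∀ i, Measurable (f (x i)) := fun i => hf.comp measurable_prodMk_left
  have e : (Measure.pi fun i => κ (x i)) =
      (Measure.pi fun _ : Fin n => (volume : Measure unitInterval)).map
        fun v i => f (x i) (v i) := by
    have : ∀ i, IsProbabilityMeasure ((volume : Measure unitInterval).map (f (x i))) := fun i =>
      Measure.isProbabilityMeasure_map (hfx i).aemeasurable
    rw [Measure.pi_map_pi (fun i => (hfx i).aemeasurable)]
    simp only [hκ]
  have hym : Measurable fun y : Fin n → ℝ => fun i => (x i, y i) :=
    measurable_pi_lambda _ fun i => measurable_const.prodMk (measurable_pi_apply i)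
  have hfm : Measurable fun (v : Fin n → unitInterval) i => f (x i) (v i) :=
    measurable_pi_lambda _ fun i => (hfx i).comp (measurable_pi_apply i)
  have hAx : MeasurableSet {y : Fin n → ℝ | (fun i => (x i, y i)) ∈ A} := hym hA
  rw [e, Measure.map_apply hfm hAx]
  rfl

theorem sampleLaw_map_sampleData {n : ℕ} (P : Measure RDUnit) [IsProbabilityMeasure P] :
    (sampleLaw n P).map sampleData =
      Measure.pi fun _ => P.map (fun u => (observedX u, outcome u)) := by
  have hm : Measurable fun u : RDUnit => (observedX u, outcome u) :=
    measurable_observedX.prodMk measurable_outcome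
  have : IsProbabilityMeasure (P.map fun u => (observedX u, outcome u)) :=
    Measure.isProbabilityMeasure_map hm.aemeasurable
  rw [sampleLaw, ← Measure.pi_map_pi (fun _ => hm.aemeasurable)]
  rfl

/-! ### Measurability of the estimator and of the interval -/

/-- As the infimum is attained and the mass increases with the half-length, a sublevel set is
described by the mass at a single half-length, which is continuous in `r`. -/
theorem measurable_criticalValue {p : ℝ} (hp : 0 < p) (hp1 : p < 1) :
    Measurable (criticalValue p) := by
  refine measurable_of_Iic fun t => ?_
  rcases lt_or_ge t 0 with ht | ht
  · have : criticalValue p ⁻¹' Iic t = ∅ := by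
      ext r
      simp only [mem_preimage, mem_Iic, mem_empty_iff_false, iff_false, not_le]
      exact ht.trans_le (criticalValue_nonneg hp hp1 r)
    rw [this]
    exact MeasurableSet.empty
  · have : criticalValue p ⁻¹' Iic t =
        {r | p ≤ ∫ z in (-t - r)..(t - r), gaussianPDFReal 0 1 z} := by
      ext r
      rw [mem_preimage, mem_Iic, mem_ofPred_eq, ← gaussianReal_real_Icc (by linarith)]
      refine ⟨fun h => (le_gaussianReal_real_criticalValue hp hp1 r).trans
        (measureReal_mono (Icc_subset_Icc (by linarith) (by linarith))), criticalValue_le hp⟩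
    rw [this]
    have hprim := intervalIntegral.continuous_primitive intervalIntegrable_gaussianPDFReal 0
    have e : (fun r : ℝ => ∫ z in (-t - r)..(t - r), gaussianPDFReal 0 1 z) = fun r =>
        (∫ z in (0:ℝ)..(t - r), gaussianPDFReal 0 1 z) -
          ∫ z in (0:ℝ)..(-t - r), gaussianPDFReal 0 1 z := by
      ext r
      rw [intervalIntegral.integral_interval_sub_left (intervalIntegrable_gaussianPDFReal _ _)
        (intervalIntegrable_gaussianPDFReal _ _)]
    refine measurableSet_le measurable_const ?_
    rw [e]
    exact ((hprim.comp (by fun_prop)).sub (hprim.comp (by fun_prop))).measurable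

section Measurability

variable {n : ℕ} {K : ℝ → ℝ} {h d : ℝ}

theorem measurable_kernelWeight (hK : Measurable K) : Measurable (kernelWeight K h d) :=
  Measurable.ite (measurableSet_le measurable_const measurable_norm)
    (hK.comp (measurable_id.div_const h)) measurable_const

theorem measurable_regressor (j : Fin 4) : Measurable fun x => regressor x j := by
  have h0 : MeasurableSet {x : ℝ | 0 ≤ x} := measurableSet_Ici
  fin_cases j
  · exact Measurable.ite h0 measurable_const measurable_const
  · exact measurable_id
  · exact Measurable.ite h0 measurable_id measurable_const
  · exact measurable_const

theorem measurable_gram_apply (hK : Measurable K) (j l : Fin 4) :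
    Measurable fun X : Fin n → ℝ => gram K h d X j l := by
  simp only [gram, Matrix.sum_apply, Matrix.smul_apply, Matrix.vecMulVec_apply, smul_eq_mul]
  exact Finset.measurable_sum _ fun i _ =>
    ((measurable_kernelWeight hK).comp (measurable_pi_apply i)).mul
      (((measurable_regressor j).comp (measurable_pi_apply i)).mul
        ((measurable_regressor l).comp (measurable_pi_apply i)))

theorem measurable_det {α : Type*} [MeasurableSpace α] {G : α → Matrix (Fin 4) (Fin 4) ℝ}
    (hG : ∀ j l, Measurable fun x => G x j l) : Measurable fun x => (G x).det := by
  simp only [Matrix.det_apply]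
  exact Finset.measurable_sum _ fun σ _ => (Finset.measurable_prod _ fun i _ => hG _ _).const_smul _

theorem measurable_inv_apply {α : Type*} [MeasurableSpace α] {G : α → Matrix (Fin 4) (Fin 4) ℝ}
    (hG : ∀ j l, Measurable fun x => G x j l) (j l : Fin 4) :
    Measurable fun x => (G x)⁻¹ j l := by
  simp only [Matrix.inv_def, Matrix.smul_apply, Matrix.adjugate_apply, Ring.inverse_eq_inv',
    smul_eq_mul]
  refine (measurable_det hG).inv.mul (measurable_det fun a b => ?_)
  simp only [Matrix.updateRow_apply]
  split_ifs
  · exact measurable_const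
  · exact hG a b

theorem measurable_weight (hK : Measurable K) (i : Fin n) :
    Measurable fun X : Fin n → ℝ => weight K h d X i := by
  simp only [weight, Matrix.mulVec, dotProduct]
  exact ((measurable_kernelWeight hK).comp (measurable_pi_apply i)).mul
    (Finset.measurable_sum _ fun j _ =>
      (measurable_inv_apply (fun a b => measurable_gram_apply hK a b) 0 j).mul
        ((measurable_regressor j).comp (measurable_pi_apply i)))

theorem measurable_worstCaseBias (hK : Measurable K) (M : ℝ) :
    Measurable fun X : Fin n → ℝ => worstCaseBias K M h d X := by
  have hsign : Measurable Real.sign := by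
    refine Measurable.ite measurableSet_Iio measurable_const
      (Measurable.ite measurableSet_Ioi measurable_const measurable_const)
  simp only [worstCaseBias]
  exact (Finset.measurable_sum _ fun i _ => ((measurable_weight hK i).mul
    ((measurable_pi_apply i).pow_const 2)).mul (hsign.comp (measurable_pi_apply i))).const_mul _

end Measurability

theorem weight_eq_zero_of_abs_lt {n : ℕ} {K : ℝ → ℝ} {h d : ℝ} {X : Fin n → ℝ} {i : Fin n}
    (hi : |X i| < d) : weight K h d X i = 0 := by
  simp [weight, kernelWeight, not_le.2 hi]

/-! ### Coverage -/

/-- Event, in terms of the data, that the estimator deviates from `τ` by at most the half-length of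
the bias-aware interval of level `p` based on the true conditional variances `σ²(Xᵢ)`. -/
def oracleEvent (K : ℝ → ℝ) (M p h d τ : ℝ) (n : ℕ) (σsq : ℝ → ℝ) : Set (Fin n → ℝ × ℝ) :=
  {z | 0 < varianceOf K h d (fun i => (z i).1) (fun i => σsq (z i).1) ∧
    |estimator K h d (fun i => (z i).1) (fun i => (z i).2) - τ| ≤
      criticalValue p (worstCaseBias K M h d (fun i => (z i).1) /
        √(varianceOf K h d (fun i => (z i).1) (fun i => σsq (z i).1))) *
      √(varianceOf K h d (fun i => (z i).1) (fun i => σsq (z i).1))}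

theorem measurableSet_oracleEvent {K : ℝ → ℝ} (hK : Measurable K) (M : ℝ) {p : ℝ} (hp : 0 < p)
    (hp1 : p < 1) (h d τ : ℝ) (n : ℕ) {σsq : ℝ → ℝ} (hσ : Measurable σsq) :
    MeasurableSet (oracleEvent K M p h d τ n σsq) := by
  have hX : Measurable fun (z : Fin n → ℝ × ℝ) i => (z i).1 :=
    measurable_pi_lambda _ fun i => (measurable_pi_apply i).fst
  have hw : ∀ i, Measurable fun z : Fin n → ℝ × ℝ => weight K h d (fun i => (z i).1) i := fun i =>
    (measurable_weight hK i).comp hX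
  have hV : Measurable fun z : Fin n → ℝ × ℝ =>
      varianceOf K h d (fun i => (z i).1) (fun i => σsq (z i).1) := by
    simp only [varianceOf]
    exact Finset.measurable_sum _ fun i _ =>
      ((hw i).pow_const 2).mul (hσ.comp (measurable_pi_apply i).fst)
  have hE : Measurable fun z : Fin n → ℝ × ℝ =>
      estimator K h d (fun i => (z i).1) (fun i => (z i).2) := by
    simp only [estimator]
    exact Finset.measurable_sum _ fun i _ => (hw i).mul (measurable_pi_apply i).snd
  have hle := measurableSet_le (measurable_norm.comp (hE.sub_const τ))
    (((measurable_criticalValue hp hp1).comp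
      (((measurable_worstCaseBias (h := h) (d := d) hK M).comp hX).div hV.sqrt)).mul hV.sqrt)
  exact (measurableSet_lt measurable_const hV).inter hle

/-- On the oracle event, the feasible interval covers as soon as the estimated variance is close to
the true one. -/
theorem mem_confidenceInterval_of_close {n : ℕ} {K : ℝ → ℝ} {M α p h d τ δ : ℝ}
    {X Y v v' : Fin n → ℝ} (hδ1 : δ < 1)
    (hδ : ∀ k : ℝ, 0 < k → |k ^ 2 - 1| ≤ δ → ∀ ρ : ℝ,
      criticalValue p (k * ρ) ≤ k * criticalValue (1 - α) ρ)
    (hV : 0 < varianceOf K h d X v)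
    (hτ : |estimator K h d X Y - τ| ≤ criticalValue p (worstCaseBias K M h d X /
        √(varianceOf K h d X v)) * √(varianceOf K h d X v))
    (hclose : |varianceOf K h d X v' - varianceOf K h d X v| ≤ δ * varianceOf K h d X v) :
    τ ∈ confidenceInterval K M α h d X Y v' := by
  set V := varianceOf K h d X v with hVdef
  set V' := varianceOf K h d X v' with hV'def
  have hV' : 0 < V' := by
    have := (abs_le.1 hclose).1
    nlinarith
  set s := √V with hs
  set s' := √V' with hs'
  have hs0 : 0 < s := Real.sqrt_pos.2 hV
  have hs'0 : 0 < s' := Real.sqrt_pos.2 hV'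
  have hk : |(s' / s) ^ 2 - 1| ≤ δ := by
    rw [div_pow, hs, hs', Real.sq_sqrt hV.le, Real.sq_sqrt hV'.le]
    have : V' / V - 1 = (V' - V) / V := by field_simp
    rw [this, abs_div, abs_of_pos hV, div_le_iff₀ hV]
    exact hclose
  -- With `k = s' / s` and `ρ = b̄ / s'`, the product `k * ρ` is the oracle ratio `b̄ / s`.
  have h1 := hδ (s' / s) (by positivity) hk (worstCaseBias K M h d X / s')
  have e : s' / s * (worstCaseBias K M h d X / s') = worstCaseBias K M h d X / s := by field_simp
  rw [e] at h1
  have h2 := mul_le_mul_of_nonneg_right h1 hs0.le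
  have e2 : s' / s * criticalValue (1 - α) (worstCaseBias K M h d X / s') * s =
      criticalValue (1 - α) (worstCaseBias K M h d X / s') * s' := by field_simp
  rw [e2] at h2
  have h3 := abs_le.1 (hτ.trans h2)
  simp only [confidenceInterval, mem_Icc]
  rw [← hV'def, ← hs']
  constructor <;> linarith [h3.1, h3.2]

/-- Conditional probability of the oracle event, given running variables for which the Gram matrix
is invertible and no weight dominates. -/
theorem oracleEvent_conditional {q C vlo ε : ℝ} (hq : 2 < q) (hvlo : 0 < vlo) (hε : 0 < ε) {p : ℝ}
    (hp : 0 < p) (hp1 : p < 1) :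
    ∃ η > 0, ∀ {n : ℕ} {K : ℝ → ℝ} {M h d : ℝ} {m σsq g : ℝ → ℝ} (κ : ℝ → Measure ℝ)
      [∀ x, IsProbabilityMeasure (κ x)] (x : Fin n → ℝ), (∀ u, 0 ≤ K u) → m ∈ smoothClass M →
      (∀ i, Integrable (fun y => |y - g (x i)| ^ q) (κ (x i)) ∧
        ∫ y, |y - g (x i)| ^ q ∂(κ (x i)) ≤ C ∧ ∫ y, y ∂(κ (x i)) = g (x i) ∧
        ∫ y, (y - g (x i)) ^ 2 ∂(κ (x i)) = σsq (x i) ∧ vlo ≤ σsq (x i) ∧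
        (d ≤ |x i| → g (x i) = m (x i))) →
      IsUnit (gram K h d x).det →
      (∀ i, weight K h d x i ^ 2 ≤ η * ∑ j, weight K h d x j ^ 2) →
      ENNReal.ofReal (p - ε) ≤ (Measure.pi fun i => κ (x i))
        {y | (fun i => (x i, y i)) ∈ oracleEvent K M p h d (jumpAtZero m) n σsq} := by
  obtain ⟨η, hη, H⟩ := exists_gaussian_approximation_weighted (C := C) hq hvlo hε
  refine ⟨η, hη, ?_⟩
  intro n K M h d m σsq g κ _ x hK hm hx hG hw
  have hbias := abs_sum_weight_mul_sub_jump_le hK hG hm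
  have hpos := sum_sq_weight_pos hG
  set w := weight K h d x with hwdef
  set τ := jumpAtZero m with hτ
  set β := worstCaseBias K M h d x with hβ
  have hV : 0 < varianceOf K h d x (fun i => σsq (x i)) := by
    refine lt_of_lt_of_le (mul_pos hpos hvlo) ?_
    rw [Finset.sum_mul]
    exact Finset.sum_le_sum fun i _ =>
      mul_le_mul_of_nonneg_left (hx i).2.2.2.2.1 (sq_nonneg _)
  set s := √(varianceOf K h d x (fun i => σsq (x i))) with hs
  have hs0 : 0 < s := Real.sqrt_pos.2 hV
  set t := criticalValue p (β / s) with ht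
  have ht0 : 0 ≤ t := criticalValue_nonneg hp hp1 _
  -- Inside the donut the conditional mean `g` may differ from `m`, but the weight there is zero.
  have hgm : ∑ i, w i * g (x i) = ∑ i, w i * m (x i) := by
    refine Finset.sum_congr rfl fun i _ => ?_
    by_cases hi : d ≤ |x i|
    · rw [(hx i).2.2.2.2.2 hi]
    · rw [hwdef, weight_eq_zero_of_abs_lt (not_le.1 hi)]; simp
  set δ := ∑ i, w i * g (x i) - τ with hδ
  have hδβ : |δ / s| ≤ β / s := by
    rw [abs_div, abs_of_pos hs0]
    refine div_le_div_of_nonneg_right ?_ hs0.le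
    rw [hδ, hgm]
    exact hbias
  -- Coverage means that the error sum plus the bias `δ` lies within `±t * s`; hence the interval
  -- shifted by `-δ / s`.
  have key := H (fun i => κ (x i)) w (fun i => g (x i)) (fun i => σsq (x i)) (fun i => (hx i).1)
    (fun i => (hx i).2.1) (fun i => (hx i).2.2.1) (fun i => (hx i).2.2.2.1)
    (fun i => (hx i).2.2.2.2.1) hw hpos (-t - δ / s) (t - δ / s)
  have hp' : p ≤ (gaussianReal 0 1).real (Icc (-t - δ / s) (t - δ / s)) :=
    (le_gaussianReal_real_criticalValue hp hp1 (β / s)).trans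
      (gaussianReal_real_Icc_le_of_abs_le ht0 hδβ)
  refine ENNReal.ofReal_le_of_le_toReal ?_
  refine (show p - ε ≤ _ by linarith [key]).trans (measureReal_mono ?_ (measure_ne_top _ _))
  intro y hy
  have hy' : ∑ i, w i * (y i - g (x i)) ∈ Icc ((-t - δ / s) * s) ((t - δ / s) * s) := hy
  refine ⟨hV, ?_⟩
  have e1 : ∑ i, w i * (y i - g (x i)) = (estimator K h d x y - τ) - δ := by
    simp only [mul_sub, Finset.sum_sub_distrib, hδ, estimator]
    ring
  have e2 : (-t - δ / s) * s = -(t * s) - δ := by field_simp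
  have e3 : (t - δ / s) * s = t * s - δ := by field_simp
  rw [e1, e2, e3] at hy'
  change |estimator K h d x y - τ| ≤ t * s
  rw [abs_le]
  constructor <;> linarith [hy'.1, hy'.2]

/-- The oracle event has asymptotic probability at least `p`, uniformly over the populations. -/
theorem WindowAsymptotics.eventually_le_oracleEvent {K : ℝ → ℝ} (hK : IsKernel K) {M : ℝ}
    {h d : ℕ → ℝ} (hd : ∀ n, 0 ≤ d n ∧ d n < h n)
    {P : ℕ → smoothClass M → Measure RDUnit} (hprob : ∀ n m, IsProbabilityMeasure (P n m))
    (hmodel : ∀ n m, IsDonutModel (P n m) (d n) m) {a b flo fhi : ℝ} (hflo : 0 < flo)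
    (hdens : ∀ n m, HasRegularDensity (P n m) a b flo fhi) {q C vlo : ℝ} {L : NNReal} (hq : 2 < q)
    (hvlo : 0 < vlo) {σsq : ℕ → smoothClass M → ℝ → ℝ}
    (herr : ∀ n m, HasRegularErrors (P n m) q C vlo L (σsq n m)) {κ l : ℝ} (hκ : 0 < κ)
    (hl : 0 < l) (hW : WindowAsymptotics K h d a b κ l) {p ε : ℝ} (hε : 0 < ε) (hεp : ε ≤ p)
    (hp1 : p < 1) :
    ∀ᶠ n in atTop, ∀ m : smoothClass M, ENNReal.ofReal (p - 2 * ε) ≤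
      sampleLaw n (P n m) (sampleData ⁻¹'
        oracleEvent K M p (h n) (d n) (jumpAtZero (m : ℝ → ℝ)) n (σsq n m)) := by
  have hp : 0 < p := hε.trans_le hεp
  obtain ⟨η, hη, H⟩ := oracleEvent_conditional (C := C) hq hvlo hε hp hp1
  filter_upwards [hW.eventually_weights hK hd hκ hl hflo hη hε] with n hn m
  have := hprob n m
  have hX := measurable_observedX
  set ν := (P n m).map observedX with hν
  have hνp : IsProbabilityMeasure ν := Measure.isProbabilityMeasure_map hX.aemeasurable
  obtain ⟨k, hk, hlaw, g, hg⟩ := exists_conditional_law (hmodel n m) (hdens n m) hq (herr n m)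
  obtain ⟨B, hB, hBε, hBx⟩ := hn ν hνp fun A hA hAm => (hdens n m).le_measureReal hflo.le hA hAm
  set E := oracleEvent K M p (h n) (d n) (jumpAtZero (m : ℝ → ℝ)) n (σsq n m) with hE
  have hEm : MeasurableSet E :=
    measurableSet_oracleEvent hK.measurable M hp hp1 _ _ _ n (herr n m).measurable
  have hae : ∀ᵐ x ∂(Measure.pi fun _ : Fin n => ν), ∀ i,
      Integrable (fun y => |y - g (x i)| ^ q) (k (x i)) ∧
        ∫ y, |y - g (x i)| ^ q ∂(k (x i)) ≤ C ∧ ∫ y, y ∂(k (x i)) = g (x i) ∧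
        ∫ y, (y - g (x i)) ^ 2 ∂(k (x i)) = σsq n m (x i) ∧ vlo ≤ σsq n m (x i) ∧
        (d n ≤ |x i| → g (x i) = (m : ℝ → ℝ) (x i)) :=
    ae_all_iff.2 fun i =>
      (Measure.tendsto_eval_ae_ae (μ := fun _ : Fin n => ν) (i := i)).eventually hg
  have hmain := mul_measure_compl_le_pi_compProd (ν := ν) (κ := k) hEm hB
    (c := ENNReal.ofReal (p - ε)) (by
      filter_upwards [hae] with x hx hxB
      obtain ⟨hG, hw⟩ := hBx x hxB
      exact H (fun x => k x) x hK.nonneg m.2 hx hG hw)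
  have hdata : Measurable (sampleData : (Fin n → RDUnit) → Fin n → ℝ × ℝ) :=
    measurable_pi_lambda _ fun i =>
      (measurable_observedX.comp (measurable_pi_apply i)).prodMk
        (measurable_outcome.comp (measurable_pi_apply i))
  rw [← hlaw, ← sampleLaw_map_sampleData, Measure.map_apply hdata hEm] at hmain
  refine le_trans ?_ hmain
  -- The loss is `ε` from the normal approximation and `ε` from bad designs: `(p - ε) * (1 - ε) ≥ p
  -- - 2 * ε` since `p < 1`.
  have hc : 1 - ENNReal.ofReal ε ≤ (Measure.pi fun _ : Fin n => ν) Bᶜ := by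
    rw [prob_compl_eq_one_sub hB]
    exact tsub_le_tsub_left hBε 1
  refine le_trans ?_ (mul_le_mul_right hc _)
  rw [← ENNReal.ofReal_one, ← ENNReal.ofReal_sub _ hε.le, ← ENNReal.ofReal_mul (by linarith)]
  refine ENNReal.ofReal_le_ofReal ?_
  nlinarith

end DonutRD

/-! ### Assembly of the error terms. -/

theorem theorem2
    -- smoothness bound and level
    (M α : ℝ) (hM : 0 < M) (hα : α ∈ Set.Ioo (0 : ℝ) 1)
    -- kernel
    (K : ℝ → ℝ) (hK : DonutRD.IsKernel K)
    -- bandwidth and donut size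
    (h d : ℕ → ℝ) (hd : ∀ n, 0 ≤ d n ∧ d n < h n)
    (hasymp :
      (∃ c, DonutRD.SmallDonut c h d ∧ ∃ u ∈ Set.Ioo c 1, 0 < K u) ∨
      (DonutRD.LargeDonut h d ∧ DonutRD.KernelRegularAtEdge K))
    -- populations, one for each sample size and each conditional mean function in `F(M)`
    (P : ℕ → DonutRD.smoothClass M → MeasureTheory.Measure DonutRD.RDUnit)
    (hprob : ∀ n m, MeasureTheory.IsProbabilityMeasure (P n m))
    (hmodel : ∀ n m, DonutRD.IsDonutModel (P n m) (d n) m)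
    -- density of the running variable
    (a b flo fhi : ℝ) (hflo : 0 < flo)
    (hhole : ∀ᶠ n in Filter.atTop, Set.Icc (-(d n)) (d n) ⊆ Set.Ioo a b)
    (hdens : ∀ n m, DonutRD.HasRegularDensity (P n m) a b flo fhi)
    -- conditional moments of the outcome
    (q C vlo : ℝ) (L : NNReal) (hq : 2 < q) (hvlo : 0 < vlo)
    (σsq : ℕ → DonutRD.smoothClass M → ℝ → ℝ)
    (herr : ∀ n m, DonutRD.HasRegularErrors (P n m) q C vlo L (σsq n m))
    -- estimates of the conditional variances, computed from the observed data
    (σhat : ∀ n : ℕ, (Fin n → ℝ × ℝ) → Fin n → ℝ) (hσhat : ∀ n, Measurable (σhat n))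
    -- the variance estimator satisfies `ŝ² = s² (1 + o_P(1))`, uniformly over `F(M)`
    (hcons : ∀ ε : ℝ, 0 < ε →
      Filter.Tendsto
        (fun n : ℕ => ⨆ m : DonutRD.smoothClass M,
          DonutRD.sampleLaw n (P n m)
            {ω | ε * DonutRD.varianceOf K (h n) (d n) (DonutRD.sampleX ω)
                    (fun i => σsq n m (DonutRD.sampleX ω i)) <
                |DonutRD.varianceOf K (h n) (d n) (DonutRD.sampleX ω)
                    (σhat n (DonutRD.sampleData ω)) -
                  DonutRD.varianceOf K (h n) (d n) (DonutRD.sampleX ω)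
                    (fun i => σsq n m (DonutRD.sampleX ω i))|})
        Filter.atTop (nhds 0)) :
    -- asymptotic coverage of `τ* = μ*₊ - μ*₋`, uniformly over `F(M)`
    ENNReal.ofReal (1 - α) ≤
      Filter.liminf
        (fun n : ℕ => ⨅ m : DonutRD.smoothClass M,
          DonutRD.sampleLaw n (P n m)
            {ω | DonutRD.jumpAtZero (m : ℝ → ℝ) ∈
              DonutRD.confidenceInterval K M α (h n) (d n) (DonutRD.sampleX ω)
                (DonutRD.sampleY ω) (σhat n (DonutRD.sampleData ω))})
        Filter.atTop := by
  obtain ⟨κ, hκ, l, hl, hW⟩ := DonutRD.exists_windowAsymptotics hK hd hasymp hhole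
  refine le_of_forall_lt fun c hc => ?_
  have hα1 : 0 < 1 - α := sub_pos.2 hα.2
  have hc' : c.toReal < 1 - α := by
    have := (ENNReal.toReal_lt_toReal hc.ne_top ENNReal.ofReal_ne_top).2 hc
    rwa [ENNReal.toReal_ofReal hα1.le] at this
  have hc0 : 0 ≤ c.toReal := ENNReal.toReal_nonneg
  -- Four losses of `ε` are incurred; the fifth part keeps the inequality with `c` strict.
  set ε := (1 - α - c.toReal) / 5 with hε
  have hε0 : 0 < ε := by rw [hε]; linarith
  obtain ⟨δ, hδ0, hδ1, hδ⟩ := DonutRD.exists_criticalValue_mul_le (p := 1 - α) hε0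
    (by rw [hε]; linarith) (by linarith [hα.1])
  refine lt_of_lt_of_le (b := ENNReal.ofReal (1 - α - 4 * ε)) ?_ ?_
  · rw [← ENNReal.ofReal_toReal hc.ne_top]
    exact (ENNReal.ofReal_lt_ofReal_iff (by rw [hε]; linarith)).2 (by rw [hε]; linarith)
  refine le_liminf_of_le (by isBoundedDefault) ?_
  have horacle := hW.eventually_le_oracleEvent hK hd hprob hmodel hflo hdens hq hvlo herr hκ hl
    (p := 1 - α - ε) hε0 (by rw [hε]; linarith) (by linarith [hα.1])
  have hbad := (hcons δ hδ0).eventually_le_const (ENNReal.ofReal_pos.2 hε0)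
  filter_upwards [horacle, hbad] with n hn hbn
  refine le_iInf fun m => ?_
  have hm := hn m
  have hbm := (le_iSup (fun m : DonutRD.smoothClass M => DonutRD.sampleLaw n (P n m)
    {ω | δ * DonutRD.varianceOf K (h n) (d n) (DonutRD.sampleX ω)
        (fun i => σsq n m (DonutRD.sampleX ω i)) <
      |DonutRD.varianceOf K (h n) (d n) (DonutRD.sampleX ω) (σhat n (DonutRD.sampleData ω)) -
        DonutRD.varianceOf K (h n) (d n) (DonutRD.sampleX ω)
          (fun i => σsq n m (DonutRD.sampleX ω i))|}) m).trans hbn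
  -- The oracle level is lowered by `ε` to absorb the estimation of `s`, its coverage loses `2 * ε`,
  -- and the event of a bad variance estimate has probability at most `ε`.
  have e : 1 - α - 4 * ε = (1 - α - ε - 2 * ε) - ε := by ring
  rw [e, ENNReal.ofReal_sub _ hε0.le]
  refine tsub_le_iff_right.2 (hm.trans ((measure_mono fun ω hω => ?_).trans
    ((measure_union_le _ _).trans (add_le_add le_rfl hbm))))
  by_cases hclose : |DonutRD.varianceOf K (h n) (d n) (DonutRD.sampleX ω)
      (σhat n (DonutRD.sampleData ω)) - DonutRD.varianceOf K (h n) (d n) (DonutRD.sampleX ω)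
        (fun i => σsq n m (DonutRD.sampleX ω i))| ≤
      δ * DonutRD.varianceOf K (h n) (d n) (DonutRD.sampleX ω)
        (fun i => σsq n m (DonutRD.sampleX ω i))
  · exact Or.inl (DonutRD.mem_confidenceInterval_of_close hδ1 hδ hω.1 hω.2 hclose)
  · exact Or.inr (not_le.1 hclose)
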